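/- Let $\mathfrak{e}_8$ be the complex simple Lie algebra of type $E_8$ with a pinning: a Cartan subalgebra $\mathfrak h$, simple roots $\alpha_1,\dots,\alpha_8$ (Bourbaki numbering) with simple coroots $\alpha_i^\vee\in\mathfrak h$, and simple root vectors. Let $\theta$ be the highest root of $\mathfrak{e}_8$ and $\theta'$ the highest root of the $E_7$ subsystem spanned by $\alpha_1,\dots,\alpha_7$. Let $\phi_1,\phi_2:\mathfrak{sl}_2(\mathbb C)\hookrightarrow\mathfrak{e}_8$ be injective Lie algebra homomorphisms mapping $\left(\begin{smallmatrix}0&1\\0&0\end{smallmatrix}\right)$ and $\left(\begin{smallmatrix}0&0\\1&0\end{smallmatrix}\right)$ into the root spaces of $\theta$ and $-\theta$, respectively of $\theta'$ and $-\theta'$. Then the diagonal map $\phi=\phi_1+\phi_2$ is an injective Lie algebra homomorphism $\mathfrak{sl}_2(\mathbb C)\to\mathfrak{e}_8$ of Dynkin index $2$: if $h=\phi\left(\begin{smallmatrix}1&0\\0&-1\end{smallmatrix}\right)$ and $\kappa$ is the Killing form, then $\kappa(h,h)=2\,\kappa(\alpha_i^\vee,\alpha_i^\vee)$ for all $i$.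 Let $\mathfrak c$ be the centralizer of $\phi(\mathfrak{sl}_2)$ in $\mathfrak{e}_8$. For a set $J$ of indices let $\mathfrak g_J$ be the (regular) subalgebra of $\mathfrak{e}_8$ generated by the root spaces of all roots that are integer combinations of the $\alpha_j$, $j\in J$. Then: 1. $\dim\mathfrak c=78$ and $\mathfrak c\cong\mathfrak{so}_{13}(\mathbb C)$. 2. $\mathfrak g_{\{2,\dots,7\}}\subsetneq\mathfrak c\subsetneq\mathfrak g_{\{2,\dots,8\}}$, where $\mathfrak g_{\{2,\dots,7\}}\cong\mathfrak{so}_{12}(\mathbb C)$ and $\mathfrak g_{\{2,\dots,8\}}\cong\mathfrak{so}_{14}(\mathbb C)$. 3. $\mathfrak c\cap\mathfrak h$ is a Cartan subalgebra of $\mathfrak c$, and $\mathfrak c$ has a pinning with this Cartan subalgebra, with Cartan matrix of type $B_6$ ($\beta_6$ the short simple root, at the end of the diagram $\beta_1-\cdots-\beta_5\Rightarrow\beta_6$) and with simple coroots $$\beta_1^\vee=\alpha_3^\vee,\quad \beta_2^\vee=\alpha_4^\vee,\quad \beta_3^\vee=\alpha_5^\vee,\quad \beta_4^\vee=\alpha_6^\vee,\quad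 \beta_5^\vee=\alpha_7^\vee,$$ $$\beta_6^\vee=-\alpha_2^\vee-\alpha_3^\vee-2\alpha_4^\vee-2\alpha_5^\vee-2\alpha_6^\vee-2\alpha_7^\vee.$$ 4. For a suitable isomorphism $\psi:\mathfrak{so}_{13}(\mathbb C)\to\mathfrak c$, the algebra $\mathfrak{e}_8$, with $(X,A)\in\mathfrak{sl}_2\times\mathfrak{so}_{13}$ acting as $\operatorname{ad}(\phi(X)+\psi(A))$, is isomorphic as a representation of $\mathfrak{sl}_2\times\mathfrak{so}_{13}$ to $$1\otimes\mathfrak{so}_{13}\;\oplus\;2\otimes(\text{spin})\;\oplus\;3\otimes 1\;\oplus\;3\otimes(\text{vector}),$$ where $1$, $2$, $3$ on the left of $\otimes$ are the trivial, natural and adjoint representations of $\mathfrak{sl}_2$, of dimensions $1,2,3$; the $1$ on the right of $\otimes$ is the trivial representation of $\mathfrak{so}_{13}$; $\mathfrak{so}_{13}$ is the adjoint representation, vector is the natural representation on $\mathbb C^{13}$, and spin is the representation on a simple module of the Clifford algebra of $\mathbb C^{13}$ (through the standard embedding of $\mathfrak{so}_{13}$ in it). -/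

import Mathlib

attribute [local instance 100] LieRing.ofAssociativeRing

open scoped TensorProduct

noncomputable section

namespace E8

/-! ### Representations of complex Lie algebras -/

/-- The direct sum of two representations. -/
def directSumRep {𝔤 V W : Type*} [LieRing 𝔤] [LieAlgebra ℂ 𝔤]
    [AddCommGroup V] [Module ℂ V] [AddCommGroup W] [Module ℂ W]
    (σ : 𝔤 →ₗ⁅ℂ⁆ Module.End ℂ V) (τ : 𝔤 →ₗ⁅ℂ⁆ Module.End ℂ W) :
    𝔤 →ₗ⁅ℂ⁆ Module.End ℂ (V × W) where
  toFun x := (σ x).prodMap (τ x)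
  map_add' x y := by ext <;> simp
  map_smul' c x := by ext <;> simp
  map_lie' {x y} := by ext <;> simp [LieRing.of_associative_ring_bracket]

/-- The external tensor product `σ ⊗ τ` of a representation of `𝔞` and a representation of `𝔟`,
as a representation of `𝔞 × 𝔟`: `(x, y)` acts as `σ x ⊗ 1 + 1 ⊗ τ y`. -/
def boxTensorRep {𝔞 𝔟 V W : Type*} [LieRing 𝔞] [LieAlgebra ℂ 𝔞] [LieRing 𝔟] [LieAlgebra ℂ 𝔟]
    [AddCommGroup V] [Module ℂ V] [AddCommGroup W] [Module ℂ W]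
    (σ : 𝔞 →ₗ⁅ℂ⁆ Module.End ℂ V) (τ : 𝔟 →ₗ⁅ℂ⁆ Module.End ℂ W) :
    𝔞 × 𝔟 →ₗ⁅ℂ⁆ Module.End ℂ (V ⊗[ℂ] W) where
  toFun x := (σ x.1).rTensor W + (τ x.2).lTensor V
  map_add' x y := by
    simp only [Prod.fst_add, Prod.snd_add, map_add, LinearMap.rTensor_add, LinearMap.lTensor_add]
    abel
  map_smul' c x := by
    simp [LinearMap.rTensor_smul, LinearMap.lTensor_smul]
  map_lie' {x y} := by
    ext v w
    simp [LieRing.of_associative_ring_bracket, LieHom.map_lie, TensorProduct.sub_tmul,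
      TensorProduct.tmul_sub]
    abel

/-- The natural representation on `ℂⁿ` of a Lie algebra of `n × n` matrices: the vector
representation of `𝔰𝔬ₙ`, the two-dimensional irreducible representation of `𝔰𝔩₂`. -/
def naturalRep {n : Type*} [Fintype n] [DecidableEq n] (𝔤 : LieSubalgebra ℂ (Matrix n n ℂ)) :
    𝔤 →ₗ⁅ℂ⁆ Module.End ℂ (n → ℂ) :=
  ((lieEquivMatrix' (R := ℂ) (n := n)).symm : Matrix n n ℂ →ₗ⁅ℂ⁆ Module.End ℂ (n → ℂ)).comp 𝔤.incl

/-- The adjoint representation. -/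
abbrev adjointRep (𝔤 : Type*) [LieRing 𝔤] [LieAlgebra ℂ 𝔤] : 𝔤 →ₗ⁅ℂ⁆ Module.End ℂ 𝔤 :=
  LieAlgebra.ad ℂ 𝔤

/-- The trivial one-dimensional representation. -/
abbrev trivialRep (𝔤 : Type*) [LieRing 𝔤] [LieAlgebra ℂ 𝔤] : 𝔤 →ₗ⁅ℂ⁆ Module.End ℂ ℂ := 0

/-! ### `𝔰𝔩₂`, `𝔰𝔬ₙ` and the spin representation -/

/-- `𝔰𝔩₂(ℂ)`, the traceless `2 × 2` matrices. -/
abbrev sl2 : LieSubalgebra ℂ (Matrix (Fin 2) (Fin 2) ℂ) := LieAlgebra.SpecialLinear.sl (Fin 2) ℂ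

/-- The matrix `(0 1; 0 0)` in `𝔰𝔩₂`. -/
def slE : sl2 := LieAlgebra.SpecialLinear.single 0 1 (by decide) 1

/-- The matrix `(0 0; 1 0)` in `𝔰𝔩₂`. -/
def slF : sl2 := LieAlgebra.SpecialLinear.single 1 0 (by decide) 1

/-- The matrix `(1 0; 0 -1)` in `𝔰𝔩₂`. -/
def slH : sl2 := LieAlgebra.SpecialLinear.singleSubSingle 0 1 1

/-- `𝔰𝔬ₙ(ℂ)`, the skew-symmetric `n × n` matrices. -/
abbrev so (n : ℕ) : LieSubalgebra ℂ (Matrix (Fin n) (Fin n) ℂ) :=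
  LieAlgebra.Orthogonal.so (Fin n) ℂ

/-- The quadratic form `x ↦ ∑ xᵢ²` on `ℂⁿ`. -/
abbrev stdQuadraticForm (n : ℕ) : QuadraticForm ℂ (Fin n → ℂ) :=
  QuadraticMap.weightedSumSquares ℂ (fun _ : Fin n => (1 : ℂ))

/-- `σ` is the spin representation of `𝔰𝔬ₙ` (for odd `n`, where it is unique up to isomorphism):
the space `S` is a simple finite-dimensional module of the Clifford algebra of `(ℂⁿ, ∑ xᵢ²)`, and
`𝔰𝔬ₙ` acts on it through its standard embedding `A ↦ (1/4) ∑ A i j eᵢ eⱼ` in the Clifford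
algebra. -/
def IsSpinRep {n : ℕ} {S : Type*} [AddCommGroup S] [Module ℂ S]
    (σ : so n →ₗ⁅ℂ⁆ Module.End ℂ S) : Prop :=
  FiniteDimensional ℂ S ∧ Nontrivial S ∧
    ∃ c : CliffordAlgebra (stdQuadraticForm n) →ₐ[ℂ] Module.End ℂ S,
      (∀ W : Submodule ℂ S, (∀ a, ∀ w ∈ W, c a w ∈ W) → W = ⊥ ∨ W = ⊤) ∧
      ∀ A : so n, σ A = (1 / 4 : ℂ) • ∑ i, ∑ j, (A : Matrix (Fin n) (Fin n) ℂ) i j •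
        c (CliffordAlgebra.ι (stdQuadraticForm n) (Pi.single i 1) *
          CliffordAlgebra.ι (stdQuadraticForm n) (Pi.single j 1))

/-! ### Subalgebras of a pinned Lie algebra

A pinning of a semisimple Lie algebra `L` is given by `b : LieAlgebra.Basis ι H`: a Cartan subalgebra
`H`, the simple coroots `b.h i`, and simple root vectors `b.e i`, `b.f i`. The simple roots are
`b.baseSupp i`. -/

/-- The centralizer of a Lie subalgebra. -/
def centralizer {L : Type*} [LieRing L] [LieAlgebra ℂ L] (K : LieSubalgebra ℂ L) :
    LieSubalgebra ℂ L where
  carrier := {x | ∀ y ∈ K, ⁅x, y⁆ = 0}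
  add_mem' {x x'} hx hx' y hy := by rw [add_lie, hx y hy, hx' y hy, add_zero]
  zero_mem' y _ := zero_lie y
  smul_mem' c x hx y hy := by rw [smul_lie, hx y hy, smul_zero]
  lie_mem' {x x'} hx hx' y hy := by
    have h1 := hx y hy
    have h2 := hx' y hy
    simp only [lie_lie, h1, h2, lie_zero, sub_zero]

section Pinned

variable {ι L : Type*} [Fintype ι] [LieRing L] [LieAlgebra ℂ L] {H : LieSubalgebra ℂ L}

/-- The element `∑ cᵢ αᵢ` of the root lattice, as a linear form on the Cartan subalgebra. -/
def rootComb (b : LieAlgebra.Basis ι H) (c : ι → ℤ) : Module.Dual ℂ H :=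
  ∑ i, c i • b.baseSupp i

/-- The element `∑ cᵢ αᵢ^∨` of the coroot lattice. -/
def corootComb (b : LieAlgebra.Basis ι H) (c : ι → ℤ) : L :=
  ∑ i, c i • b.h i

variable [LieRing.IsNilpotent H]

/-- The roots that are combinations of the simple roots `αⱼ`, `j ∈ J`, each given by its integer
coordinates with respect to the simple roots. -/
def rootsOn (b : LieAlgebra.Basis ι H) (J : Set ι) : Set (ι → ℤ) :=
  {c | c ≠ 0 ∧ (∀ i ∉ J, c i = 0) ∧ LieAlgebra.rootSpace H (rootComb b c) ≠ ⊥}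

/-- The regular subalgebra generated by the root spaces of the subsystem of all roots that are
combinations of the simple roots `αⱼ`, `j ∈ J`. -/
def regularSubalgebra (b : LieAlgebra.Basis ι H) (J : Set ι) : LieSubalgebra ℂ L :=
  LieSubalgebra.lieSpan ℂ L
    {x | ∃ c ∈ rootsOn b J, x ∈ LieAlgebra.rootSpace H (rootComb b c)}

/-- `φ` identifies `𝔰𝔩₂` with the subalgebra generated by the root spaces of the root `c` and its
negative, matching the upper and lower triangular matrices with the root spaces of `c` and `-c`. -/
def IsRootEmbedding (b : LieAlgebra.Basis ι H) (c : ι → ℤ) (φ : sl2 →ₗ⁅ℂ⁆ L) : Prop :=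
  Function.Injective φ ∧ φ slE ∈ LieAlgebra.rootSpace H (rootComb b c) ∧
    φ slF ∈ LieAlgebra.rootSpace H (rootComb b (-c))

end Pinned

/-- The coordinates, with respect to the simple coroots `α₁^∨, …, α₈^∨` of `E₈`, of the six simple
coroots `β₁^∨, …, β₆^∨` of `𝔰𝔬₁₃`. -/
def so13Coroots : Fin 6 → Fin 8 → ℤ :=
  ![![0, 0, 1, 0, 0, 0, 0, 0],
    ![0, 0, 0, 1, 0, 0, 0, 0],
    ![0, 0, 0, 0, 1, 0, 0, 0],
    ![0, 0, 0, 0, 0, 1, 0, 0],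
    ![0, 0, 0, 0, 0, 0, 1, 0],
    ![0, -1, -1, -2, -2, -2, -2, 0]]

end E8

end

/-! The pairing with `θ` reads off the coefficient of `α₈`, and the pairing with `θ'` reads off the
coefficient of `α₁` minus that of `α₈`. The semisimple element `h` of the diagonal triple therefore
grades `𝔢₈` by the coefficient of `α₁`, in degrees `-2, …, 2`. Degree `0` is `𝔰𝔬₁₄` plus the line of
`h`, degree `2` is its vector representation of dimension `14`, and degree `1` is a half-spin
representation. The raising element `E` is a non-isotropic vector of degree `2`. By `𝔰𝔩₂`-theory the
centralizer of the diagonal is the stabilizer of `E` in degree `0`, which is `𝔰𝔬₁₃`.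

The argument has an abstract half and a root-theoretic half, linked by `Sl2Pair.IsSpecial`. In the
abstract half, `V` is the complement of `E` in degree `2`, namely the line of `u = E₁ - E₂` plus the
space `W` of bidegree `(1, 1)`. For `x, y` in `V` the bracket `⁅x, ⁅y, F⁆⁆` is a multiple of `E`,
which produces the form `b` (`lie_lie_F`), nondegenerate because the Killing form is. The elements
`⁅⁅F, x⁆, ⁅F, y⁆⁆` centralize the triple and act on `V` as infinitesimal rotations (`lie_X`), so
faithfulness and `exists_so_equiv` give `𝔰𝔬₁₃`. Stabilizing `u` as well gives `𝔰𝔬₁₂`; adjoining `E`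
to `V` gives `𝔰𝔬₁₄`. On degree `1`, the operators `s ↦ ⁅v, ⁅F, s⁆⁆` satisfy the Clifford relation
(`cl_mul_cl`), and the rotations become their commutators. The strings through `V`, `E` and degree
`1`, together with the centralizer, fill the algebra and yield the four summands.

The root-theoretic half uses that every root has norm `2` (`form_self_eq_two`), a consequence of the
unimodularity of the lattice, and that every positive vector of norm `2` is a root. Orthogonal
coordinates of type `D₇` (`four_mul_form_eq`) list the fourteen roots of level `2`
(`eq_of_level_two`): `θ`, `θ'` and the twelve weights of `W`. They also show that degree `0` acts
faithfully on degree `2`. Lowering to `α₁` by simple root vectors of degree `0` shows that degree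
`1` is irreducible (`gr_one_irreducible`), so the Clifford module is simple.

For the pinning, `α₃, …, α₇` already belong to `𝔰𝔬₁₂`. The short root vectors are `⁅⁅F, x⁆, ⁅F, u⁆⁆`
for `x` in two opposite weight spaces of `W` (`lie_X_X_eq`), and they generate the rest
(`W_le_of_stable`, `cent_le_of_X_mem`). -/

noncomputable section

namespace E8

/-! ### Recognizing `𝔰𝔬ₙ` from elementary rotations -/

section Orthogonal

variable {L : Type*} [LieRing L] [LieAlgebra ℂ L] {n : ℕ}

/-- The linear map `A ↦ (1/2) ∑ A i j X i j` from skew-symmetric matrices. -/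
def soMap (X : Fin n → Fin n → L) : so n →ₗ[ℂ] L where
  toFun A := (1 / 2 : ℂ) • ∑ i, ∑ j, (A : Matrix (Fin n) (Fin n) ℂ) i j • X i j
  map_add' A B := by
    simp [add_smul, Finset.sum_add_distrib]
  map_smul' c A := by
    simp only [SetLike.val_smul, Matrix.smul_apply, smul_eq_mul, mul_smul,
      ← Finset.smul_sum, RingHom.id_apply]
    rw [smul_comm]

lemma so_apply_swap (A : so n) (i j : Fin n) :
    (A : Matrix (Fin n) (Fin n) ℂ) i j = -(A : Matrix (Fin n) (Fin n) ℂ) j i := by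
  have := (LieAlgebra.Orthogonal.mem_so (Fin n) ℂ _).1 A.2
  have h := congrFun (congrFun this j) i
  simpa using h

/-- The factor `1/2` in `soMap` compensates for the two terms `(i, j)` and `(j, i)`, which
contribute equally by skew-symmetry. -/
lemma soMap_lie {X : Fin n → Fin n → L} {w : Fin n → L}
    (hX : ∀ i j k, ⁅X i j, w k⁆ = (if j = k then w i else 0) - (if i = k then w j else 0))
    (A : so n) (k : Fin n) :
    ⁅soMap X A, w k⁆ = ∑ i, (A : Matrix (Fin n) (Fin n) ℂ) i k • w i := by
  have h1 : ⁅soMap X A, w k⁆ = (1 / 2 : ℂ) • (∑ i, (A : Matrix (Fin n) (Fin n) ℂ) i k • w i -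
      ∑ j, (A : Matrix (Fin n) (Fin n) ℂ) k j • w j) := by
    simp only [soMap, LinearMap.coe_mk, AddHom.coe_mk, smul_lie, hX,
      smul_sub, smul_ite, smul_zero, Finset.sum_sub_distrib, Finset.sum_ite_eq', Finset.mem_univ, if_true, sum_lie]
    congr 2
    rw [Finset.sum_comm]
    simp
  have h2 : ∑ j, (A : Matrix (Fin n) (Fin n) ℂ) k j • w j =
      -∑ i, (A : Matrix (Fin n) (Fin n) ℂ) i k • w i := by
    rw [← Finset.sum_neg_distrib]
    exact Finset.sum_congr rfl fun j _ => by rw [so_apply_swap A k j, neg_smul]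
  rw [h1, h2, sub_neg_eq_add, ← two_smul ℂ, smul_smul]
  norm_num

/-- Each `X i j` acts by an elementary skew-symmetric matrix, and skew-symmetry is linear. This
supplies the skewness hypothesis of `exists_so_equiv` when it is not read off from an invariant
form. -/
lemma exists_so_of_mem_span {X : Fin n → Fin n → L} {w : Fin n → L}
    (hX : ∀ i j k, ⁅X i j, w k⁆ = (if j = k then w i else 0) - (if i = k then w j else 0))
    {x : L} (hx : x ∈ Submodule.span ℂ (Set.range fun p : Fin n × Fin n => X p.1 p.2)) :
    ∃ A : so n, ∀ k, ⁅x, w k⁆ = ∑ i, (A : Matrix (Fin n) (Fin n) ℂ) i k • w i := by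
  induction hx using Submodule.span_induction with
  | mem x hx =>
    obtain ⟨⟨i, j⟩, rfl⟩ := hx
    refine ⟨⟨Matrix.single i j 1 - Matrix.single j i 1, ?_⟩, fun k => ?_⟩
    · rw [LieAlgebra.Orthogonal.mem_so]
      simp
    · simp only [hX, Matrix.sub_apply, Matrix.single_apply, sub_smul, ite_smul, one_smul, zero_smul,
        Finset.sum_sub_distrib, ite_and, Finset.sum_ite_eq, Finset.mem_univ, if_true]
  | zero => exact ⟨0, fun k => by simp⟩
  | add x y _ _ hx hy =>
    obtain ⟨A, hA⟩ := hx
    obtain ⟨B, hB⟩ := hy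
    exact ⟨A + B, fun k => by simp [hA, hB, add_smul, Finset.sum_add_distrib]⟩
  | smul c x _ hx =>
    obtain ⟨A, hA⟩ := hx
    refine ⟨c • A, fun k => ?_⟩
    rw [smul_lie, hA, Finset.smul_sum]
    exact Finset.sum_congr rfl fun i _ => smul_smul _ _ _

lemma soMap_mem_span (X : Fin n → Fin n → L) (A : so n) :
    soMap X A ∈ Submodule.span ℂ (Set.range fun p : Fin n × Fin n => X p.1 p.2) :=
  Submodule.smul_mem _ _ (sum_mem fun i _ => sum_mem fun j _ => Submodule.smul_mem _ _
    (Submodule.subset_span ⟨(i, j), rfl⟩))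

/-- A Lie subalgebra acting faithfully on the span of a linearly independent family by
skew-symmetric matrices, and containing the elementary ones, is isomorphic to `𝔰𝔬ₙ`. -/
lemma exists_so_equiv (K : LieSubalgebra ℂ L) {w : Fin n → L} (hw : LinearIndependent ℂ w)
    {X : Fin n → Fin n → L} (hXK : ∀ i j, X i j ∈ K)
    (hX : ∀ i j k, ⁅X i j, w k⁆ = (if j = k then w i else 0) - (if i = k then w j else 0))
    (faithful : ∀ x ∈ K, (∀ k, ⁅x, w k⁆ = 0) → x = 0)
    (hskew : ∀ x ∈ K, ∃ A : so n, ∀ k, ⁅x, w k⁆ =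
      ∑ i, (A : Matrix (Fin n) (Fin n) ℂ) i k • w i) :
    ∃ ψ : so n ≃ₗ⁅ℂ⁆ K, ∀ A, (ψ A : L) = soMap X A := by
  have mem (A : so n) : soMap X A ∈ K := by
    refine K.smul_mem _ (sum_mem fun i _ => sum_mem fun j _ => K.smul_mem _ (hXK i j))
  have ext' {x y : L} (hx : x ∈ K) (hy : y ∈ K) (h : ∀ k, ⁅x, w k⁆ = ⁅y, w k⁆) : x = y :=
    sub_eq_zero.1 (faithful _ (K.sub_mem hx hy) fun k => by rw [sub_lie, h, sub_self])
  let f : so n →ₗ⁅ℂ⁆ K :=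
    { toFun := fun A => ⟨soMap X A, mem A⟩
      map_add' := fun A B => Subtype.ext (map_add (soMap X) A B)
      map_smul' := fun c A => Subtype.ext (map_smul (soMap X) c A)
      map_lie' := by
        intro A B
        -- By faithfulness the bracket need only be compared on the `w k`, where it becomes the
        -- commutator of matrices.
        refine Subtype.ext (ext' (mem _) (K.lie_mem (mem A) (mem B)) fun k => ?_)
        simp only [LieSubalgebra.coe_bracket]
        rw [soMap_lie hX, lie_lie, soMap_lie hX, soMap_lie hX]
        simp only [lie_sum, lie_smul, soMap_lie hX, Finset.smul_sum, smul_smul]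
        rw [Finset.sum_comm]
        nth_rw 2 [Finset.sum_comm]
        rw [← Finset.sum_sub_distrib]
        refine Finset.sum_congr rfl fun i _ => ?_
        rw [← Finset.sum_smul, ← Finset.sum_smul, ← sub_smul]
        congr 1
        rw [LieSubalgebra.coe_bracket, Ring.lie_def, Matrix.sub_apply, Matrix.mul_apply,
          Matrix.mul_apply]
        congr 1 <;> exact Finset.sum_congr rfl fun j _ => mul_comm _ _ }
  have inj : Function.Injective f := by
    intro A B h
    have h' : soMap X A = soMap X B := congrArg Subtype.val h
    refine Subtype.ext (Matrix.ext fun i k => ?_)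
    have hk := soMap_lie hX A k
    rw [h', soMap_lie hX B k] at hk
    have := Fintype.linearIndependent_iff.1 hw
      (fun i => (A : Matrix (Fin n) (Fin n) ℂ) i k - (B : Matrix (Fin n) (Fin n) ℂ) i k)
      (by simp only [sub_smul, Finset.sum_sub_distrib]; rw [hk, sub_self]) i
    exact sub_eq_zero.1 this
  have surj : Function.Surjective f := by
    intro x
    obtain ⟨A, hA⟩ := hskew x x.2
    exact ⟨A, Subtype.ext (ext' (mem A) x.2 fun k =>
      (soMap_lie hX A k).trans (hA k).symm)⟩
  exact ⟨LieEquiv.ofBijective f ⟨inj, surj⟩, fun A => rfl⟩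

end Orthogonal

/-! ### Eigenspaces of `ad x` and the Killing form -/

section Eigenspaces

variable {L : Type*} [LieRing L] [LieAlgebra ℂ L]

/-- The eigenspace of `ad x` for the eigenvalue `t`. -/
def eig (x : L) (t : ℂ) : Submodule ℂ L where
  carrier := {y | ⁅x, y⁆ = t • y}
  add_mem' {y z} hy hz := by
    rw [Set.mem_ofPred_eq] at hy hz ⊢
    rw [lie_add, hy, hz, smul_add]
  zero_mem' := by simp
  smul_mem' c y hy := by
    rw [Set.mem_ofPred_eq] at hy ⊢
    rw [lie_smul, hy, smul_comm]

lemma mem_eig {x y : L} {t : ℂ} : y ∈ eig x t ↔ ⁅x, y⁆ = t • y := Iff.rfl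

lemma lie_mem_eig {x y z : L} {s t r : ℂ} (hy : y ∈ eig x s) (hz : z ∈ eig x t)
    (hr : s + t = r) : ⁅y, z⁆ ∈ eig x r := by
  rw [mem_eig] at *
  rw [leibniz_lie, hy, hz, smul_lie, lie_smul, ← add_smul, hr]

lemma add_mem_eig {x x' y : L} {s t r : ℂ} (h : y ∈ eig x s) (h' : y ∈ eig x' t)
    (hr : s + t = r) : y ∈ eig (x + x') r := by
  rw [mem_eig] at *
  rw [add_lie, h, h', ← add_smul, hr]

lemma killingForm_lie_left (x y z : L) :
    killingForm ℂ L ⁅x, y⁆ z = killingForm ℂ L x ⁅y, z⁆ :=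
  LieModule.traceForm_apply_lie_apply ℂ L L x y z

lemma killingForm_symm (x y : L) : killingForm ℂ L x y = killingForm ℂ L y x :=
  LieModule.traceForm_comm ℂ L L x y

/-- Invariance under `ad x` multiplies the value by `s + t` and must give zero. -/
lemma killingForm_eq_zero_of_mem_eig {x y z : L} {s t : ℂ} (hy : y ∈ eig x s) (hz : z ∈ eig x t)
    (h : s + t ≠ 0) : killingForm ℂ L y z = 0 := by
  rw [mem_eig] at hy hz
  have h1 : killingForm ℂ L ⁅x, y⁆ z = -killingForm ℂ L y ⁅x, z⁆ := by
    rw [← lie_skew, map_neg, LinearMap.neg_apply, killingForm_lie_left]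
  rw [hy, hz] at h1
  simp only [map_smul, LinearMap.smul_apply, smul_eq_mul] at h1
  have : (s + t) * killingForm ℂ L y z = 0 := by linear_combination h1
  exact (mul_eq_zero.1 this).resolve_left h

end Eigenspaces

/-! ### Commuting `𝔰𝔩₂`-triples and the grading of their diagonal -/

/-- A pair of commuting `𝔰𝔩₂`-triples. -/
structure Sl2Pair (L : Type*) [LieRing L] [LieAlgebra ℂ L] where
  (E₁ F₁ h₁ E₂ F₂ h₂ : L)
  lie_E₁_F₁ : ⁅E₁, F₁⁆ = h₁
  lie_h₁_E₁ : ⁅h₁, E₁⁆ = (2 : ℂ) • E₁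
  lie_h₁_F₁ : ⁅h₁, F₁⁆ = (-2 : ℂ) • F₁
  lie_E₂_F₂ : ⁅E₂, F₂⁆ = h₂
  lie_h₂_E₂ : ⁅h₂, E₂⁆ = (2 : ℂ) • E₂
  lie_h₂_F₂ : ⁅h₂, F₂⁆ = (-2 : ℂ) • F₂
  lie_E₁_E₂ : ⁅E₁, E₂⁆ = 0
  lie_E₁_F₂ : ⁅E₁, F₂⁆ = 0
  lie_F₁_E₂ : ⁅F₁, E₂⁆ = 0
  lie_F₁_F₂ : ⁅F₁, F₂⁆ = 0

namespace Sl2Pair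

variable {L : Type*} [LieRing L] [LieAlgebra ℂ L] (D : Sl2Pair L)

/-- The pair with the two triples exchanged. -/
@[simps] def swap : Sl2Pair L where
  E₁ := D.E₂
  F₁ := D.F₂
  h₁ := D.h₂
  E₂ := D.E₁
  F₂ := D.F₁
  h₂ := D.h₁
  lie_E₁_F₁ := D.lie_E₂_F₂
  lie_h₁_E₁ := D.lie_h₂_E₂
  lie_h₁_F₁ := D.lie_h₂_F₂
  lie_E₂_F₂ := D.lie_E₁_F₁
  lie_h₂_E₂ := D.lie_h₁_E₁
  lie_h₂_F₂ := D.lie_h₁_F₁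
  lie_E₁_E₂ := by rw [← lie_skew, D.lie_E₁_E₂, neg_zero]
  lie_E₁_F₂ := by rw [← lie_skew, D.lie_F₁_E₂, neg_zero]
  lie_F₁_E₂ := by rw [← lie_skew, D.lie_E₁_F₂, neg_zero]
  lie_F₁_F₂ := by rw [← lie_skew, D.lie_F₁_F₂, neg_zero]

/-- The raising element of the diagonal triple. -/
def E : L := D.E₁ + D.E₂

/-- The lowering element of the diagonal triple. -/
def F : L := D.F₁ + D.F₂

/-- The semisimple element of the diagonal triple. -/
def h : L := D.h₁ + D.h₂

/-- The difference of the two raising operators. -/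
def u : L := D.E₁ - D.E₂

/-- The grading by the eigenvalues of the diagonal `h`. -/
abbrev gr (t : ℂ) : Submodule ℂ L := eig D.h t

/-- The common eigenspace with eigenvalues `1` and `1`. -/
def W : Submodule ℂ L := eig D.h₁ 1 ⊓ eig D.h₂ 1

/-- The complement of `E` in the top degree of the grading. -/
def V : Submodule ℂ L := D.W ⊔ ℂ ∙ D.u

lemma lie_h₁_E₂ : ⁅D.h₁, D.E₂⁆ = 0 := by
  rw [← D.lie_E₁_F₁, lie_lie, D.lie_F₁_E₂, D.lie_E₁_E₂, lie_zero, lie_zero, sub_zero]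

lemma lie_h₁_F₂ : ⁅D.h₁, D.F₂⁆ = 0 := by
  rw [← D.lie_E₁_F₁, lie_lie, D.lie_F₁_F₂, D.lie_E₁_F₂, lie_zero, lie_zero, sub_zero]

lemma lie_h₁_h₂ : ⁅D.h₁, D.h₂⁆ = 0 := by
  rw [← D.lie_E₂_F₂, leibniz_lie, D.lie_h₁_E₂, D.lie_h₁_F₂, lie_zero, zero_lie, add_zero]

lemma lie_h₂_E₁ : ⁅D.h₂, D.E₁⁆ = 0 := D.swap.lie_h₁_E₂

lemma lie_h₂_F₁ : ⁅D.h₂, D.F₁⁆ = 0 := D.swap.lie_h₁_F₂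

lemma lie_E₂_F₁ : ⁅D.E₂, D.F₁⁆ = 0 := D.swap.lie_E₁_F₂

lemma lie_E_F : ⁅D.E, D.F⁆ = D.h := by
  simp [E, F, h, D.lie_E₁_F₁, D.lie_E₂_F₂, D.lie_E₁_F₂, D.lie_E₂_F₁]

lemma E_mem : D.E ∈ D.gr 2 := by
  rw [mem_eig]
  simp [E, h, D.lie_h₁_E₁, D.lie_h₂_E₂, D.lie_h₁_E₂, D.lie_h₂_E₁]

lemma F_mem : D.F ∈ D.gr (-2) := by
  rw [mem_eig]
  simp [F, h, D.lie_h₁_F₁, D.lie_h₂_F₂, D.lie_h₁_F₂, D.lie_h₂_F₁, add_comm]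

lemma u_mem : D.u ∈ D.gr 2 := by
  rw [mem_eig]
  simp [u, h, D.lie_h₁_E₁, D.lie_h₂_E₂, D.lie_h₁_E₂, D.lie_h₂_E₁, smul_sub]

lemma W_le : D.W ≤ D.gr 2 := fun _ hw => add_mem_eig hw.1 hw.2 (by norm_num)

lemma V_le : D.V ≤ D.gr 2 :=
  sup_le D.W_le ((Submodule.span_singleton_le_iff_mem _ _).2 D.u_mem)

lemma W_le_V : D.W ≤ D.V := le_sup_left

lemma u_mem_V : D.u ∈ D.V := Submodule.mem_sup_right (Submodule.mem_span_singleton_self _)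

lemma mem_V {x : L} (hx : x ∈ D.V) : ∃ w ∈ D.W, ∃ a : ℂ, x = w + a • D.u := by
  obtain ⟨w, hw, y, hy, rfl⟩ := Submodule.mem_sup.1 hx
  obtain ⟨a, rfl⟩ := Submodule.mem_span_singleton.1 hy
  exact ⟨w, hw, a, rfl⟩

lemma lie_u_F : ⁅D.u, D.F⁆ = D.h₁ - D.h₂ := by
  simp [u, F, D.lie_E₁_F₁, D.lie_E₂_F₂, D.lie_E₁_F₂, D.lie_E₂_F₁, sub_eq_add_neg]

/-- The properties of the pair of triples of the highest roots of `E₈` and `E₇` used to identify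
the centralizer of the diagonal. -/
structure IsSpecial : Prop where
  killing_eq : killingForm ℂ L D.E₁ D.F₁ = killingForm ℂ L D.E₂ D.F₂
  killing_ne : killingForm ℂ L D.E₁ D.F₁ ≠ 0
  exists_decomp : ∀ x, ∃ x₂ ∈ D.gr 2, ∃ x₁ ∈ D.gr 1, ∃ x₀ ∈ D.gr 0, ∃ y₁ ∈ D.gr (-1),
    ∃ y₂ ∈ D.gr (-2), x = x₂ + x₁ + x₀ + y₁ + y₂
  gr_three : D.gr 3 = ⊥
  gr_neg_three : D.gr (-3) = ⊥
  gr_four : D.gr 4 = ⊥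
  gr_neg_four : D.gr (-4) = ⊥
  exists_of_mem_gr_two : ∀ x ∈ D.gr 2, ∃ w ∈ D.W, ∃ a c : ℂ, x = w + a • D.E₁ + c • D.E₂
  faithful : ∀ x ∈ D.gr 0, (∀ y ∈ D.gr 2, ⁅x, y⁆ = 0) → x = 0

variable {D} (hD : D.IsSpecial)
include hD

namespace IsSpecial

lemma killing_E_F : killingForm ℂ L D.E D.F = 2 * killingForm ℂ L D.E₁ D.F₁ := by
  have h12 : killingForm ℂ L D.E₁ D.F₂ = 0 :=
    killingForm_eq_zero_of_mem_eig (x := D.h₁) D.lie_h₁_E₁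
      (show D.F₂ ∈ eig D.h₁ 0 by rw [mem_eig, D.lie_h₁_F₂, zero_smul]) (by norm_num)
  have h21 : killingForm ℂ L D.E₂ D.F₁ = 0 :=
    killingForm_eq_zero_of_mem_eig (x := D.h₂) D.lie_h₂_E₂
      (show D.F₁ ∈ eig D.h₂ 0 by rw [mem_eig, D.lie_h₂_F₁, zero_smul]) (by norm_num)
  simp only [E, F, map_add, LinearMap.add_apply, h12, h21, ← hD.killing_eq]
  ring

lemma killing_E_F_ne : killingForm ℂ L D.E D.F ≠ 0 := by
  rw [hD.killing_E_F]
  exact mul_ne_zero two_ne_zero hD.killing_ne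

/-- The conditions are symmetric in the two triples, so a statement about `F₁` also yields the one
about `F₂`. -/
lemma swap : D.swap.IsSpecial := by
  have hh : D.swap.h = D.h := add_comm _ _
  exact
  { killing_eq := hD.killing_eq.symm
    killing_ne := hD.killing_eq ▸ hD.killing_ne
    exists_decomp := by rw [gr, gr, gr, gr, gr, hh]; exact hD.exists_decomp
    gr_three := by rw [gr, hh]; exact hD.gr_three
    gr_neg_three := by rw [gr, hh]; exact hD.gr_neg_three
    gr_four := by rw [gr, hh]; exact hD.gr_four
    gr_neg_four := by rw [gr, hh]; exact hD.gr_neg_four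
    exists_of_mem_gr_two := by
      rw [gr, hh]
      intro x hx
      obtain ⟨w, hw, a, c, rfl⟩ := hD.exists_of_mem_gr_two x hx
      exact ⟨w, hw.symm, c, a, add_right_comm _ _ _⟩
    faithful := by rw [gr, gr, hh]; exact hD.faithful }

lemma lie_eq_zero_of_add_eq_four {x y : L} (hx : x ∈ D.gr 2) (hy : y ∈ D.gr 2) :
    ⁅x, y⁆ = 0 := by
  have : ⁅x, y⁆ ∈ D.gr 4 := lie_mem_eig hx hy (by norm_num)
  rwa [hD.gr_four, Submodule.mem_bot] at this

lemma lie_lie_F_comm {x y : L} (hx : x ∈ D.gr 2) (hy : y ∈ D.gr 2) :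
    ⁅x, ⁅y, D.F⁆⁆ = ⁅y, ⁅x, D.F⁆⁆ := by
  rw [leibniz_lie, hD.lie_eq_zero_of_add_eq_four hx hy, zero_lie, zero_add]

/-- The bidegree under `(h₁, h₂)` is `(1, 1) + (1, 1) + (-2, 0) = (0, 2)`, and in degree `2` only
the line of `E₂` has it. -/
lemma exists_lie_lie_F₁ {x y : L} (hx : x ∈ D.W) (hy : y ∈ D.W) :
    ∃ a : ℂ, ⁅x, ⁅y, D.F₁⁆⁆ = a • D.E₂ := by
  have hF₁ : D.F₁ ∈ eig D.h₂ 0 := by rw [mem_eig, D.lie_h₂_F₁, zero_smul]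
  have h1 : ⁅x, ⁅y, D.F₁⁆⁆ ∈ eig D.h₁ 0 :=
    lie_mem_eig hx.1 (lie_mem_eig hy.1 D.lie_h₁_F₁ rfl) (by norm_num)
  have h2 : ⁅x, ⁅y, D.F₁⁆⁆ ∈ eig D.h₂ 2 :=
    lie_mem_eig hx.2 (lie_mem_eig hy.2 hF₁ rfl) (by norm_num)
  obtain ⟨w, hw, a, c, hz⟩ := hD.exists_of_mem_gr_two _ (add_mem_eig h1 h2 (zero_add _))
  rw [hz] at h1 ⊢
  have hw1 : ⁅D.h₁, w⁆ = (1 : ℂ) • w := hw.1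
  -- The eigenvalues of `ad h₁` on `w` and `E₁` are `1` and `2`; applying it twice separates the two
  -- components and kills both.
  have k1 : w + (2 * a) • D.E₁ = 0 := by
    rw [mem_eig] at h1
    simp only [lie_add, lie_smul, hw1, D.lie_h₁_E₁, D.lie_h₁_E₂, zero_smul, smul_zero, one_smul,
      add_zero, smul_smul] at h1
    rw [mul_comm, h1]
  have k2 : w + (4 * a) • D.E₁ = 0 := by
    have := congrArg (fun z => ⁅D.h₁, z⁆) k1
    simp only [lie_add, lie_smul, hw1, D.lie_h₁_E₁, one_smul, lie_zero, smul_smul] at this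
    rw [← this]
    ring_nf
  have k3 : (2 * a) • D.E₁ = 0 := by
    have : (2 * a) • D.E₁ = (w + (4 * a) • D.E₁) - (w + (2 * a) • D.E₁) := by module
    rw [this, k1, k2, sub_zero]
  have k4 : w = 0 := by rwa [k3, add_zero] at k1
  have k5 : a • D.E₁ = 0 := by
    rw [mul_smul] at k3
    exact (smul_eq_zero.1 k3).resolve_left two_ne_zero
  exact ⟨c, by rw [k4, k5, zero_add, zero_add]⟩

/-- The `F₁`-part is a multiple of `E₂` and the `F₂`-part a multiple of `E₁`. The two coefficients
agree because `F₁` and `F₂` commute, the Killing form is invariant, and it takes the same value on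
both pairs. -/
lemma exists_lie_lie_F_of_mem_W {x y : L} (hx : x ∈ D.W) (hy : y ∈ D.W) :
    ∃ a : ℂ, ⁅x, ⁅y, D.F⁆⁆ = a • D.E := by
  obtain ⟨a, ha⟩ := hD.exists_lie_lie_F₁ hx hy
  obtain ⟨c, hc⟩ := hD.swap.exists_lie_lie_F₁ (x := x) (y := y) hx.symm hy.symm
  simp only [swap_F₁, swap_E₂] at hc
  have key : killingForm ℂ L ⁅x, ⁅y, D.F₁⁆⁆ D.F₂ = killingForm ℂ L ⁅x, ⁅y, D.F₂⁆⁆ D.F₁ := by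
    rw [killingForm_lie_left, killingForm_lie_left, lie_lie y D.F₁, D.lie_F₁_F₂, lie_zero, zero_sub,
      lie_skew]
  rw [ha, hc, map_smul, map_smul, LinearMap.smul_apply, LinearMap.smul_apply, hD.killing_eq,
    smul_eq_mul, smul_eq_mul] at key
  have hac : a = c := mul_right_cancel₀ (hD.killing_eq ▸ hD.killing_ne) key
  exact ⟨a, by rw [F, lie_add, lie_add, ha, hc, hac, ← smul_add, add_comm D.E₂, E]⟩

end IsSpecial
end Sl2Pair

/-! ### The form on `V`, the centralizer and its rotations -/

namespace Sl2Pair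

variable {L : Type*} [LieRing L] [LieAlgebra ℂ L] (D : Sl2Pair L)

/-- The bilinear form whose restriction to `V` is preserved by the centralizer. -/
def b : LinearMap.BilinForm ℂ L :=
  -- The scalar is chosen so that `⁅x, ⁅y, F⁆⁆ = -2 b(x, y) E` on `V` and `b(u, u) = 1`.
  LinearMap.mk₂ ℂ (fun x y => -(2 * killingForm ℂ L D.E D.F)⁻¹ *
      killingForm ℂ L ⁅x, ⁅y, D.F⁆⁆ D.F)
    (fun x x' y => by simp only [add_lie, map_add, LinearMap.add_apply]; ring)
    (fun c x y => by simp only [smul_lie, map_smul, LinearMap.smul_apply, smul_eq_mul]; ring)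
    (fun x y y' => by simp only [add_lie, lie_add, map_add, LinearMap.add_apply]; ring)
    (fun c x y => by
      simp only [smul_lie, lie_smul, map_smul, LinearMap.smul_apply, smul_eq_mul]; ring)

lemma b_apply (x y : L) : D.b x y = -(2 * killingForm ℂ L D.E D.F)⁻¹ *
      killingForm ℂ L ⁅x, ⁅y, D.F⁆⁆ D.F := rfl

/-- The elements spanning the centralizer. -/
def X (x y : L) : L := ⁅⁅D.F, x⁆, ⁅D.F, y⁆⁆

/-- The centralizer of the diagonal triple. -/
def cent : LieSubalgebra ℂ L where
  carrier := {x | ⁅x, D.E⁆ = 0 ∧ ⁅x, D.F⁆ = 0}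
  add_mem' {x y} hx hy := by
    simp only [Set.mem_ofPred_eq, add_lie] at *
    rw [hx.1, hx.2, hy.1, hy.2, add_zero]
    exact ⟨rfl, rfl⟩
  zero_mem' := by simp
  smul_mem' c x hx := by
    simp only [Set.mem_ofPred_eq, smul_lie] at *
    rw [hx.1, hx.2, smul_zero]
    exact ⟨rfl, rfl⟩
  lie_mem' {x y} hx hy := by
    simp only [Set.mem_ofPred_eq, lie_lie] at *
    simp [hx.1, hx.2, hy.1, hy.2]

lemma mem_cent {x : L} : x ∈ D.cent ↔ ⁅x, D.E⁆ = 0 ∧ ⁅x, D.F⁆ = 0 := Iff.rfl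

lemma lie_F_E : ⁅D.F, D.E⁆ = -D.h := by rw [← lie_skew, D.lie_E_F]

lemma cent_le {x : L} (hx : x ∈ D.cent) : x ∈ D.gr 0 := by
  rw [mem_eig, ← D.lie_E_F, lie_lie, ← lie_skew _ x, hx.2, ← lie_skew _ x, hx.1]
  simp

lemma killing_W_F {w : L} (hw : w ∈ D.W) : killingForm ℂ L w D.F = 0 := by
  rw [F, map_add, killingForm_eq_zero_of_mem_eig hw.1 D.lie_h₁_F₁ (by norm_num),
    killingForm_eq_zero_of_mem_eig hw.2 D.lie_h₂_F₂ (by norm_num), add_zero]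

namespace IsSpecial

variable {D} (hD : D.IsSpecial)
include hD

lemma lie_E_lie_F {x : L} (hx : x ∈ D.gr 2) : ⁅D.E, ⁅D.F, x⁆⁆ = (2 : ℂ) • x := by
  rw [leibniz_lie, D.lie_E_F, hD.lie_eq_zero_of_add_eq_four D.E_mem hx, lie_zero, add_zero,
    mem_eig.1 hx]

lemma lie_lie_F_E {x : L} (hx : x ∈ D.gr 2) : ⁅⁅D.F, x⁆, D.E⁆ = (-2 : ℂ) • x := by
  rw [← lie_skew, hD.lie_E_lie_F hx, neg_smul]

/-- Extends the case of `W` by the line of `u`: since `⁅u, F⁆ = h₁ - h₂`, the mixed terms vanish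
because `h₁` and `h₂` act equally on `W`, and the square of `u` gives `-2 E`. -/
lemma exists_lie_lie_F {x y : L} (hx : x ∈ D.V) (hy : y ∈ D.V) :
    ∃ a : ℂ, ⁅x, ⁅y, D.F⁆⁆ = a • D.E := by
  obtain ⟨w, hw, s, rfl⟩ := D.mem_V hx
  obtain ⟨v, hv, t, rfl⟩ := D.mem_V hy
  obtain ⟨a, ha⟩ := hD.exists_lie_lie_F_of_mem_W hw hv
  have hu {w : L} (hw : w ∈ D.W) : ⁅w, ⁅D.u, D.F⁆⁆ = 0 := by
    rw [D.lie_u_F, ← lie_skew, sub_lie, hw.1, hw.2, sub_self, neg_zero]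
  have hu' : ⁅D.u, ⁅v, D.F⁆⁆ = 0 := by
    rw [hD.lie_lie_F_comm D.u_mem (D.W_le hv), hu hv]
  have huu : ⁅D.u, ⁅D.u, D.F⁆⁆ = (-2 : ℂ) • D.E := by
    rw [D.lie_u_F, ← lie_skew, u, E, sub_lie, lie_sub, lie_sub, D.lie_h₁_E₁, D.lie_h₁_E₂,
      D.lie_h₂_E₁, D.lie_h₂_E₂]
    module
  refine ⟨a + s * t * (-2), ?_⟩
  simp only [lie_add, add_lie, lie_smul, smul_lie, hu', hu hw, huu, ha]
  module

lemma lie_lie_F {x y : L} (hx : x ∈ D.V) (hy : y ∈ D.V) :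
    ⁅x, ⁅y, D.F⁆⁆ = (-2 * D.b x y) • D.E := by
  obtain ⟨a, ha⟩ := hD.exists_lie_lie_F hx hy
  have := hD.killing_E_F_ne
  rw [b_apply, ha, map_smul, LinearMap.smul_apply, smul_eq_mul]
  congr 1
  field_simp

lemma b_u_u : D.b D.u D.u = 1 := by
  have := hD.killing_E_F_ne
  have huu : ⁅D.u, ⁅D.u, D.F⁆⁆ = (-2 : ℂ) • D.E := by
    rw [D.lie_u_F, ← lie_skew, u, E, sub_lie, lie_sub, lie_sub, D.lie_h₁_E₁, D.lie_h₁_E₂,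
      D.lie_h₂_E₁, D.lie_h₂_E₂]
    module
  rw [b_apply, huu, map_smul, LinearMap.smul_apply, smul_eq_mul]
  field_simp

omit hD in
lemma b_W_u {w : L} (hw : w ∈ D.W) : D.b w D.u = 0 := by
  rw [b_apply, D.lie_u_F, ← lie_skew, sub_lie, hw.1, hw.2, sub_self, neg_zero, map_zero,
    LinearMap.zero_apply, mul_zero]

lemma b_symm {x y : L} (hx : x ∈ D.gr 2) (hy : y ∈ D.gr 2) : D.b x y = D.b y x := by
  rw [b_apply, b_apply, hD.lie_lie_F_comm hx hy]

lemma lie_lie_F_V {x y : L} (hx : x ∈ D.V) (hy : y ∈ D.V) :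
    ⁅⁅D.F, x⁆, y⁆ = (-2 * D.b x y) • D.E := by
  rw [← hD.lie_lie_F hx hy, lie_lie, hD.lie_eq_zero_of_add_eq_four (D.V_le hx) (D.V_le hy),
    lie_zero, zero_sub, ← lie_neg, lie_skew]

/-- Each `⁅F, x⁆` sends `V` to the line of `E` and `E` to `-2 x`, so a commutator of two of them is
a rotation in the plane of `x` and `y`. -/
lemma lie_X {x y z : L} (hx : x ∈ D.V) (hy : y ∈ D.V) (hz : z ∈ D.V) :
    ⁅D.X x y, z⁆ = (4 * D.b y z) • x - (4 * D.b x z) • y := by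
  rw [X, lie_lie, hD.lie_lie_F_V hy hz, hD.lie_lie_F_V hx hz, lie_smul, lie_smul,
    hD.lie_lie_F_E (D.V_le hx), hD.lie_lie_F_E (D.V_le hy)]
  module

/-- A highest weight vector of weight `0` is invariant: `⁅x, F⁆` is killed by `E` and, since degree
`-4` vanishes, by `F`. Hence it is killed by `h`, which acts on it by `-2`. -/
lemma mem_cent_of_lie_E {x : L} (hx : x ∈ D.gr 0) (hE : ⁅x, D.E⁆ = 0) : x ∈ D.cent := by
  refine ⟨hE, ?_⟩
  have h1 : ⁅x, D.F⁆ ∈ D.gr (-2) := lie_mem_eig hx D.F_mem (by norm_num)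
  have h2 : ⁅D.E, ⁅x, D.F⁆⁆ = 0 := by
    rw [leibniz_lie, ← lie_skew D.E x, hE, D.lie_E_F, ← lie_skew x D.h, mem_eig.1 hx]
    simp
  have h3 : ⁅D.F, ⁅x, D.F⁆⁆ = 0 := by
    have : ⁅D.F, ⁅x, D.F⁆⁆ ∈ D.gr (-4) := lie_mem_eig D.F_mem h1 (by norm_num)
    rwa [hD.gr_neg_four, Submodule.mem_bot] at this
  have h4 : ⁅D.h, ⁅x, D.F⁆⁆ = 0 := by
    rw [← D.lie_E_F, lie_lie, h2, h3, lie_zero, lie_zero, sub_zero]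
  rw [mem_eig.1 h1] at h4
  exact (smul_eq_zero.1 h4).resolve_left (by norm_num)

omit hD in
lemma lie_F_mem {x : L} (hx : x ∈ D.gr 2) : ⁅D.F, x⁆ ∈ D.gr 0 :=
  lie_mem_eig D.F_mem hx (by norm_num)

lemma lie_X_E {x y : L} (hx : x ∈ D.V) (hy : y ∈ D.V) : ⁅D.X x y, D.E⁆ = 0 := by
  rw [X, lie_lie, hD.lie_lie_F_E (D.V_le hx), hD.lie_lie_F_E (D.V_le hy), lie_smul, lie_smul,
    hD.lie_lie_F_V hx hy, hD.lie_lie_F_V hy hx, hD.b_symm (D.V_le hx) (D.V_le hy), sub_self]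

lemma X_mem_cent {x y : L} (hx : x ∈ D.V) (hy : y ∈ D.V) : D.X x y ∈ D.cent :=
  hD.mem_cent_of_lie_E (lie_mem_eig (lie_F_mem (D.V_le hx)) (lie_F_mem (D.V_le hy)) (by norm_num))
    (hD.lie_X_E hx hy)

omit hD in
lemma lie_cent_X {x y z : L} (hx : x ∈ D.cent) :
    ⁅x, D.X y z⁆ = D.X ⁅x, y⁆ z + D.X y ⁅x, z⁆ := by
  have h (y : L) : ⁅x, ⁅D.F, y⁆⁆ = ⁅D.F, ⁅x, y⁆⁆ := by rw [leibniz_lie, hx.2, zero_lie, zero_add]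
  rw [X, leibniz_lie, h, h, X, X]

lemma killing_u_F : killingForm ℂ L D.u D.F = 0 := by
  have h12 : killingForm ℂ L D.E₁ D.F₂ = 0 :=
    killingForm_eq_zero_of_mem_eig (x := D.h₁) D.lie_h₁_E₁
      (show D.F₂ ∈ eig D.h₁ 0 by rw [mem_eig, D.lie_h₁_F₂, zero_smul]) (by norm_num)
  have h21 : killingForm ℂ L D.E₂ D.F₁ = 0 :=
    killingForm_eq_zero_of_mem_eig (x := D.h₂) D.lie_h₂_E₂
      (show D.F₁ ∈ eig D.h₂ 0 by rw [mem_eig, D.lie_h₂_F₁, zero_smul]) (by norm_num)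
  simp only [u, F, map_add, map_sub, LinearMap.sub_apply, h12, h21, hD.killing_eq]
  ring

lemma killing_V_F {v : L} (hv : v ∈ D.V) : killingForm ℂ L v D.F = 0 := by
  obtain ⟨w, hw, a, rfl⟩ := D.mem_V hv
  rw [map_add, LinearMap.add_apply, D.killing_W_F hw, map_smul, LinearMap.smul_apply,
    hD.killing_u_F, smul_zero, add_zero]

/-- With `killing_V_F`, this describes `V` as the orthogonal of `F` in degree `2`, whence its
stability under the centralizer. -/
lemma mem_V_of_killing {x : L} (hx : x ∈ D.gr 2) (h : killingForm ℂ L x D.F = 0) : x ∈ D.V := by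
  obtain ⟨w, hw, a, c, rfl⟩ := hD.exists_of_mem_gr_two x hx
  have hu := hD.killing_u_F
  have e : w + a • D.E₁ + c • D.E₂ = (w + ((a - c) / 2) • D.u) + ((a + c) / 2) • D.E := by
    rw [u, E]
    module
  have hV : w + ((a - c) / 2) • D.u ∈ D.V :=
    add_mem (D.W_le_V hw) (Submodule.smul_mem _ _ D.u_mem_V)
  rw [e] at h ⊢
  simp only [map_add, map_smul, LinearMap.add_apply, LinearMap.smul_apply, D.killing_W_F hw, hu,
    smul_eq_mul, mul_zero, zero_add, mul_eq_zero, hD.killing_E_F_ne, or_false] at h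
  rw [h, zero_smul, add_zero]
  exact hV

lemma exists_of_mem_gr_two' {x : L} (hx : x ∈ D.gr 2) : ∃ v ∈ D.V, ∃ a : ℂ, x = v + a • D.E := by
  obtain ⟨w, hw, a, c, rfl⟩ := hD.exists_of_mem_gr_two x hx
  refine ⟨w + ((a - c) / 2) • D.u, add_mem (D.W_le_V hw) (Submodule.smul_mem _ _ D.u_mem_V),
    (a + c) / 2, ?_⟩
  rw [u, E]
  module

lemma lie_cent_mem_V {x v : L} (hx : x ∈ D.cent) (hv : v ∈ D.gr 2) : ⁅x, v⁆ ∈ D.V := by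
  refine hD.mem_V_of_killing (lie_mem_eig (D.cent_le hx) hv (by norm_num)) ?_
  rw [← lie_skew, map_neg, LinearMap.neg_apply, killingForm_lie_left, hx.2, map_zero, neg_zero]

-- An element of the centralizer kills `F`, so it carries any vector to one orthogonal to `F`;
-- invariance of `b` follows from this and the Jacobi identity.
omit hD in
lemma b_cent {x : L} (hx : x ∈ D.cent) (y z : L) : D.b ⁅x, y⁆ z = -D.b y ⁅x, z⁆ := by
  have h1 : ⁅⁅x, z⁆, D.F⁆ = ⁅x, ⁅z, D.F⁆⁆ := by rw [lie_lie, hx.2, lie_zero, sub_zero]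
  have h2 : ⁅⁅x, y⁆, ⁅z, D.F⁆⁆ = ⁅x, ⁅y, ⁅z, D.F⁆⁆⁆ - ⁅y, ⁅x, ⁅z, D.F⁆⁆⁆ := lie_lie _ _ _
  have h3 : killingForm ℂ L ⁅x, ⁅y, ⁅z, D.F⁆⁆⁆ D.F = 0 := by
    rw [← lie_skew, map_neg, LinearMap.neg_apply, killingForm_lie_left, hx.2, map_zero, neg_zero]
  rw [b_apply, b_apply, h1, h2, map_sub, LinearMap.sub_apply, h3]
  ring

lemma eq_zero_of_mem_cent {x : L} (hx : x ∈ D.cent) (h : ∀ v ∈ D.V, ⁅x, v⁆ = 0) : x = 0 := by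
  refine hD.faithful x (D.cent_le hx) fun y hy => ?_
  obtain ⟨v, hv, a, rfl⟩ := hD.exists_of_mem_gr_two' hy
  rw [lie_add, lie_smul, h v hv, hx.1, smul_zero, add_zero]

end IsSpecial
end Sl2Pair

/-! ### Orthonormal bases for complex symmetric forms -/

section Orthonormal

variable {M : Type*} [AddCommGroup M] [Module ℂ M]

/-- `w` is orthonormal for `B`. -/
def IsOrthonormal {n : ℕ} (B : LinearMap.BilinForm ℂ M) (w : Fin n → M) : Prop :=
  ∀ i j, B (w i) (w j) = if i = j then 1 else 0

lemma IsOrthonormal.linearIndependent {n : ℕ} {B : LinearMap.BilinForm ℂ M} {w : Fin n → M}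
    (h : IsOrthonormal B w) : LinearIndependent ℂ w := by
  refine Fintype.linearIndependent_iff.2 fun g hg i => ?_
  have := congrArg (fun x => B x (w i)) hg
  simpa [map_sum, LinearMap.sum_apply, h _ _] using this

lemma exists_isOrthonormal [FiniteDimensional ℂ M] (B : LinearMap.BilinForm ℂ M)
    (W : Submodule ℂ M) (hsymm : ∀ x ∈ W, ∀ y ∈ W, B x y = B y x)
    (hnd : ∀ x ∈ W, (∀ y ∈ W, B x y = 0) → x = 0) {n : ℕ} (hn : Module.finrank ℂ W = n) :
    ∃ w : Fin n → M, (∀ i, w i ∈ W) ∧ IsOrthonormal B w ∧ ∀ x ∈ W, x = ∑ i, B x (w i) • w i := by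
  subst hn
  let C : LinearMap.BilinForm ℂ W := B.restrict W
  obtain ⟨v, hv⟩ := LinearMap.BilinForm.exists_orthogonal_basis (B := C)
    ⟨fun x y => hsymm x x.2 y y.2⟩
  have hsep : C.SeparatingLeft := fun x hx =>
    Subtype.ext (hnd x x.2 fun y hy => hx ⟨y, hy⟩)
  have hne := hv.not_isOrtho_basis_self_of_separatingLeft hsep
  -- Over `ℂ` an orthogonal basis of a nondegenerate form is normalized by square roots of its
  -- nonzero norms.
  choose s hs using fun i => IsAlgClosed.exists_pow_nat_eq (C (v i) (v i)) (n := 2) two_pos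
  have hs0 (i) : s i ≠ 0 := fun h => hne i (by rw [← hs i, h]; norm_num)
  have key : IsOrthonormal B (fun i => (s i)⁻¹ • (v i : M)) := by
    intro i j
    have h1 : B (v i : M) (v j) = C (v i) (v j) := rfl
    simp only [map_smul, LinearMap.smul_apply, smul_eq_mul, h1]
    split_ifs with h
    · subst h
      rw [← hs i]
      field_simp [hs0 i]
    · rw [show C (v i) (v j) = 0 from hv h, mul_zero, mul_zero]
  refine ⟨fun i => (s i)⁻¹ • (v i : M), fun i => W.smul_mem _ (v i).2, key, fun x hx => ?_⟩
  have h1 : x = ∑ i, (v.repr ⟨x, hx⟩ i * s i) • (s i)⁻¹ • (v i : M) := by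
    have := congrArg Subtype.val (v.sum_repr ⟨x, hx⟩)
    rw [Submodule.coe_sum] at this
    refine this.symm.trans (Finset.sum_congr rfl fun i _ => ?_)
    rw [smul_smul, mul_assoc, mul_inv_cancel₀ (hs0 i), mul_one]
    simp
  have h2 (i) : B x ((s i)⁻¹ • (v i : M)) = v.repr ⟨x, hx⟩ i * s i := by
    conv_lhs => rw [h1]
    rw [map_sum, LinearMap.sum_apply]
    simp only [map_smul _ (_ * _), LinearMap.smul_apply (_ * _), key _ i, smul_eq_mul, mul_ite,
      mul_one, mul_zero, Finset.sum_ite_eq', Finset.mem_univ, if_true]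
  simp_rw [h2]
  exact h1

end Orthonormal

/-! ### Nondegeneracy and the orthogonal algebras of ranks 13, 12 and 14 -/

namespace Sl2Pair

variable {L : Type*} [LieRing L] [LieAlgebra ℂ L] {D : Sl2Pair L}

/-- An orthonormal basis of `V`, adapted to the decomposition into `W` and the line of `u`. -/
structure OrthonormalFamily (D : Sl2Pair L) where
  w : Fin 13 → L
  mem (i : Fin 13) : w i ∈ D.V
  mem_W (i : Fin 12) : w i.castSucc ∈ D.W
  last : w (Fin.last 12) = D.u
  orthonormal : IsOrthonormal D.b w
  expand (x : L) (hx : x ∈ D.V) : x = ∑ i, D.b x (w i) • w i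

namespace IsSpecial

variable (hD : D.IsSpecial)
include hD

/-- Such a `z` is a lowest weight vector of weight `-2`, so this is a computation in the
three-dimensional representation. It shows that degree `-2` is the image of degree `2` under `F`
applied twice. -/
lemma lie_lie_F_lie_lie_E {z : L} (hz : z ∈ D.gr (-2)) :
    ⁅D.F, ⁅D.F, ⁅D.E, ⁅D.E, z⁆⁆⁆⁆ = (4 : ℂ) • z := by
  have h0 : ⁅D.F, z⁆ = 0 := by
    have : ⁅D.F, z⁆ ∈ D.gr (-4) := lie_mem_eig D.F_mem hz (by norm_num)
    rwa [hD.gr_neg_four, Submodule.mem_bot] at this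
  have h1 : ⁅D.F, ⁅D.E, z⁆⁆ = (2 : ℂ) • z := by
    rw [leibniz_lie, D.lie_F_E, h0, lie_zero, add_zero, neg_lie, mem_eig.1 hz, neg_smul, neg_neg]
  have h2 : ⁅D.E, z⁆ ∈ D.gr 0 := lie_mem_eig D.E_mem hz (by norm_num)
  have h3 : ⁅D.F, ⁅D.E, ⁅D.E, z⁆⁆⁆ = (2 : ℂ) • ⁅D.E, z⁆ := by
    rw [leibniz_lie D.F, D.lie_F_E, h1, lie_smul, neg_lie, mem_eig.1 h2, zero_smul, neg_zero,
      zero_add]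
  rw [h3, lie_smul, h1, smul_smul]
  norm_num

/-- A vector of `W` in the radical of `b` is also orthogonal to `u` and `E`, so moving both copies
of `F` to one side makes it Killing-orthogonal to degree `-2`. It is orthogonal to the other degrees
for reasons of weight. -/
lemma nondegenerate_W [FiniteDimensional ℂ L] [LieAlgebra.IsKilling ℂ L] {w : L} (hw : w ∈ D.W) (h : ∀ y ∈ D.W, D.b w y = 0) : w = 0 := by
  have hκ := hD.killing_E_F_ne
  have h1 (y : L) (hy : y ∈ D.V) : killingForm ℂ L ⁅w, ⁅y, D.F⁆⁆ D.F = 0 := by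
    obtain ⟨v, hv, a, rfl⟩ := D.mem_V hy
    have h2 : D.b w (v + a • D.u) = 0 := by
      rw [map_add, map_smul, h v hv, b_W_u hw, smul_zero, add_zero]
    rw [b_apply] at h2
    exact (mul_eq_zero.1 h2).resolve_left
      (neg_ne_zero.2 (inv_ne_zero (mul_ne_zero two_ne_zero hκ)))
  have h2 (y : L) (hy : y ∈ D.gr 2) : killingForm ℂ L ⁅w, ⁅y, D.F⁆⁆ D.F = 0 := by
    obtain ⟨v, hv, a, rfl⟩ := hD.exists_of_mem_gr_two' hy
    have h3 : ⁅w, ⁅D.E, D.F⁆⁆ = (-2 : ℂ) • w := by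
      rw [D.lie_E_F, ← lie_skew, mem_eig.1 (D.W_le hw), neg_smul]
    rw [add_lie, lie_add, smul_lie, lie_smul, h3, map_add, LinearMap.add_apply, h1 v hv, map_smul,
      map_smul, LinearMap.smul_apply, LinearMap.smul_apply, D.killing_W_F hw]
    simp
  have h3 (z : L) (hz : z ∈ D.gr (-2)) : killingForm ℂ L w z = 0 := by
    have h4 := h2 ⁅D.E, ⁅D.E, z⁆⁆
      (lie_mem_eig (r := 2) D.E_mem (lie_mem_eig (r := 0) D.E_mem hz (by norm_num)) (by norm_num))
    rw [killingForm_lie_left, ← lie_skew _ D.F, ← lie_skew ⁅D.E, ⁅D.E, z⁆⁆ D.F, lie_neg,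
      neg_neg, hD.lie_lie_F_lie_lie_E hz, map_smul, smul_eq_mul] at h4
    exact (mul_eq_zero.1 h4).resolve_left (by norm_num)
  have hk : w ∈ LinearMap.ker (killingForm ℂ L) := by
    rw [LinearMap.mem_ker]
    ext z
    have hw2 := D.W_le hw
    obtain ⟨x₂, h2, x₁, h1, x₀, h0, y₁, k1, y₂, k2, rfl⟩ := hD.exists_decomp z
    simp only [map_add, LinearMap.zero_apply, h3 _ k2,
      killingForm_eq_zero_of_mem_eig hw2 h2 (by norm_num),
      killingForm_eq_zero_of_mem_eig hw2 h1 (by norm_num),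
      killingForm_eq_zero_of_mem_eig hw2 h0 (by norm_num),
      killingForm_eq_zero_of_mem_eig hw2 k1 (by norm_num), add_zero]
  rwa [LieAlgebra.IsKilling.ker_killingForm_eq_bot, Submodule.mem_bot] at hk

lemma exists_orthonormalFamily [FiniteDimensional ℂ L] [LieAlgebra.IsKilling ℂ L]
    (hW : Module.finrank ℂ D.W = 12) :
    Nonempty (OrthonormalFamily D) := by
  obtain ⟨w, hw, ho, hx⟩ := exists_isOrthonormal D.b D.W
    (fun x hx y hy => hD.b_symm (D.W_le hx) (D.W_le hy))
    (fun x hx h => hD.nondegenerate_W hx h) hW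
  have huW {x : L} (hx : x ∈ D.W) : D.b D.u x = 0 := by
    rw [hD.b_symm D.u_mem (D.W_le hx), b_W_u hx]
  refine ⟨⟨Fin.snoc w D.u, fun i => ?_, fun i => ?_, ?_, ?_, ?_⟩⟩
  · induction i using Fin.lastCases with
    | last => rw [Fin.snoc_last]; exact D.u_mem_V
    | cast i => rw [Fin.snoc_castSucc]; exact D.W_le_V (hw i)
  · rw [Fin.snoc_castSucc]; exact hw i
  · rw [Fin.snoc_last]
  · intro i j
    induction i using Fin.lastCases with
    | last =>
      induction j using Fin.lastCases with
      | last => rw [Fin.snoc_last, hD.b_u_u, if_pos rfl]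
      | cast j =>
        rw [Fin.snoc_last, Fin.snoc_castSucc, huW (hw j), if_neg (Fin.castSucc_lt_last j).ne']
    | cast i =>
      induction j using Fin.lastCases with
      | last =>
        rw [Fin.snoc_last, Fin.snoc_castSucc, b_W_u (hw i), if_neg (Fin.castSucc_lt_last i).ne]
      | cast j => rw [Fin.snoc_castSucc, Fin.snoc_castSucc, ho i j]; simp
  · intro x hx'
    obtain ⟨v, hv, a, rfl⟩ := D.mem_V hx'
    rw [Fin.sum_univ_castSucc]
    simp only [Fin.snoc_castSucc, Fin.snoc_last, map_add, map_smul, LinearMap.add_apply,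
      LinearMap.smul_apply, huW (hw _), hD.b_u_u, b_W_u hv, mul_zero, add_zero, zero_add,
      smul_eq_mul, mul_one]
    rw [← hx v hv]

end IsSpecial

namespace OrthonormalFamily

variable (B : OrthonormalFamily D) (hD : D.IsSpecial)
include hD

lemma lie_X (i j k : Fin 13) : ⁅(1 / 4 : ℂ) • D.X (B.w i) (B.w j), B.w k⁆ =
    (if j = k then B.w i else 0) - (if i = k then B.w j else 0) := by
  rw [smul_lie, hD.lie_X (B.mem i) (B.mem j) (B.mem k), B.orthonormal, B.orthonormal]
  split_ifs <;> simp [smul_sub, smul_smul]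

lemma ext_cent {x : L} (hx : x ∈ D.cent) (h : ∀ k, ⁅x, B.w k⁆ = 0) : x = 0 := by
  refine hD.eq_zero_of_mem_cent hx fun v hv => ?_
  rw [B.expand v hv, lie_sum]
  exact Finset.sum_eq_zero fun i _ => by rw [lie_smul, h, smul_zero]

/-- The matrix of the action of an element of the centralizer on `V`. -/
lemma exists_matrix {x : L} (hx : x ∈ D.cent) : ∃ A : so 13, ∀ k, ⁅x, B.w k⁆ =
    ∑ i, (A : Matrix (Fin 13) (Fin 13) ℂ) i k • B.w i := by
  refine ⟨⟨Matrix.of fun i k => D.b ⁅x, B.w k⁆ (B.w i), ?_⟩, fun k => ?_⟩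
  · rw [LieAlgebra.Orthogonal.mem_so]
    ext i k
    rw [Matrix.transpose_apply, Matrix.neg_apply, Matrix.of_apply, Matrix.of_apply,
      IsSpecial.b_cent hx,
      hD.b_symm (D.V_le (B.mem i)) (lie_mem_eig (D.cent_le hx) (D.V_le (B.mem k)) (by norm_num))]
  · exact B.expand _ (hD.lie_cent_mem_V hx (D.V_le (B.mem k)))

lemma exists_so13_equiv : ∃ ψ : so 13 ≃ₗ⁅ℂ⁆ D.cent, ∀ A, (ψ A : L) =
    soMap (fun i j => (1 / 4 : ℂ) • D.X (B.w i) (B.w j)) A :=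
  exists_so_equiv D.cent B.orthonormal.linearIndependent
    (fun i j => D.cent.smul_mem _ (hD.X_mem_cent (B.mem i) (B.mem j))) (B.lie_X hD)
    (fun _ hx h => B.ext_cent hD hx h) (fun _ hx => B.exists_matrix hD hx)

-- The stabilizer in `𝔰𝔬₁₃` of the last basis vector `u`, acting on the first twelve.
include B in
lemma exists_so12_equiv (K : LieSubalgebra ℂ L)
    (hK : ∀ x, x ∈ K ↔ x ∈ D.cent ∧ ⁅x, D.u⁆ = 0) : Nonempty (K ≃ₗ⁅ℂ⁆ so 12) := by
  have ho : IsOrthonormal D.b (fun i : Fin 12 => B.w i.castSucc) := fun i j => by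
    simp [B.orthonormal _ _]
  have hne (i : Fin 12) : i.castSucc ≠ Fin.last 12 := (Fin.castSucc_lt_last i).ne
  obtain ⟨ψ, -⟩ := exists_so_equiv K ho.linearIndependent
    (X := fun i j => (1 / 4 : ℂ) • D.X (B.w i.castSucc) (B.w j.castSucc))
    (fun i j => (hK _).2
      ⟨D.cent.smul_mem _ (hD.X_mem_cent (B.mem _) (B.mem _)), by
        rw [← B.last, B.lie_X hD, if_neg (hne _), if_neg (hne _), sub_zero]⟩)
    (fun i j k => by rw [B.lie_X hD]; simp)
    (fun x hx h => B.ext_cent hD ((hK x).1 hx).1 fun k => by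
      induction k using Fin.lastCases with
      | last => rw [B.last, ((hK x).1 hx).2]
      | cast k => exact h k)
    (fun x hx => by
      obtain ⟨A, hA⟩ := B.exists_matrix hD ((hK x).1 hx).1
      refine ⟨⟨Matrix.of fun i k => (A : Matrix (Fin 13) (Fin 13) ℂ) i.castSucc k.castSucc, ?_⟩,
        fun k => ?_⟩
      · rw [LieAlgebra.Orthogonal.mem_so]
        ext i k
        exact so_apply_swap A k.castSucc i.castSucc
      · have h0 : (A : Matrix (Fin 13) (Fin 13) ℂ) (Fin.last 12) k.castSucc = 0 := by
          have h1 := hA (Fin.last 12)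
          rw [B.last, ((hK x).1 hx).2] at h1
          have := Fintype.linearIndependent_iff.1 B.orthonormal.linearIndependent _ h1.symm
            k.castSucc
          rw [so_apply_swap, this, neg_zero]
        rw [hA, Fin.sum_univ_castSucc, h0, zero_smul, add_zero]
        rfl)
  exact ⟨ψ.symm⟩

-- The elements `⁅F, v⁆` supply the missing rotations between `V` and the line of `E`. Orthogonality
-- to `h` removes the central direction of degree `0`.
include B in
lemma exists_so14_equiv (K : LieSubalgebra ℂ L)
    (hK : ∀ x, x ∈ K ↔ x ∈ D.gr 0 ∧ killingForm ℂ L x D.h = 0) : Nonempty (K ≃ₗ⁅ℂ⁆ so 14) := by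
  have hcent {x : L} (hx : x ∈ D.cent) : x ∈ K := (hK x).2
    ⟨D.cent_le hx, by rw [← D.lie_E_F, ← killingForm_lie_left, hx.1]; simp⟩
  have hFw {v : L} (hv : v ∈ D.V) : ⁅D.F, v⁆ ∈ K := (hK _).2 ⟨IsSpecial.lie_F_mem (D.V_le hv), by
    rw [killingForm_lie_left, ← lie_skew, mem_eig.1 (D.V_le hv), killingForm_symm, map_neg,
      LinearMap.neg_apply, map_smul, LinearMap.smul_apply, hD.killing_V_F hv, smul_zero, neg_zero]⟩
  have hI : Complex.I * Complex.I = -1 := Complex.I_mul_I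
  -- If a form extending `b` is to be preserved by the operators `⁅F, v⁆`, it must give `E` norm
  -- `-1`; the factor `i` makes the last vector a unit vector.
  let w : Fin 14 → L := Fin.snoc B.w (Complex.I • D.E)
  let X : Fin 14 → Fin 14 → L := Fin.snoc
    (fun i => Fin.snoc (fun j => (1 / 4 : ℂ) • D.X (B.w i) (B.w j))
      ((Complex.I / 2) • ⁅D.F, B.w i⁆))
    (Fin.snoc (fun j => -(Complex.I / 2) • ⁅D.F, B.w j⁆) 0)
  have w_cast (i : Fin 13) : w i.castSucc = B.w i := Fin.snoc_castSucc (α := fun _ => L) _ _ _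
  have w_last : w (Fin.last 13) = Complex.I • D.E := Fin.snoc_last (α := fun _ => L) _ _
  have X_cc (i j : Fin 13) : X i.castSucc j.castSucc = (1 / 4 : ℂ) • D.X (B.w i) (B.w j) := by
    simp [X]
  have X_cl (i : Fin 13) : X i.castSucc (Fin.last 13) = (Complex.I / 2) • ⁅D.F, B.w i⁆ := by
    simp only [X, Fin.snoc_castSucc, Fin.snoc_last]
  have X_lc (j : Fin 13) : X (Fin.last 13) j.castSucc = -(Complex.I / 2) • ⁅D.F, B.w j⁆ := by
    simp only [X, Fin.snoc_castSucc, Fin.snoc_last]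
  have X_ll : X (Fin.last 13) (Fin.last 13) = 0 := by simp only [X, Fin.snoc_last]
  have hne (i : Fin 13) : i.castSucc ≠ Fin.last 13 := (Fin.castSucc_lt_last i).ne
  have hXK (i j : Fin 14) : X i j ∈ K := by
    induction i using Fin.lastCases with
    | last =>
      induction j using Fin.lastCases with
      | last => rw [X_ll]; exact K.zero_mem
      | cast j => rw [X_lc]; exact K.smul_mem _ (hFw (B.mem j))
    | cast i =>
      induction j using Fin.lastCases with
      | last => rw [X_cl]; exact K.smul_mem _ (hFw (B.mem i))
      | cast j =>
        rw [X_cc]; exact hcent (D.cent.smul_mem _ (hD.X_mem_cent (B.mem _) (B.mem _)))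
  have hX (i j k : Fin 14) :
      ⁅X i j, w k⁆ = (if j = k then w i else 0) - (if i = k then w j else 0) := by
    induction i using Fin.lastCases with
    | last =>
      induction j using Fin.lastCases with
      | last => rw [X_ll, zero_lie, sub_self]
      | cast j =>
        induction k using Fin.lastCases with
        | last =>
          rw [X_lc, w_last, if_neg (hne j), if_pos rfl, w_cast, smul_lie, lie_smul,
            hD.lie_lie_F_E (D.V_le (B.mem j)), smul_smul, smul_smul]
          match_scalars
          linear_combination hI
        | cast k =>
          rw [X_lc, w_cast, w_last, if_neg (hne k).symm, smul_lie,
            hD.lie_lie_F_V (B.mem j) (B.mem k), B.orthonormal]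
          simp only [Fin.castSucc_inj]
          split_ifs <;> module
    | cast i =>
      induction j using Fin.lastCases with
      | last =>
        induction k using Fin.lastCases with
        | last =>
          rw [X_cl, w_last, if_neg (hne i), if_pos rfl, w_cast, smul_lie, lie_smul,
            hD.lie_lie_F_E (D.V_le (B.mem i)), smul_smul, smul_smul]
          match_scalars
          linear_combination -hI
        | cast k =>
          rw [X_cl, w_cast, w_last, if_neg (hne k).symm, smul_lie,
            hD.lie_lie_F_V (B.mem i) (B.mem k), B.orthonormal]
          simp only [Fin.castSucc_inj]
          split_ifs <;> module
      | cast j =>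
        induction k using Fin.lastCases with
        | last =>
          rw [X_cc, w_last, if_neg (hne i), if_neg (hne j), smul_lie, lie_smul,
            hD.lie_X_E (B.mem i) (B.mem j)]
          simp
        | cast k =>
          rw [X_cc, w_cast, B.lie_X hD, w_cast, w_cast]
          simp only [Fin.castSucc_inj]
  have lin : LinearIndependent ℂ w := by
    refine LinearIndependent.finSnoc B.orthonormal.linearIndependent ?_
    intro h
    have h1 : Complex.I • D.E ∈ D.V :=
      (Submodule.span_le.2 (Set.range_subset_iff.2 B.mem)) h
    have h2 := hD.killing_V_F h1
    rw [map_smul, LinearMap.smul_apply, smul_eq_mul] at h2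
    exact mul_ne_zero Complex.I_ne_zero hD.killing_E_F_ne h2
  obtain ⟨ψ', hψ'⟩ := B.exists_so13_equiv hD
  obtain ⟨ψ, -⟩ := exists_so_equiv K lin hXK hX
    (fun x hx h => by
      refine hD.faithful x ((hK x).1 hx).1 fun y hy => ?_
      obtain ⟨v, hv, a, rfl⟩ := hD.exists_of_mem_gr_two' hy
      have hE : ⁅x, D.E⁆ = 0 := by
        have := h (Fin.last 13)
        rw [w_last, lie_smul] at this
        exact (smul_eq_zero.1 this).resolve_left Complex.I_ne_zero
      rw [B.expand v hv, lie_add, lie_smul, hE, lie_sum, smul_zero, add_zero]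
      exact Finset.sum_eq_zero fun i _ => by rw [lie_smul, ← w_cast, h, smul_zero])
    -- Write `x` as `x - ½ ⁅F, ⁅E, x⁆⁆`, which kills `E` and lies in the span of the `𝔰𝔬₁₃`
    -- rotations, plus `½ ⁅F, v⁆` with `v = ⁅E, x⁆` in `V`.
    (fun x hx => exists_so_of_mem_span hX (by
      obtain ⟨hx0, hxh⟩ := (hK x).1 hx
      have hv2 : ⁅D.E, x⁆ ∈ D.gr 2 := lie_mem_eig D.E_mem hx0 (by norm_num)
      have hv : ⁅D.E, x⁆ ∈ D.V := hD.mem_V_of_killing hv2 (by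
        rw [← lie_skew, map_neg, LinearMap.neg_apply, killingForm_lie_left, D.lie_E_F, hxh,
          neg_zero])
      have hc : x - (1 / 2 : ℂ) • ⁅D.F, ⁅D.E, x⁆⁆ ∈ D.cent := by
        refine hD.mem_cent_of_lie_E (sub_mem hx0 (Submodule.smul_mem _ _
          (IsSpecial.lie_F_mem hv2))) ?_
        rw [sub_lie, smul_lie, hD.lie_lie_F_E hv2, ← lie_skew x]
        module
      have h1 : x - (1 / 2 : ℂ) • ⁅D.F, ⁅D.E, x⁆⁆ ∈
          Submodule.span ℂ (Set.range fun p : Fin 14 × Fin 14 => X p.1 p.2) := by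
        obtain ⟨A, hA⟩ := ψ'.surjective ⟨_, hc⟩
        have h2 := hψ' A
        rw [show ψ' A = ⟨_, hc⟩ from hA] at h2
        rw [show x - (1 / 2 : ℂ) • ⁅D.F, ⁅D.E, x⁆⁆ = _ from h2]
        refine Submodule.span_mono ?_ (soMap_mem_span _ A)
        rintro _ ⟨⟨i, j⟩, rfl⟩
        exact ⟨(i.castSucc, j.castSucc), X_cc i j⟩
      have h3 : ⁅D.F, ⁅D.E, x⁆⁆ ∈
          Submodule.span ℂ (Set.range fun p : Fin 14 × Fin 14 => X p.1 p.2) := by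
        rw [B.expand _ hv, lie_sum]
        refine sum_mem fun i _ => ?_
        have h4 : ⁅D.F, B.w i⁆ = (-2 * Complex.I) • X i.castSucc (Fin.last 13) := by
          rw [X_cl, smul_smul]
          match_scalars
          linear_combination hI
        rw [lie_smul, h4]
        exact Submodule.smul_mem _ _ (Submodule.smul_mem _ _
          (Submodule.subset_span ⟨(i.castSucc, Fin.last 13), rfl⟩))
      have := add_mem h1 (Submodule.smul_mem _ (1 / 2 : ℂ) h3)
      rwa [sub_add_cancel] at this))
  exact ⟨ψ.symm⟩

end OrthonormalFamily
end Sl2Pair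

/-! ### The Clifford action on degree one -/

namespace Sl2Pair

variable {L : Type*} [LieRing L] [LieAlgebra ℂ L] (D : Sl2Pair L)

/-- The action of the top degree on the degree one part through which the Clifford algebra acts. -/
def cl : D.gr 2 →ₗ[ℂ] Module.End ℂ (D.gr 1) :=
  LinearMap.mk₂ ℂ
    (fun v s => ⟨⁅(v : L), ⁅D.F, (s : L)⁆⁆,
      lie_mem_eig (s := 2) (t := -1) v.2 (lie_mem_eig D.F_mem s.2 (by norm_num)) (by norm_num)⟩)
    (fun v v' s => Subtype.ext (add_lie _ _ _))
    (fun c v s => Subtype.ext (smul_lie _ _ _))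
    (fun v s s' => Subtype.ext (by simp))
    (fun c v s => Subtype.ext (by simp))

lemma coe_cl (v : D.gr 2) (s : D.gr 1) : (D.cl v s : L) = ⁅(v : L), ⁅D.F, (s : L)⁆⁆ := rfl

/-- The action of the centralizer on the degree one part. -/
def adGr : D.cent →ₗ⁅ℂ⁆ Module.End ℂ (D.gr 1) where
  toFun x :=
    { toFun := fun s => ⟨⁅(x : L), (s : L)⁆, lie_mem_eig (D.cent_le x.2) s.2 (zero_add _)⟩
      map_add' := fun s t => Subtype.ext (lie_add _ _ _)
      map_smul' := fun c s => Subtype.ext (lie_smul _ _ _) }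
  map_add' x y := by ext s; exact add_lie _ _ _
  map_smul' c x := by ext s; exact smul_lie _ _ _
  map_lie' {x y} := by ext s; exact lie_lie _ _ _

variable {D}

lemma lie_cent_F {x : L} (hx : x ∈ D.cent) (y : L) : ⁅x, ⁅D.F, y⁆⁆ = ⁅D.F, ⁅x, y⁆⁆ := by
  rw [leibniz_lie, hx.2, zero_lie, zero_add]

namespace IsSpecial

variable (hD : D.IsSpecial)
include hD

lemma lie_eq_zero_of_add_eq_three {x y : L} (hx : x ∈ D.gr 2) (hy : y ∈ D.gr 1) :
    ⁅x, y⁆ = 0 := by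
  have : ⁅x, y⁆ ∈ D.gr 3 := lie_mem_eig hx hy (by norm_num)
  rwa [hD.gr_three, Submodule.mem_bot] at this

lemma lie_F_lie_F_gr_one {s : L} (hs : s ∈ D.gr 1) : ⁅D.F, ⁅D.F, s⁆⁆ = 0 := by
  have : ⁅D.F, ⁅D.F, s⁆⁆ ∈ D.gr (-3) :=
    lie_mem_eig D.F_mem (lie_mem_eig (r := -1) D.F_mem hs (by norm_num)) (by norm_num)
  rwa [hD.gr_neg_three, Submodule.mem_bot] at this

lemma lie_E_lie_F_gr_one {s : L} (hs : s ∈ D.gr 1) : ⁅D.E, ⁅D.F, s⁆⁆ = s := by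
  rw [leibniz_lie, D.lie_E_F, hD.lie_eq_zero_of_add_eq_three D.E_mem hs, lie_zero, add_zero,
    mem_eig.1 hs, one_smul]

lemma lie_F_lie_E_gr_neg_one {s : L} (hs : s ∈ D.gr (-1)) : ⁅D.F, ⁅D.E, s⁆⁆ = s := by
  have : ⁅D.F, s⁆ ∈ D.gr (-3) := lie_mem_eig D.F_mem hs (by norm_num)
  rw [hD.gr_neg_three, Submodule.mem_bot] at this
  rw [leibniz_lie, D.lie_F_E, this, lie_zero, add_zero, neg_lie, mem_eig.1 hs, neg_smul, neg_neg,
    one_smul]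

lemma lie_lie_F_gr_one {v s : L} (hv : v ∈ D.gr 2) (hs : s ∈ D.gr 1) :
    ⁅⁅D.F, v⁆, s⁆ = -⁅v, ⁅D.F, s⁆⁆ := by
  rw [lie_lie, hD.lie_eq_zero_of_add_eq_three hv hs, lie_zero, zero_sub]

/-- Let `T` be the square of the operator of `v`, applied to `s`. As `F` kills `⁅F, s⁆`, the Jacobi
identity and `⁅v, ⁅F, v⁆⁆ = 2 b(v, v) E` give `T = 2 b(v, v) s - T`. -/
lemma cl_mul_cl (v : D.gr 2) (hv : (v : L) ∈ D.V) :
    D.cl v * D.cl v = algebraMap ℂ _ (D.b v v) := by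
  ext s
  rw [Module.End.mul_apply, Module.algebraMap_end_apply, coe_cl, coe_cl, Submodule.coe_smul]
  have h1 : ⁅D.F, ⁅(v : L), ⁅D.F, (s : L)⁆⁆⁆ = ⁅⁅D.F, (v : L)⁆, ⁅D.F, (s : L)⁆⁆ := by
    rw [leibniz_lie, hD.lie_F_lie_F_gr_one s.2, lie_zero, add_zero]
  have h2 : ⁅(v : L), ⁅D.F, (v : L)⁆⁆ = (2 * D.b v v) • D.E := by
    rw [← lie_skew _ (v : L), lie_neg, hD.lie_lie_F hv hv]
    module
  have h3 : ⁅(v : L), ⁅D.F, ⁅(v : L), ⁅D.F, (s : L)⁆⁆⁆⁆ = (2 * D.b v v) • (s : L) -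
      ⁅(v : L), ⁅D.F, ⁅(v : L), ⁅D.F, (s : L)⁆⁆⁆⁆ := by
    have h4 := hD.lie_lie_F_gr_one v.2 (D.cl v s).2
    rw [coe_cl] at h4
    conv_lhs => rw [h1, leibniz_lie, h2, smul_lie, hD.lie_E_lie_F_gr_one s.2, h4,
      ← sub_eq_add_neg]
  have h4 : (2 : ℂ) • ⁅(v : L), ⁅D.F, ⁅(v : L), ⁅D.F, (s : L)⁆⁆⁆⁆ = (2 * D.b v v) • (s : L) := by
    rw [two_smul]
    nth_rw 1 [h3]
    rw [sub_add_cancel]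
  rw [mul_smul] at h4
  exact smul_right_injective L (two_ne_zero (α := ℂ)) h4

/-- On degree `1` the element `⁅F, v⁆` acts as minus the Clifford operator of `v`, because degree
`3` vanishes; the two signs cancel in the commutator. -/
lemma lie_X_gr_one (v v' : D.gr 2) (s : D.gr 1) :
    ⁅D.X v v', (s : L)⁆ = ((D.cl v * D.cl v' - D.cl v' * D.cl v) s : D.gr 1) := by
  rw [X, lie_lie, hD.lie_lie_F_gr_one v'.2 s.2, hD.lie_lie_F_gr_one v.2 s.2, lie_neg, lie_neg,
    ← coe_cl, ← coe_cl, hD.lie_lie_F_gr_one v.2 (D.cl v' s).2,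
    hD.lie_lie_F_gr_one v'.2 (D.cl v s).2, ← coe_cl, ← coe_cl, neg_neg, neg_neg]
  simp

omit hD in
lemma eq_zero_of_sum_eq_zero {x₂ x₁ x₀ y₁ y₂ : L} (h2 : x₂ ∈ D.gr 2) (h1 : x₁ ∈ D.gr 1)
    (h0 : x₀ ∈ D.gr 0) (k1 : y₁ ∈ D.gr (-1)) (k2 : y₂ ∈ D.gr (-2))
    (h : x₂ + x₁ + x₀ + y₁ + y₂ = 0) : x₂ = 0 ∧ x₁ = 0 ∧ x₀ = 0 ∧ y₁ = 0 ∧ y₂ = 0 := by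
  rw [mem_eig] at *
  have step {a c d e f : ℂ} (h : a • x₂ + c • x₁ + d • x₀ + e • y₁ + f • y₂ = 0) :
      (2 * a) • x₂ + c • x₁ - e • y₁ - (2 * f) • y₂ = 0 := by
    have := congrArg (fun z => ⁅D.h, z⁆) h
    simp only [lie_add, lie_smul, h2, h1, h0, k1, k2, lie_zero] at this
    linear_combination (norm := module) this
  have e0 : (1 : ℂ) • x₂ + (1 : ℂ) • x₁ + (1 : ℂ) • x₀ + (1 : ℂ) • y₁ + (1 : ℂ) • y₂ = 0 := by
    linear_combination (norm := module) h
  have e1 : (2 : ℂ) • x₂ + (1 : ℂ) • x₁ + (0 : ℂ) • x₀ + (-1 : ℂ) • y₁ + (-2 : ℂ) • y₂ = 0 := by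
    linear_combination (norm := module) step e0
  have e2 : (4 : ℂ) • x₂ + (1 : ℂ) • x₁ + (0 : ℂ) • x₀ + (1 : ℂ) • y₁ + (4 : ℂ) • y₂ = 0 := by
    linear_combination (norm := module) step e1
  have e3 : (8 : ℂ) • x₂ + (1 : ℂ) • x₁ + (0 : ℂ) • x₀ + (-1 : ℂ) • y₁ + (-8 : ℂ) • y₂ = 0 := by
    linear_combination (norm := module) step e2
  have e4 : (16 : ℂ) • x₂ + (1 : ℂ) • x₁ + (0 : ℂ) • x₀ + (1 : ℂ) • y₁ + (16 : ℂ) • y₂ = 0 := by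
    linear_combination (norm := module) step e3
  -- `ek` is the relation after `k` applications of `ad h`. The coefficients below are those of the
  -- Lagrange polynomials at the nodes `2, 1, 0, -1, -2`.
  refine ⟨?_, ?_, ?_, ?_, ?_⟩
  · linear_combination (norm := module) (1 / 24 : ℂ) • e4 + (1 / 12 : ℂ) • e3 - (1 / 24 : ℂ) • e2 -
      (1 / 12 : ℂ) • e1
  · linear_combination (norm := module) (-1 / 6 : ℂ) • e4 - (1 / 6 : ℂ) • e3 + (2 / 3 : ℂ) • e2 +
      (2 / 3 : ℂ) • e1
  · linear_combination (norm := module) (1 / 4 : ℂ) • e4 - (5 / 4 : ℂ) • e2 + e0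
  · linear_combination (norm := module) (-1 / 6 : ℂ) • e4 + (1 / 6 : ℂ) • e3 + (2 / 3 : ℂ) • e2 -
      (2 / 3 : ℂ) • e1
  · linear_combination (norm := module) (1 / 24 : ℂ) • e4 - (1 / 12 : ℂ) • e3 - (1 / 24 : ℂ) • e2 +
      (1 / 12 : ℂ) • e1

end IsSpecial

end Sl2Pair

/-! ### Coordinates on `𝔰𝔩₂` -/

section SpecialLinear

lemma sl2_apply_one_one (X : sl2) :
    (X : Matrix (Fin 2) (Fin 2) ℂ) 1 1 = -(X : Matrix (Fin 2) (Fin 2) ℂ) 0 0 := by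
  have h : Matrix.trace (X : Matrix (Fin 2) (Fin 2) ℂ) = 0 := X.2
  rw [Matrix.trace_fin_two] at h
  linear_combination h

lemma coe_slE : (slE : Matrix (Fin 2) (Fin 2) ℂ) = !![0, 1; 0, 0] := by
  rw [slE, LieAlgebra.SpecialLinear.val_single]
  ext i j; fin_cases i <;> fin_cases j <;> simp

lemma coe_slF : (slF : Matrix (Fin 2) (Fin 2) ℂ) = !![0, 0; 1, 0] := by
  rw [slF, LieAlgebra.SpecialLinear.val_single]
  ext i j; fin_cases i <;> fin_cases j <;> simp

lemma coe_slH : (slH : Matrix (Fin 2) (Fin 2) ℂ) = !![1, 0; 0, -1] := by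
  rw [slH, LieAlgebra.SpecialLinear.val_singleSubSingle]
  ext i j; fin_cases i <;> fin_cases j <;> simp

lemma sl2_eq (X : sl2) : X = (X : Matrix (Fin 2) (Fin 2) ℂ) 0 1 • slE +
    (X : Matrix (Fin 2) (Fin 2) ℂ) 1 0 • slF + (X : Matrix (Fin 2) (Fin 2) ℂ) 0 0 • slH := by
  refine Subtype.ext (Matrix.ext fun i j => ?_)
  have h := sl2_apply_one_one X
  change _ = ((X : Matrix (Fin 2) (Fin 2) ℂ) 0 1 • (slE : Matrix (Fin 2) (Fin 2) ℂ) +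
    (X : Matrix (Fin 2) (Fin 2) ℂ) 1 0 • (slF : Matrix (Fin 2) (Fin 2) ℂ) +
    (X : Matrix (Fin 2) (Fin 2) ℂ) 0 0 • (slH : Matrix (Fin 2) (Fin 2) ℂ)) i j
  rw [coe_slE, coe_slF, coe_slH]
  fin_cases i <;> fin_cases j <;> simp [h]

lemma lie_slE_slF : ⁅slE, slF⁆ = slH := by
  refine Subtype.ext ?_
  rw [LieSubalgebra.coe_bracket, Ring.lie_def, coe_slE, coe_slF, coe_slH]
  simp

lemma lie_slH_slE : ⁅slH, slE⁆ = (2 : ℂ) • slE := by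
  refine Subtype.ext ?_
  rw [LieSubalgebra.coe_bracket, Ring.lie_def, SetLike.val_smul, coe_slE, coe_slH]
  ext i j
  fin_cases i <;> fin_cases j <;> norm_num

lemma lie_slH_slF : ⁅slH, slF⁆ = (-2 : ℂ) • slF := by
  refine Subtype.ext ?_
  rw [LieSubalgebra.coe_bracket, Ring.lie_def, SetLike.val_smul, coe_slF, coe_slH]
  ext i j
  fin_cases i <;> fin_cases j <;> norm_num

/-- A matrix entry, as a linear form on `𝔰𝔩₂`. -/
def slEntry (i j : Fin 2) : sl2 →ₗ[ℂ] ℂ where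
  toFun X := (X : Matrix (Fin 2) (Fin 2) ℂ) i j
  map_add' _ _ := rfl
  map_smul' _ _ := rfl

lemma slEntry_apply (i j : Fin 2) (X : sl2) :
    slEntry i j X = (X : Matrix (Fin 2) (Fin 2) ℂ) i j := rfl

lemma slEntry_lie_zero_zero (X Y : sl2) :
    slEntry 0 0 ⁅X, Y⁆ = slEntry 0 1 X * slEntry 1 0 Y - slEntry 0 1 Y * slEntry 1 0 X := by
  simp only [slEntry_apply, LieSubalgebra.coe_bracket, Ring.lie_def, Matrix.sub_apply,
    Matrix.mul_apply, Fin.sum_univ_two]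
  ring

lemma slEntry_lie_zero_one (X Y : sl2) : slEntry 0 1 ⁅X, Y⁆ =
    2 * slEntry 0 0 X * slEntry 0 1 Y - 2 * slEntry 0 1 X * slEntry 0 0 Y := by
  simp only [slEntry_apply, LieSubalgebra.coe_bracket, Ring.lie_def, Matrix.sub_apply,
    Matrix.mul_apply, Fin.sum_univ_two, sl2_apply_one_one]
  ring

lemma slEntry_lie_one_zero (X Y : sl2) : slEntry 1 0 ⁅X, Y⁆ =
    2 * slEntry 1 0 X * slEntry 0 0 Y - 2 * slEntry 0 0 X * slEntry 1 0 Y := by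
  simp only [slEntry_apply, LieSubalgebra.coe_bracket, Ring.lie_def, Matrix.sub_apply,
    Matrix.mul_apply, Fin.sum_univ_two, sl2_apply_one_one]
  ring

lemma naturalRep_apply {n : Type*} [Fintype n] [DecidableEq n]
    (𝔤 : LieSubalgebra ℂ (Matrix n n ℂ)) (A : 𝔤) (v : n → ℂ) :
    naturalRep 𝔤 A v = (A : Matrix n n ℂ).mulVec v := by
  simp [naturalRep]

end SpecialLinear

/-! ### The four isotypic components and their equivariance -/

namespace Sl2Pair

variable {L : Type*} [LieRing L] [LieAlgebra ℂ L] {D : Sl2Pair L}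

/-- The data for the decomposition of `L` under the diagonal `𝔰𝔩₂` and its centralizer. -/
structure Decomposition (D : Sl2Pair L) (S : Type*) [AddCommGroup S] [Module ℂ S] where
  special : D.IsSpecial
  family : OrthonormalFamily D
  φ : sl2 →ₗ⁅ℂ⁆ L
  φ_slE : φ slE = D.E
  φ_slF : φ slF = D.F
  ψ : so 13 ≃ₗ⁅ℂ⁆ D.cent
  ψ_apply (A : so 13) : (ψ A : L) =
    soMap (fun i j => (1 / 4 : ℂ) • D.X (family.w i) (family.w j)) A
  e : S ≃ₗ[ℂ] D.gr 1

namespace Decomposition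

variable {S : Type*} [AddCommGroup S] [Module ℂ S] (P : Decomposition D S)

/-- The representation of `𝔰𝔬₁₃` on the degree one part. -/
def spin : so 13 →ₗ⁅ℂ⁆ Module.End ℂ S :=
  ((LinearEquiv.lieConj P.e.symm : Module.End ℂ (D.gr 1) →ₗ⁅ℂ⁆ Module.End ℂ S).comp D.adGr).comp
    (P.ψ : so 13 →ₗ⁅ℂ⁆ D.cent)

lemma e_spin (A : so 13) (s : S) : (P.e (P.spin A s) : L) = ⁅(P.ψ A : L), (P.e s : L)⁆ := by
  change ((P.e (P.e.symm (D.adGr (P.ψ A) (P.e s))) : D.gr 1) : L) = _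
  rw [LinearEquiv.apply_symm_apply]
  rfl

/-- The isomorphism of `ℂ¹³` with `V`. -/
def vec : (Fin 13 → ℂ) →ₗ[ℂ] L := Fintype.linearCombination ℂ P.family.w

lemma vec_apply (m : Fin 13 → ℂ) : P.vec m = ∑ i, m i • P.family.w i :=
  Fintype.linearCombination_apply ℂ P.family.w m

lemma vec_mem (m : Fin 13 → ℂ) : P.vec m ∈ D.V := by
  rw [vec_apply]
  exact sum_mem fun i _ => Submodule.smul_mem _ _ (P.family.mem i)

lemma vec_surj {v : L} (hv : v ∈ D.V) : ∃ m, P.vec m = v :=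
  ⟨fun i => D.b v (P.family.w i), by rw [vec_apply, ← P.family.expand v hv]⟩

lemma vec_inj {m : Fin 13 → ℂ} (hm : P.vec m = 0) : m = 0 := by
  rw [vec_apply] at hm
  exact funext (Fintype.linearIndependent_iff.1 P.family.orthonormal.linearIndependent m hm)

lemma lie_ψ_vec (A : so 13) (m : Fin 13 → ℂ) :
    ⁅(P.ψ A : L), P.vec m⁆ = P.vec (naturalRep (so 13) A m) := by
  simp only [vec_apply, naturalRep_apply, P.ψ_apply, lie_sum, lie_smul,
    soMap_lie (P.family.lie_X P.special), Matrix.mulVec, dotProduct, Finset.sum_smul,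
    Finset.smul_sum, smul_smul]
  rw [Finset.sum_comm]
  exact Finset.sum_congr rfl fun i _ => Finset.sum_congr rfl fun j _ => by rw [mul_comm]

lemma φ_apply (X : sl2) : P.φ X =
    slEntry 0 1 X • D.E + slEntry 1 0 X • D.F + slEntry 0 0 X • D.h := by
  conv_lhs => rw [sl2_eq X]
  rw [map_add, map_add, map_smul, map_smul, map_smul, ← lie_slE_slF, LieHom.map_lie, P.φ_slE,
    P.φ_slF, D.lie_E_F]
  rfl

/-- The component of the adjoint representation of `𝔰𝔬₁₃`. -/
def compAd : ℂ ⊗[ℂ] so 13 →ₗ[ℂ] L :=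
  TensorProduct.lift (LinearMap.mk₂ ℂ (fun c A => c • (P.ψ A : L))
    (fun _ _ _ => add_smul _ _ _) (fun _ _ _ => mul_smul _ _ _)
    (fun _ _ _ => by simp) (fun c c' A => by simp [smul_comm c' c]))

/-- The component of the spin representation. -/
def compSpin : (Fin 2 → ℂ) ⊗[ℂ] S →ₗ[ℂ] L :=
  TensorProduct.lift (LinearMap.mk₂ ℂ
    (fun u s => u 0 • (P.e s : L) + u 1 • ⁅D.F, (P.e s : L)⁆)
    (fun _ _ _ => by simp only [Pi.add_apply]; module)
    (fun _ _ _ => by simp only [Pi.smul_apply, smul_eq_mul]; module)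
    (fun _ _ _ => by simp only [map_add, Submodule.coe_add, lie_add]; module)
    (fun _ _ _ => by simp only [map_smul, Submodule.coe_smul, lie_smul]; module))

/-- The component of the adjoint representation of `𝔰𝔩₂`. -/
def compSl : sl2 ⊗[ℂ] ℂ →ₗ[ℂ] L :=
  TensorProduct.lift (LinearMap.mk₂ ℂ (fun X c => c • P.φ X)
    (fun _ _ _ => by simp) (fun c X c' => by simp [smul_comm c c'])
    (fun _ _ _ => add_smul _ _ _) (fun _ _ _ => mul_smul _ _ _))

/-- The component of the vector representation. -/
def compVec : sl2 ⊗[ℂ] (Fin 13 → ℂ) →ₗ[ℂ] L :=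
  TensorProduct.lift (LinearMap.mk₂ ℂ
    -- Forced by sending `slE ⊗ m` to the vector `v` of `m`: from `⁅slF, slE⁆ = -slH` and `⁅slF,
    -- slH⁆ = 2 slF`, equivariance gives `slH ⊗ m ↦ -⁅F, v⁆` and `slF ⊗ m ↦ -½ ⁅F, ⁅F, v⁆⁆`.
    (fun X m => slEntry 0 1 X • P.vec m - slEntry 0 0 X • ⁅D.F, P.vec m⁆ -
      (slEntry 1 0 X / 2) • ⁅D.F, ⁅D.F, P.vec m⁆⁆)
    (fun _ _ _ => by simp only [map_add]; module)
    (fun _ _ _ => by simp only [map_smul, smul_eq_mul]; module)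
    (fun _ _ _ => by simp only [map_add, lie_add]; module)
    (fun _ _ _ => by simp only [map_smul, lie_smul]; module))

lemma compAd_tmul (c : ℂ) (A : so 13) : P.compAd (c ⊗ₜ A) = c • (P.ψ A : L) := rfl

lemma compSpin_tmul (u : Fin 2 → ℂ) (s : S) :
    P.compSpin (u ⊗ₜ s) = u 0 • (P.e s : L) + u 1 • ⁅D.F, (P.e s : L)⁆ := rfl

lemma compSl_tmul (X : sl2) (c : ℂ) : P.compSl (X ⊗ₜ c) = c • P.φ X := rfl

lemma compVec_tmul (X : sl2) (m : Fin 13 → ℂ) : P.compVec (X ⊗ₜ m) =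
    slEntry 0 1 X • P.vec m - slEntry 0 0 X • ⁅D.F, P.vec m⁆ -
      (slEntry 1 0 X / 2) • ⁅D.F, ⁅D.F, P.vec m⁆⁆ := rfl

lemma lie_φ_ψ (X : sl2) (A : so 13) : ⁅P.φ X, (P.ψ A : L)⁆ = 0 := by
  have h0 := D.cent_le (P.ψ A).2
  rw [mem_eig, zero_smul] at h0
  rw [P.φ_apply, ← lie_skew, lie_add, lie_add, lie_smul, lie_smul, lie_smul, (P.ψ A).2.1,
    (P.ψ A).2.2, ← lie_skew, h0]
  simp

lemma compAd_equivariant (X : sl2) (A : so 13) (t : ℂ ⊗[ℂ] so 13) :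
    P.compAd (boxTensorRep (trivialRep sl2) (adjointRep (so 13)) (X, A) t) =
      ⁅P.φ X + (P.ψ A : L), P.compAd t⁆ := by
  induction t using TensorProduct.induction_on with
  | zero => simp
  | add x y hx hy => rw [map_add, map_add, hx, hy, map_add, lie_add]
  | tmul c A' =>
    rw [compAd_tmul, lie_smul, add_lie, lie_φ_ψ, zero_add, ← LieSubalgebra.coe_bracket,
      ← LieEquiv.map_lie]
    simp [boxTensorRep, compAd_tmul]

lemma compSpin_equivariant (X : sl2) (A : so 13) (t : (Fin 2 → ℂ) ⊗[ℂ] S) :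
    P.compSpin (boxTensorRep (naturalRep sl2) P.spin (X, A) t) =
      ⁅P.φ X + (P.ψ A : L), P.compSpin t⁆ := by
  induction t using TensorProduct.induction_on with
  | zero => simp
  | add x y hx hy => rw [map_add, map_add, hx, hy, map_add, lie_add]
  | tmul u s =>
    have h1 := P.special.lie_eq_zero_of_add_eq_three D.E_mem (P.e s).2
    have h2 := P.special.lie_E_lie_F_gr_one (P.e s).2
    have h3 := P.special.lie_F_lie_F_gr_one (P.e s).2
    have h4 : ⁅D.h, ((P.e s : D.gr 1) : L)⁆ = (1 : ℂ) • (P.e s : L) := (P.e s).2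
    have h5 : ⁅D.h, ⁅D.F, ((P.e s : D.gr 1) : L)⁆⁆ = (-1 : ℂ) • ⁅D.F, (P.e s : L)⁆ :=
      lie_mem_eig D.F_mem (P.e s).2 (by norm_num)
    have h6 : ((naturalRep sl2) X u) 0 = slEntry 0 0 X * u 0 + slEntry 0 1 X * u 1 := by
      rw [naturalRep_apply]; simp [Matrix.mulVec, dotProduct, Fin.sum_univ_two, slEntry_apply]
    have h7 : ((naturalRep sl2) X u) 1 = slEntry 1 0 X * u 0 - slEntry 0 0 X * u 1 := by
      rw [naturalRep_apply]
      simp [Matrix.mulVec, dotProduct, Fin.sum_univ_two, slEntry_apply, sl2_apply_one_one,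
        sub_eq_add_neg]
    have h8 : boxTensorRep (naturalRep sl2) P.spin (X, A) (u ⊗ₜ s) =
      naturalRep sl2 X u ⊗ₜ s + u ⊗ₜ P.spin A s := rfl
    rw [h8, map_add, compSpin_tmul, compSpin_tmul, compSpin_tmul, h6, h7, e_spin, P.φ_apply]
    simp only [add_lie, lie_add, smul_lie, lie_smul, h1, h2, h3, h4, h5,
      lie_cent_F (P.ψ A).2]
    module

lemma compSl_equivariant (X : sl2) (A : so 13) (t : sl2 ⊗[ℂ] ℂ) :
    P.compSl (boxTensorRep (adjointRep sl2) (trivialRep (so 13)) (X, A) t) =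
      ⁅P.φ X + (P.ψ A : L), P.compSl t⁆ := by
  induction t using TensorProduct.induction_on with
  | zero => simp
  | add x y hx hy => rw [map_add, map_add, hx, hy, map_add, lie_add]
  | tmul Y c =>
    rw [compSl_tmul, lie_smul, add_lie, ← lie_skew (P.ψ A : L), lie_φ_ψ, neg_zero, add_zero]
    simp [boxTensorRep, compSl_tmul]

lemma compVec_equivariant (X : sl2) (A : so 13) (t : sl2 ⊗[ℂ] (Fin 13 → ℂ)) :
    P.compVec (boxTensorRep (adjointRep sl2) (naturalRep (so 13)) (X, A) t) =
      ⁅P.φ X + (P.ψ A : L), P.compVec t⁆ := by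
  induction t using TensorProduct.induction_on with
  | zero => simp
  | add x y hx hy => rw [map_add, map_add, hx, hy, map_add, lie_add]
  | tmul Y m =>
    have hm := D.V_le (P.vec_mem m)
    have hF : ⁅D.F, P.vec m⁆ ∈ D.gr 0 := lie_mem_eig D.F_mem hm (by norm_num)
    have hFF : ⁅D.F, ⁅D.F, P.vec m⁆⁆ ∈ D.gr (-2) := lie_mem_eig D.F_mem hF (by norm_num)
    have h1 : ⁅D.E, P.vec m⁆ = 0 := P.special.lie_eq_zero_of_add_eq_four D.E_mem hm
    have h2 : ⁅D.E, ⁅D.F, P.vec m⁆⁆ = (2 : ℂ) • P.vec m := P.special.lie_E_lie_F hm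
    have h3 : ⁅D.E, ⁅D.F, ⁅D.F, P.vec m⁆⁆⁆ = (2 : ℂ) • ⁅D.F, P.vec m⁆ := by
      rw [leibniz_lie D.E, D.lie_E_F, h2, lie_smul, mem_eig.1 hF, zero_smul, zero_add]
    have h4 : ⁅D.F, ⁅D.F, ⁅D.F, P.vec m⁆⁆⁆ = 0 := by
      have : ⁅D.F, ⁅D.F, ⁅D.F, P.vec m⁆⁆⁆ ∈ D.gr (-4) := lie_mem_eig D.F_mem hFF (by norm_num)
      rwa [P.special.gr_neg_four, Submodule.mem_bot] at this
    have h8 : boxTensorRep (adjointRep sl2) (naturalRep (so 13)) (X, A) (Y ⊗ₜ m) =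
      ⁅X, Y⁆ ⊗ₜ m + Y ⊗ₜ naturalRep (so 13) A m := rfl
    rw [h8, map_add, compVec_tmul, compVec_tmul, compVec_tmul, P.φ_apply,
      slEntry_lie_zero_zero, slEntry_lie_zero_one, slEntry_lie_one_zero, ← lie_ψ_vec]
    simp only [add_lie, lie_sub, smul_lie, lie_smul, h1, h2, h3, h4, mem_eig.1 hm, mem_eig.1 hF,
      mem_eig.1 hFF, lie_cent_F (P.ψ A).2]
    module

/-- The map from the sum of the four tensor products. -/
def total : (ℂ ⊗[ℂ] so 13) × ((Fin 2 → ℂ) ⊗[ℂ] S) × (sl2 ⊗[ℂ] ℂ) × (sl2 ⊗[ℂ] (Fin 13 → ℂ)) →ₗ[ℂ]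
    L :=
  P.compAd.coprod (P.compSpin.coprod (P.compSl.coprod P.compVec))

lemma total_equivariant (X : sl2) (A : so 13)
    (t : (ℂ ⊗[ℂ] so 13) × ((Fin 2 → ℂ) ⊗[ℂ] S) × (sl2 ⊗[ℂ] ℂ) × (sl2 ⊗[ℂ] (Fin 13 → ℂ))) :
    P.total (directSumRep (boxTensorRep (trivialRep sl2) (adjointRep (so 13)))
      (directSumRep (boxTensorRep (naturalRep sl2) P.spin)
        (directSumRep (boxTensorRep (adjointRep sl2) (trivialRep (so 13)))
          (boxTensorRep (adjointRep sl2) (naturalRep (so 13))))) (X, A) t) =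
      ⁅P.φ X + (P.ψ A : L), P.total t⁆ := by
  obtain ⟨t₀, t₁, t₂, t₃⟩ := t
  simp only [total, LinearMap.coprod_apply, lie_add, ← compAd_equivariant,
    ← compSpin_equivariant, ← compSl_equivariant, ← compVec_equivariant]
  rfl

end Decomposition
end Sl2Pair

/-! ### Bijectivity of the decomposition map and the spin module -/

namespace Sl2Pair

variable {L : Type*} [LieRing L] [LieAlgebra ℂ L] {D : Sl2Pair L}

namespace IsSpecial

variable (hD : D.IsSpecial)
include hD

/-- Since `E` after `F` is multiplication by `2` on degree `2`, subtracting `½ ⁅F, ⁅E, x⁆⁆` lands in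
the centralizer; splitting `⁅E, x⁆` along `V` and `E` gives the other two terms. -/
lemma exists_of_mem_gr_zero {x : L} (hx : x ∈ D.gr 0) :
    ∃ c ∈ D.cent, ∃ v ∈ D.V, ∃ a : ℂ, x = c + ⁅D.F, v⁆ + a • D.h := by
  have hv2 : ⁅D.E, x⁆ ∈ D.gr 2 := lie_mem_eig D.E_mem hx (by norm_num)
  have hc : x - (1 / 2 : ℂ) • ⁅D.F, ⁅D.E, x⁆⁆ ∈ D.cent := by
    refine hD.mem_cent_of_lie_E (sub_mem hx (Submodule.smul_mem _ _
      (lie_F_mem hv2))) ?_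
    rw [sub_lie, smul_lie, hD.lie_lie_F_E hv2, ← lie_skew x]
    module
  obtain ⟨v, hv, a, ha⟩ := hD.exists_of_mem_gr_two' hv2
  refine ⟨_, hc, (1 / 2 : ℂ) • v, Submodule.smul_mem _ _ hv, -(1 / 2 * a), ?_⟩
  rw [ha, lie_add, lie_smul, lie_smul, D.lie_F_E]
  module

end IsSpecial

namespace Decomposition

variable {S : Type*} [AddCommGroup S] [Module ℂ S] (P : Decomposition D S)

/-- Degree by degree: degree `2` is `V` plus `E`, degree `0` is treated by `exists_of_mem_gr_zero`,
and the negative degrees are reached from the positive ones by `F`. -/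
lemma total_surjective : Function.Surjective P.total := by
  have hD := P.special
  rw [← LinearMap.range_eq_top, eq_top_iff]
  rintro x -
  have hAd (A : so 13) : (P.ψ A : L) ∈ LinearMap.range P.total :=
    ⟨(1 ⊗ₜ A, 0, 0, 0), by simp [total, compAd_tmul]⟩
  have hSpin (u : Fin 2 → ℂ) (s : S) : u 0 • (P.e s : L) + u 1 • ⁅D.F, (P.e s : L)⁆ ∈
      LinearMap.range P.total :=
    ⟨(0, u ⊗ₜ s, 0, 0), by simp [total, compSpin_tmul]⟩
  have hSl (X : sl2) : P.φ X ∈ LinearMap.range P.total :=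
    ⟨(0, 0, X ⊗ₜ 1, 0), by simp [total, compSl_tmul]⟩
  have hVec (X : sl2) (m : Fin 13 → ℂ) : P.compVec (X ⊗ₜ m) ∈ LinearMap.range P.total :=
    ⟨(0, 0, 0, X ⊗ₜ m), by simp [total]⟩
  have hE : D.E ∈ LinearMap.range P.total := P.φ_slE ▸ hSl slE
  have hF : D.F ∈ LinearMap.range P.total := P.φ_slF ▸ hSl slF
  have hh : D.h ∈ LinearMap.range P.total := by
    have := hSl ⁅slE, slF⁆
    rwa [LieHom.map_lie, P.φ_slE, P.φ_slF, D.lie_E_F] at this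
  have hv {v : L} (hv : v ∈ D.V) : v ∈ LinearMap.range P.total := by
    obtain ⟨m, rfl⟩ := P.vec_surj hv
    have := hVec slE m
    rw [compVec_tmul] at this
    simpa [slEntry_apply, coe_slE] using this
  have hFv {v : L} (hv : v ∈ D.V) : ⁅D.F, v⁆ ∈ LinearMap.range P.total := by
    obtain ⟨m, rfl⟩ := P.vec_surj hv
    have h : ⁅D.F, P.vec m⁆ = -P.compVec (slH ⊗ₜ m) := by
      simp [-lie_skew, compVec_tmul, slEntry_apply, coe_slH]
    rw [h]
    exact neg_mem (hVec slH m)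
  have hFFv {v : L} (hv : v ∈ D.V) : ⁅D.F, ⁅D.F, v⁆⁆ ∈ LinearMap.range P.total := by
    obtain ⟨m, rfl⟩ := P.vec_surj hv
    have h : ⁅D.F, ⁅D.F, P.vec m⁆⁆ = (-2 : ℂ) • P.compVec (slF ⊗ₜ m) := by
      simp [-lie_skew, compVec_tmul, slEntry_apply, coe_slF, smul_smul]
    rw [h]
    exact Submodule.smul_mem _ _ (hVec slF m)
  have h1 {s : L} (hs : s ∈ D.gr 1) : s ∈ LinearMap.range P.total := by
    have := hSpin (Pi.single 0 1) (P.e.symm ⟨s, hs⟩)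
    simpa using this
  have k1 {s : L} (hs : s ∈ D.gr 1) : ⁅D.F, s⁆ ∈ LinearMap.range P.total := by
    have := hSpin (Pi.single 1 1) (P.e.symm ⟨s, hs⟩)
    simpa using this
  obtain ⟨x₂, hx₂, x₁, hx₁, x₀, hx₀, y₁, hy₁, y₂, hy₂, rfl⟩ := hD.exists_decomp x
  refine add_mem (add_mem (add_mem (add_mem ?_ (h1 hx₁)) ?_) ?_) ?_
  · obtain ⟨v, hv', a, rfl⟩ := hD.exists_of_mem_gr_two' hx₂
    exact add_mem (hv hv') (Submodule.smul_mem _ _ hE)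
  · obtain ⟨c, hc, v, hv', a, rfl⟩ := hD.exists_of_mem_gr_zero hx₀
    refine add_mem (add_mem ?_ (hFv hv')) (Submodule.smul_mem _ _ hh)
    obtain ⟨A, hA⟩ := P.ψ.surjective ⟨c, hc⟩
    have := hAd A
    rwa [show P.ψ A = ⟨c, hc⟩ from hA] at this
  · rw [← hD.lie_F_lie_E_gr_neg_one hy₁]
    exact k1 (lie_mem_eig D.E_mem hy₁ (by norm_num))
  · have h2 : ⁅D.E, ⁅D.E, y₂⁆⁆ ∈ D.gr 2 := lie_mem_eig (t := 0) D.E_mem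
      (lie_mem_eig D.E_mem hy₂ (by norm_num)) (by norm_num)
    have h3 : y₂ = (1 / 4 : ℂ) • ⁅D.F, ⁅D.F, ⁅D.E, ⁅D.E, y₂⁆⁆⁆⁆ := by
      rw [hD.lie_lie_F_lie_lie_E hy₂, smul_smul]
      norm_num
    obtain ⟨v, hv', a, hva⟩ := hD.exists_of_mem_gr_two' h2
    rw [h3, hva]
    refine Submodule.smul_mem _ _ ?_
    rw [lie_add, lie_add, lie_smul, lie_smul, D.lie_F_E, lie_neg, lie_skew,
      mem_eig.1 D.F_mem]
    exact add_mem (hFFv hv') (Submodule.smul_mem _ _ (Submodule.smul_mem _ _ hF))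

lemma exists_eq_single_tmul (t : (Fin 2 → ℂ) ⊗[ℂ] S) :
    ∃ s s', t = Pi.single 0 1 ⊗ₜ s + Pi.single 1 1 ⊗ₜ s' := by
  induction t using TensorProduct.induction_on with
  | zero => exact ⟨0, 0, by simp⟩
  | add x y hx hy =>
    obtain ⟨s, s', rfl⟩ := hx
    obtain ⟨r, r', rfl⟩ := hy
    exact ⟨s + r, s' + r', by simp only [TensorProduct.tmul_add]; abel⟩
  | tmul u s =>
    refine ⟨u 0 • s, u 1 • s, ?_⟩
    rw [← TensorProduct.smul_tmul, ← TensorProduct.smul_tmul, ← TensorProduct.add_tmul]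
    congr 1
    ext i
    fin_cases i <;> simp

lemma exists_eq_sl_tmul {M : Type*} [AddCommGroup M] [Module ℂ M] (t : sl2 ⊗[ℂ] M) :
    ∃ m m' m'', t = slE ⊗ₜ m + slF ⊗ₜ m' + slH ⊗ₜ m'' := by
  induction t using TensorProduct.induction_on with
  | zero => exact ⟨0, 0, 0, by simp⟩
  | add x y hx hy =>
    obtain ⟨m, m', m'', rfl⟩ := hx
    obtain ⟨r, r', r'', rfl⟩ := hy
    exact ⟨m + r, m' + r', m'' + r'', by simp only [TensorProduct.tmul_add]; abel⟩
  | tmul X m =>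
    refine ⟨(X : Matrix (Fin 2) (Fin 2) ℂ) 0 1 • m, (X : Matrix (Fin 2) (Fin 2) ℂ) 1 0 • m,
      (X : Matrix (Fin 2) (Fin 2) ℂ) 0 0 • m, ?_⟩
    rw [← TensorProduct.smul_tmul, ← TensorProduct.smul_tmul, ← TensorProduct.smul_tmul,
      ← TensorProduct.add_tmul, ← TensorProduct.add_tmul, ← sl2_eq X]

/-- After separation by degree, `E` is applied once in degrees `0` and `-1` and twice in degree
`-2`. What remains in degree `2` splits along `V` and `E` by pairing with `F`. -/
lemma total_injective : Function.Injective P.total := by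
  have hD := P.special
  rw [injective_iff_map_eq_zero]
  rintro ⟨t₀, t₁, t₂, t₃⟩ ht
  obtain ⟨A, rfl⟩ : ∃ A, t₀ = 1 ⊗ₜ[ℂ] A :=
    ⟨TensorProduct.lid ℂ _ t₀, by rw [← TensorProduct.lid_symm_apply,
      LinearEquiv.symm_apply_apply]⟩
  obtain ⟨s, s', rfl⟩ := exists_eq_single_tmul t₁
  obtain ⟨a, a', a'', rfl⟩ := exists_eq_sl_tmul t₂
  obtain ⟨m, m', m'', rfl⟩ := exists_eq_sl_tmul t₃
  have hV (m : Fin 13 → ℂ) := D.V_le (P.vec_mem m)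
  have hF (m : Fin 13 → ℂ) : ⁅D.F, P.vec m⁆ ∈ D.gr 0 := IsSpecial.lie_F_mem (hV m)
  have hFF (m : Fin 13 → ℂ) : ⁅D.F, ⁅D.F, P.vec m⁆⁆ ∈ D.gr (-2) :=
    lie_mem_eig D.F_mem (hF m) (by norm_num)
  have hh : D.h ∈ D.gr 0 := by rw [mem_eig, lie_self, zero_smul]
  have key : (P.vec m + a • D.E) + P.e s + ((P.ψ A : L) + (-⁅D.F, P.vec m''⁆ + a'' • D.h)) +
      ⁅D.F, (P.e s' : L)⁆ + (a' • D.F - (1 / 2 : ℂ) • ⁅D.F, ⁅D.F, P.vec m'⁆⁆) = 0 := by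
    rw [← ht]
    simp only [total, LinearMap.coprod_apply, map_add, compAd_tmul, compSpin_tmul, compSl_tmul,
      compVec_tmul, φ_apply, slEntry_apply, coe_slE, coe_slF, coe_slH]
    simp
    module
  obtain ⟨k₂, k₁, k₀, l₁, l₂⟩ := IsSpecial.eq_zero_of_sum_eq_zero
    (add_mem (hV m) (Submodule.smul_mem _ a D.E_mem)) (P.e s).2
    (add_mem (D.cent_le (P.ψ A).2) (add_mem (neg_mem (hF m'')) (Submodule.smul_mem _ a'' hh)))
    (lie_mem_eig (r := -1) D.F_mem (P.e s').2 (by norm_num))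
    (sub_mem (Submodule.smul_mem _ a' D.F_mem) (Submodule.smul_mem _ _ (hFF m'))) key
  have split {m : Fin 13 → ℂ} {a : ℂ} (h : P.vec m + a • D.E = 0) : m = 0 ∧ a = 0 := by
    have h1 := congrArg (fun x => killingForm ℂ L x D.F) h
    simp only [map_add, map_smul, LinearMap.add_apply, LinearMap.smul_apply,
      hD.killing_V_F (P.vec_mem m), map_zero, LinearMap.zero_apply, zero_add, smul_eq_mul,
      mul_eq_zero, hD.killing_E_F_ne, or_false] at h1
    rw [h1, zero_smul, add_zero] at h
    exact ⟨P.vec_inj h, h1⟩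
  have e0 : (P.e s : D.gr 1) = 0 := Subtype.ext k₁
  have e1 : (P.e s' : D.gr 1) = 0 := by
    refine Subtype.ext ?_
    rw [← hD.lie_E_lie_F_gr_one (P.e s').2, l₁, lie_zero]
    rfl
  rw [LinearEquiv.map_eq_zero_iff] at e0 e1
  obtain ⟨rfl, rfl⟩ := split k₂
  obtain ⟨rfl, rfl⟩ : m'' = 0 ∧ a'' = 0 := by
    have h1 := congrArg (fun x => ⁅D.E, x⁆) k₀
    simp only [lie_add, lie_smul, lie_neg, hD.lie_E_lie_F (hV m''), lie_zero] at h1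
    rw [← lie_skew, (P.ψ A).2.1, ← lie_skew D.E D.h, mem_eig.1 D.E_mem] at h1
    refine split ?_
    linear_combination (norm := module) (-1 / 2 : ℂ) • h1
  obtain ⟨rfl, rfl⟩ : m' = 0 ∧ a' = 0 := by
    have h1 := congrArg (fun x => ⁅D.E, ⁅D.E, x⁆⁆) l₂
    have h2 : ⁅D.E, ⁅D.F, ⁅D.F, P.vec m'⁆⁆⁆ = (2 : ℂ) • ⁅D.F, P.vec m'⁆ := by
      rw [leibniz_lie D.E, D.lie_E_F, hD.lie_E_lie_F (hV m'), lie_smul, mem_eig.1 (hF m'),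
        zero_smul, zero_add]
    simp only [lie_sub, lie_smul, h2, hD.lie_E_lie_F (hV m'), D.lie_E_F, lie_zero] at h1
    rw [← lie_skew D.E D.h, mem_eig.1 D.E_mem] at h1
    refine split ?_
    linear_combination (norm := module) (-1 / 2 : ℂ) • h1
  have hA : P.ψ A = 0 := Subtype.ext (by simpa using k₀)
  have hA0 : A = 0 :=
    P.ψ.injective (hA.trans (map_zero (P.ψ : so 13 →ₗ⁅ℂ⁆ D.cent)).symm)
  simp [e0, e1, hA0]

/-- The decomposition of `L` under the diagonal `𝔰𝔩₂` and its centralizer. -/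
def equiv : L ≃ₗ[ℂ]
    (ℂ ⊗[ℂ] so 13) × ((Fin 2 → ℂ) ⊗[ℂ] S) × (sl2 ⊗[ℂ] ℂ) × (sl2 ⊗[ℂ] (Fin 13 → ℂ)) :=
  (LinearEquiv.ofBijective P.total ⟨P.total_injective, P.total_surjective⟩).symm

lemma equiv_lie (X : sl2) (A : so 13) (v : L) : P.equiv ⁅P.φ X + (P.ψ A : L), v⁆ =
    directSumRep (boxTensorRep (trivialRep sl2) (adjointRep (so 13)))
      (directSumRep (boxTensorRep (naturalRep sl2) P.spin)
        (directSumRep (boxTensorRep (adjointRep sl2) (trivialRep (so 13)))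
          (boxTensorRep (adjointRep sl2) (naturalRep (so 13))))) (X, A) (P.equiv v) := by
  apply P.equiv.symm.injective
  rw [LinearEquiv.symm_apply_apply]
  refine Eq.trans ?_ (P.total_equivariant X A (P.equiv v)).symm
  rw [show P.total (P.equiv v) = v from P.equiv.symm_apply_apply v]

/-- The Clifford action of `ℂ¹³` on `S`. -/
def cliffordMap : (Fin 13 → ℂ) →ₗ[ℂ] Module.End ℂ S :=
  (P.e.symm.conj : Module.End ℂ (D.gr 1) →ₗ[ℂ] Module.End ℂ S) ∘ₗ D.cl ∘ₗ
    P.vec.codRestrict (D.gr 2) fun m => D.V_le (P.vec_mem m)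

lemma e_cliffordMap (m : Fin 13 → ℂ) (s : S) :
    P.e (P.cliffordMap m s) = D.cl ⟨P.vec m, D.V_le (P.vec_mem m)⟩ (P.e s) := by
  simp [cliffordMap, LinearEquiv.conj_apply, LinearMap.codRestrict]

lemma b_vec (m : Fin 13 → ℂ) : D.b (P.vec m) (P.vec m) = stdQuadraticForm 13 m := by
  simp only [vec_apply, map_sum, map_smul, LinearMap.sum_apply, LinearMap.smul_apply,
    P.family.orthonormal _ _, smul_eq_mul, mul_ite, mul_one, mul_zero, Finset.sum_ite_eq',
    Finset.mem_univ, if_true, stdQuadraticForm, QuadraticMap.weightedSumSquares_apply, one_mul]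

/-- The Clifford module structure on `S`. -/
def clifford : CliffordAlgebra (stdQuadraticForm 13) →ₐ[ℂ] Module.End ℂ S :=
  CliffordAlgebra.lift _ ⟨P.cliffordMap, fun m => by
    ext s
    apply P.e.injective
    rw [Module.End.mul_apply, e_cliffordMap, e_cliffordMap, ← Module.End.mul_apply,
      P.special.cl_mul_cl _ (P.vec_mem m), Module.algebraMap_end_apply, b_vec,
      Module.algebraMap_end_apply, map_smul]⟩

lemma clifford_ι (m : Fin 13 → ℂ) :
    P.clifford (CliffordAlgebra.ι _ m) = P.cliffordMap m := by
  rw [clifford, CliffordAlgebra.lift_ι_apply]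

lemma vec_single (i : Fin 13) : P.vec (Pi.single i 1) = P.family.w i := by
  simp [vec_apply, Pi.single_apply]

/-- The factors `1/2` of `soMap` and `1/4` of the rotations give `1/8` times a sum of commutators.
Skew-symmetry of `A` makes both halves of each commutator contribute equally, hence `1/4`. -/
lemma spin_eq (A : so 13) : P.spin A = (1 / 4 : ℂ) • ∑ i, ∑ j,
    (A : Matrix (Fin 13) (Fin 13) ℂ) i j • P.clifford
      (CliffordAlgebra.ι (stdQuadraticForm 13) (Pi.single i 1) *
        CliffordAlgebra.ι (stdQuadraticForm 13) (Pi.single j 1)) := by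
  let c (i : Fin 13) : Module.End ℂ S := P.cliffordMap (Pi.single i 1)
  have hX (i j : Fin 13) (s : S) : ⁅D.X (P.family.w i) (P.family.w j), (P.e s : L)⁆ =
      P.e ((c i * c j - c j * c i) s) := by
    have := P.special.lie_X_gr_one ⟨P.vec (Pi.single i 1), D.V_le (P.vec_mem _)⟩
      ⟨P.vec (Pi.single j 1), D.V_le (P.vec_mem _)⟩ (P.e s)
    simp only [vec_single] at this
    rw [this]
    simp only [c, LinearMap.sub_apply, Module.End.mul_apply, map_sub, e_cliffordMap, vec_single]
  have h1 (s : S) : P.spin A s = ((1 / 8 : ℂ) • ∑ i, ∑ j,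
      (A : Matrix (Fin 13) (Fin 13) ℂ) i j • (c i * c j - c j * c i)) s := by
    apply P.e.injective
    refine Subtype.ext ?_
    rw [e_spin, P.ψ_apply]
    simp only [soMap, LinearMap.coe_mk, AddHom.coe_mk, smul_lie, sum_lie, hX, LinearMap.smul_apply,
      LinearMap.sum_apply, map_smul, map_sum, Submodule.coe_smul, Submodule.coe_sum,
      Finset.smul_sum, smul_smul]
    refine Finset.sum_congr rfl fun i _ => Finset.sum_congr rfl fun j _ => ?_
    congr 1
    ring
  have h2 : ∑ i, ∑ j, (A : Matrix (Fin 13) (Fin 13) ℂ) i j • (c j * c i) =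
      -∑ i, ∑ j, (A : Matrix (Fin 13) (Fin 13) ℂ) i j • (c i * c j) := by
    rw [Finset.sum_comm, ← Finset.sum_neg_distrib]
    refine Finset.sum_congr rfl fun i _ => ?_
    rw [← Finset.sum_neg_distrib]
    exact Finset.sum_congr rfl fun j _ => by rw [so_apply_swap A j i, neg_smul]
  refine (LinearMap.ext h1).trans ?_
  simp only [smul_sub, Finset.sum_sub_distrib, h2, map_mul, clifford_ι]
  module

/-- The spin representation, when the degree one part is irreducible under degree zero. -/
lemma isSpinRep [FiniteDimensional ℂ S] [Nontrivial S]
    (hirr : ∀ W : Submodule ℂ L, W ≤ D.gr 1 → (∀ x ∈ D.gr 0, ∀ w ∈ W, ⁅x, w⁆ ∈ W) →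
      W = ⊥ ∨ W = D.gr 1) : IsSpinRep P.spin := by
  refine ⟨inferInstance, inferInstance, P.clifford, fun W hW => ?_, P.spin_eq⟩
  let f : S →ₗ[ℂ] L := (D.gr 1).subtype ∘ₗ P.e
  have hf : Function.Injective f := (Submodule.subtype_injective _).comp P.e.injective
  have hspin (A : so 13) (w : S) (hw : w ∈ W) : P.spin A w ∈ W := by
    rw [P.spin_eq, LinearMap.smul_apply, LinearMap.sum_apply]
    refine W.smul_mem _ (sum_mem fun i _ => ?_)
    rw [LinearMap.sum_apply]
    exact sum_mem fun j _ => W.smul_mem _ (hW _ _ hw)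
  -- A Clifford submodule is stable under all of degree `0`: the centralizer acts by quadratic
  -- Clifford elements, `⁅F, v⁆` by minus the operator of `v`, and `h` by a scalar.
  have := hirr (W.map f) (by rintro _ ⟨w, -, rfl⟩; exact (P.e w).2) (by
    rintro x hx _ ⟨w, hw, rfl⟩
    obtain ⟨c, hc, v, hv, a, rfl⟩ := P.special.exists_of_mem_gr_zero hx
    obtain ⟨A, hA⟩ := P.ψ.surjective ⟨c, hc⟩
    obtain ⟨m, rfl⟩ := P.vec_surj hv
    have h1 : ⁅c, f w⁆ = f (P.spin A w) := by
      refine Eq.trans ?_ (P.e_spin A w).symm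
      rw [show P.ψ A = ⟨c, hc⟩ from hA]
      rfl
    have h2 : ⁅⁅D.F, P.vec m⁆, f w⁆ = -f (P.cliffordMap m w) := by
      refine (P.special.lie_lie_F_gr_one (D.V_le hv) (P.e w).2).trans ?_
      exact congrArg (fun y : D.gr 1 => -(y : L)) (P.e_cliffordMap m w).symm
    have h3 : ⁅D.h, f w⁆ = (1 : ℂ) • f w := (P.e w).2
    rw [add_lie, add_lie, smul_lie, h1, h2, h3]
    refine add_mem (add_mem ⟨_, hspin A w hw, rfl⟩ (neg_mem ⟨_, ?_, rfl⟩))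
      (Submodule.smul_mem _ _ (Submodule.smul_mem _ _ ⟨_, hw, rfl⟩))
    rw [← clifford_ι]
    exact hW _ _ hw)
  refine this.imp (fun h => ?_) fun h => ?_
  · rw [eq_bot_iff]
    intro w hw
    have h0 : f w ∈ W.map f := ⟨w, hw, rfl⟩
    rw [h, Submodule.mem_bot] at h0
    exact hf (h0.trans (map_zero f).symm)
  · rw [eq_top_iff]
    intro s _
    have : f s ∈ W.map f := h ▸ (P.e s).2
    obtain ⟨w, hw, hws⟩ := this
    exact hf hws ▸ hw

end Decomposition
end Sl2Pair

/-! ### The root lattice of `E₈` -/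

/-- The pairing of `∑ cⱼ αⱼ` with the simple coroot `αᵢ^∨`. -/
def pairing (c : Fin 8 → ℤ) (i : Fin 8) : ℤ := ∑ j, c j * CartanMatrix.E₈ j i

/-- The invariant form on the root lattice. -/
def form (c d : Fin 8 → ℤ) : ℤ := ∑ i, d i * pairing c i

lemma pairing_add (c d : Fin 8 → ℤ) (i : Fin 8) :
    pairing (c + d) i = pairing c i + pairing d i := by
  simp [pairing, add_mul, Finset.sum_add_distrib]

lemma pairing_neg (c : Fin 8 → ℤ) (i : Fin 8) : pairing (-c) i = -pairing c i := by
  simp [pairing]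

lemma pairing_sub (c d : Fin 8 → ℤ) (i : Fin 8) :
    pairing (c - d) i = pairing c i - pairing d i := by
  rw [sub_eq_add_neg, pairing_add, pairing_neg, sub_eq_add_neg]

@[simp] lemma pairing_zero (i : Fin 8) : pairing 0 i = 0 := by
  simp [pairing]

lemma pairing_single (i j : Fin 8) : pairing (Pi.single i 1) j = CartanMatrix.E₈ i j := by
  simp [pairing, Pi.single_apply]

lemma form_add_left (c c' d : Fin 8 → ℤ) : form (c + c') d = form c d + form c' d := by
  simp [form, pairing_add, mul_add, Finset.sum_add_distrib]

lemma form_neg_left (c d : Fin 8 → ℤ) : form (-c) d = -form c d := by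
  simp [form, pairing_neg]

lemma form_sub_left (c c' d : Fin 8 → ℤ) : form (c - c') d = form c d - form c' d := by
  rw [sub_eq_add_neg, form_add_left, form_neg_left, sub_eq_add_neg]

lemma form_symm (c d : Fin 8 → ℤ) : form c d = form d c := by
  have hsymm : ∀ i j, CartanMatrix.E₈ i j = CartanMatrix.E₈ j i := fun i j =>
    CartanMatrix.E₈_isSymm.apply j i
  simp only [form, pairing, Finset.mul_sum]
  rw [Finset.sum_comm]
  refine Finset.sum_congr rfl fun i _ => Finset.sum_congr rfl fun j _ => ?_
  rw [hsymm i j]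
  ring

lemma form_add_right (c d d' : Fin 8 → ℤ) : form c (d + d') = form c d + form c d' := by
  rw [form_symm, form_add_left, form_symm d, form_symm d']

lemma form_neg_right (c d : Fin 8 → ℤ) : form c (-d) = -form c d := by
  rw [form_symm, form_neg_left, form_symm]

lemma form_sub_right (c d d' : Fin 8 → ℤ) : form c (d - d') = form c d - form c d' := by
  rw [form_symm, form_sub_left, form_symm d, form_symm d']

@[simp] lemma form_zero_left (d : Fin 8 → ℤ) : form 0 d = 0 := by simp [form]

lemma form_single_right (c : Fin 8 → ℤ) (i : Fin 8) : form c (Pi.single i 1) = pairing c i := by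
  simp [form, Pi.single_apply]

lemma pairing_explicit (c : Fin 8 → ℤ) :
    pairing c = ![2 * c 0 - c 2, 2 * c 1 - c 3, 2 * c 2 - c 0 - c 3,
      2 * c 3 - c 1 - c 2 - c 4, 2 * c 4 - c 3 - c 5, 2 * c 5 - c 4 - c 6,
      2 * c 6 - c 5 - c 7, 2 * c 7 - c 6] := by
  funext i
  simp only [pairing, Fin.sum_univ_eight]
  fin_cases i <;> simp [CartanMatrix.E₈] <;> ring

/-- Twice the coordinates, in an orthogonal basis, of the component of a root lattice vector in a
`D₇` sublattice. -/
def dcoord (c : Fin 8 → ℤ) : Fin 7 → ℤ :=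
  ![2 * c 7 - c 0, c 0 - 2 * c 6 + 2 * c 7, c 0 + 2 * c 6 - 2 * c 5, c 0 + 2 * c 5 - 2 * c 4,
    c 0 + 2 * c 4 - 2 * c 3, c 0 + 2 * c 3 - 2 * c 2 - 2 * c 1, 2 * c 2 - 2 * c 1 - c 0]

/-- Splits the lattice rationally into a line and a `D₇` part. Positive definiteness, the bound on
the level and the list of roots of level `2` all come from this sum of squares. -/
lemma four_mul_form_eq (c d : Fin 8 → ℤ) :
    4 * form c d = c 0 * d 0 + ∑ i, dcoord c i * dcoord d i := by
  simp only [form, pairing_explicit, dcoord, Fin.sum_univ_eight, Fin.sum_univ_seven]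
  simp
  ring

lemma form_self_nonneg (c : Fin 8 → ℤ) : 0 ≤ form c c := by
  have := four_mul_form_eq c c
  have h : 0 ≤ ∑ i, dcoord c i * dcoord c i := Finset.sum_nonneg fun i _ => mul_self_nonneg _
  nlinarith [mul_self_nonneg (c 0)]

lemma eq_zero_of_dcoord {c : Fin 8 → ℤ} (h0 : c 0 = 0) (h : ∀ i, dcoord c i = 0) : c = 0 := by
  have e0 := h 0
  have e1 := h 1
  have e2 := h 2
  have e3 := h 3
  have e4 := h 4
  have e5 := h 5
  have e6 := h 6
  simp [dcoord] at e0 e1 e2 e3 e4 e5 e6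
  funext i
  fin_cases i <;> simp <;> omega

lemma eq_zero_of_form_self_le {c : Fin 8 → ℤ} (h : form c c ≤ 0) : c = 0 := by
  have h4 := four_mul_form_eq c c
  have hs : ∀ i ∈ Finset.univ, 0 ≤ dcoord c i * dcoord c i := fun i _ => mul_self_nonneg _
  have h0 := Finset.sum_nonneg hs
  have h1 := mul_self_nonneg (c 0)
  refine eq_zero_of_dcoord (mul_self_eq_zero.1 (by linarith)) fun i => ?_
  have := (Finset.sum_eq_zero_iff_of_nonneg hs).1 (by linarith) i (Finset.mem_univ i)
  exact mul_self_eq_zero.1 this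

lemma form_self_even (c : Fin 8 → ℤ) : Even (form c c) := by
  refine ⟨c 0 * c 0 + c 1 * c 1 + c 2 * c 2 + c 3 * c 3 + c 4 * c 4 + c 5 * c 5 + c 6 * c 6 +
    c 7 * c 7 - c 0 * c 2 - c 1 * c 3 - c 2 * c 3 - c 3 * c 4 - c 4 * c 5 - c 5 * c 6 - c 6 * c 7,
    ?_⟩
  simp only [form, pairing_explicit, Fin.sum_univ_eight]
  simp
  ring

/-- Multiplication by the inverse of the Cartan matrix. -/
def dualCoord {R : Type*} [CommRing R] (y : Fin 8 → R) : Fin 8 → R :=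
  ![4*y 0 + 5*y 1 + 7*y 2 + 10*y 3 + 8*y 4 + 6*y 5 + 4*y 6 + 2*y 7,
      5*y 0 + 8*y 1 + 10*y 2 + 15*y 3 + 12*y 4 + 9*y 5 + 6*y 6 + 3*y 7,
      7*y 0 + 10*y 1 + 14*y 2 + 20*y 3 + 16*y 4 + 12*y 5 + 8*y 6 + 4*y 7,
      10*y 0 + 15*y 1 + 20*y 2 + 30*y 3 + 24*y 4 + 18*y 5 + 12*y 6 + 6*y 7,
      8*y 0 + 12*y 1 + 16*y 2 + 24*y 3 + 20*y 4 + 15*y 5 + 10*y 6 + 5*y 7,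
      6*y 0 + 9*y 1 + 12*y 2 + 18*y 3 + 15*y 4 + 12*y 5 + 8*y 6 + 4*y 7,
      4*y 0 + 6*y 1 + 8*y 2 + 12*y 3 + 10*y 4 + 8*y 5 + 6*y 6 + 3*y 7,
      2*y 0 + 3*y 1 + 4*y 2 + 6*y 3 + 5*y 4 + 4*y 5 + 3*y 6 + 2*y 7]

/-- The inverse of the Cartan matrix has integer entries, that is, the lattice is unimodular. Over
`ℤ`, any multiple dividing all the pairings of `x` therefore divides `x`. -/
lemma eq_dualCoord {R : Type*} [CommRing R] {x y : Fin 8 → R}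
    (h : ∀ i, ∑ j, x j * (CartanMatrix.E₈ j i : R) = y i) : x = dualCoord y := by
  funext i
  simp only [dualCoord, ← h, Fin.sum_univ_eight]
  fin_cases i <;> simp [CartanMatrix.E₈] <;> ring

lemma dualCoord_smul {R : Type*} [CommRing R] (t : R) (y : Fin 8 → R) (i : Fin 8) :
    dualCoord (fun j => t * y j) i = t * dualCoord y i := by
  simp only [dualCoord]
  fin_cases i <;> simp <;> ring

/-- The highest root of `E₈`. -/
def thetaEight : Fin 8 → ℤ := ![2, 3, 4, 6, 5, 4, 3, 2]

/-- The highest root of the subsystem `E₇`. -/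
def thetaSeven : Fin 8 → ℤ := ![2, 2, 3, 4, 3, 2, 1, 0]

/-- Six of the roots of level `2` orthogonal to `θ - θ'`. -/
def sixRoots : Fin 6 → Fin 8 → ℤ :=
  ![![2, 2, 3, 4, 3, 2, 1, 1], ![2, 2, 3, 4, 3, 2, 2, 1], ![2, 2, 3, 4, 3, 3, 2, 1],
    ![2, 2, 3, 4, 4, 3, 2, 1], ![2, 2, 3, 5, 4, 3, 2, 1], ![2, 2, 4, 5, 4, 3, 2, 1]]

/-- In other words `θ` is the fundamental weight of node `8`. -/
lemma form_thetaEight (c : Fin 8 → ℤ) : form c thetaEight = c 7 := by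
  simp only [form, pairing_explicit, thetaEight, Fin.sum_univ_eight]
  simp
  ring

/-- Thus `θ + θ'` is the fundamental weight of node `1`. -/
lemma form_thetaSeven (c : Fin 8 → ℤ) : form c thetaSeven = c 0 - c 7 := by
  simp only [form, pairing_explicit, thetaSeven, Fin.sum_univ_eight]
  simp
  ring

lemma form_sixRoots (c : Fin 8 → ℤ) (k : Fin 6) :
    2 * form c (sixRoots k) = c 0 + dcoord c k.succ := by
  simp only [form, pairing_explicit, Fin.sum_univ_eight]
  fin_cases k <;> simp [sixRoots, dcoord, Fin.succ] <;> ring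

lemma exists_of_sum_mul_self_eq_one {ι : Type*} [Fintype ι] [DecidableEq ι] {z : ι → ℤ}
    (h : ∑ i, z i * z i = 1) :
    ∃ k, (z k = 1 ∨ z k = -1) ∧ ∀ j, j ≠ k → z j = 0 := by
  obtain ⟨k, hk⟩ : ∃ k, z k ≠ 0 := by
    by_contra hcon
    push Not at hcon
    simp [hcon] at h
  rw [← Finset.add_sum_erase _ _ (Finset.mem_univ k)] at h
  have hs : ∀ i ∈ Finset.univ.erase k, 0 ≤ z i * z i := fun i _ => mul_self_nonneg _
  have h0 := Finset.sum_nonneg hs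
  have hk1 : 1 ≤ z k * z k := by
    have := mul_self_pos.2 hk
    omega
  refine ⟨k, mul_self_eq_one_iff.1 (by linarith), fun j hj => ?_⟩
  have := (Finset.sum_eq_zero_iff_of_nonneg hs).1 (by linarith) j
    (Finset.mem_erase.2 ⟨hj, Finset.mem_univ j⟩)
  exact mul_self_eq_zero.1 this

lemma abs_apply_zero_le {c : Fin 8 → ℤ} (h : form c c = 2) : -2 ≤ c 0 ∧ c 0 ≤ 2 := by
  have h4 := four_mul_form_eq c c
  have hs := Finset.sum_nonneg (s := Finset.univ) fun i _ => mul_self_nonneg (dcoord c i)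
  constructor <;> nlinarith

/-- The squares of the `D₇` coordinates sum to `8 - 4 = 4`, and all coordinates are even since `c 0`
is. So exactly one is `±2`: the first belongs to `θ` and `θ'`, the other six to `sixRoots` and their
reflections. -/
lemma eq_of_level_two {c : Fin 8 → ℤ} (h : form c c = 2) (h0 : c 0 = 2) :
    c = thetaEight ∨ c = thetaSeven ∨ ∃ k, c = sixRoots k ∨
      c = thetaEight + thetaSeven - sixRoots k := by
  have h4 := four_mul_form_eq c c
  rw [h, h0] at h4
  obtain ⟨z, hz⟩ : ∃ z : Fin 7 → ℤ, ∀ i, dcoord c i = 2 * z i := by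
    refine ⟨fun i => dcoord c i / 2, fun i => ?_⟩
    fin_cases i <;> simp [dcoord] <;> omega
  have h1 : ∑ i, z i * z i = 1 := by
    have : ∑ i, dcoord c i * dcoord c i = 4 * ∑ i, z i * z i := by
      rw [Finset.mul_sum]
      exact Finset.sum_congr rfl fun i _ => by rw [hz]; ring
    omega
  obtain ⟨k, hk, hj⟩ := exists_of_sum_mul_self_eq_one h1
  have e : ∀ i, dcoord c i = if i = k then 2 * z k else 0 := fun i => by
    by_cases hik : i = k
    · simp [hik, hz]
    · simp [hik, hz, hj i hik]
  have e0 := e 0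
  have e1 := e 1
  have e2 := e 2
  have e3 := e 3
  have e4 := e 4
  have e5 := e 5
  have e6 := e 6
  simp only [dcoord] at e0 e1 e2 e3 e4 e5 e6
  simp at e0 e1 e2 e3 e4 e5 e6
  induction k using Fin.cases with
  | zero =>
    simp at e0 e1 e2 e3 e4 e5 e6
    rcases hk with hk | hk
    · left
      funext i
      fin_cases i <;> simp [thetaEight] <;> omega
    · right; left
      funext i
      fin_cases i <;> simp [thetaSeven] <;> omega
  | succ k =>
    right; right
    refine ⟨k, hk.imp (fun hk => ?_) fun hk => ?_⟩ <;> rw [hk] at e0 e1 e2 e3 e4 e5 e6 <;>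
    · funext i
      fin_cases k <;> simp [Fin.succ, Fin.ext_iff] at e0 e1 e2 e3 e4 e5 e6 <;>
      fin_cases i <;> simp [thetaEight, thetaSeven, sixRoots] <;> omega

/-- Among the positive vectors of norm `2`, all but the simple roots can be lowered. -/
lemma exists_pairing_eq_one {c : Fin 8 → ℤ} (hc : 0 ≤ c) (h : form c c = 2)
    (hs : ∀ i, c ≠ Pi.single i 1) : ∃ i, 0 < c i ∧ pairing c i = 1 := by
  obtain ⟨i, -, hi⟩ : ∃ i ∈ Finset.univ, 0 < c i * pairing c i := by
    refine Finset.exists_lt_of_sum_lt (f := fun _ => (0 : ℤ)) ?_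
    change _ < form c c
    simp [h]
  have hci : 0 < c i := (hc i).lt_of_ne fun h0 => by
    rw [Pi.zero_apply] at h0
    simp [← h0] at hi
  have hpi : 0 < pairing c i := pos_of_mul_pos_right hi hci.le
  refine ⟨i, hci, ?_⟩
  have hf : form (c - Pi.single i 1) (c - Pi.single i 1) = 4 - 2 * pairing c i := by
    rw [form_sub_right, form_sub_left, form_single_right, pairing_sub, pairing_single,
      form_symm (Pi.single i 1), form_single_right, h]
    have : CartanMatrix.E₈ i i = 2 := by fin_cases i <;> rfl
    omega
  by_contra hne
  exact hs i (sub_eq_zero.1 (eq_zero_of_form_self_le (by omega)))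

/-! ### Root spaces in terms of coordinates -/

section RootSpaces

variable {L : Type*} [LieRing L] [LieAlgebra ℂ L] {H : LieSubalgebra ℂ L}
  (b : LieAlgebra.Basis (Fin 8) H)

/-- The weight space of the element `∑ cᵢ αᵢ` of the root lattice. -/
def wt (c : Fin 8 → ℤ) : Submodule ℂ L := ⨅ i, eig (b.h i) (pairing c i)

variable {b} {c d : Fin 8 → ℤ} {x y : L}

lemma mem_wt : x ∈ wt b c ↔ ∀ i, ⁅b.h i, x⁆ = (pairing c i : ℂ) • x := by
  simp [wt, Submodule.mem_iInf, mem_eig]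

lemma lie_mem_wt (hx : x ∈ wt b c) (hy : y ∈ wt b d) : ⁅x, y⁆ ∈ wt b (c + d) := by
  rw [mem_wt] at *
  intro i
  exact lie_mem_eig (hx i) (hy i) (by rw [pairing_add]; push_cast; ring)

lemma lie_corootComb (hx : x ∈ wt b d) (c : Fin 8 → ℤ) :
    ⁅corootComb b c, x⁆ = (form d c : ℂ) • x := by
  rw [mem_wt] at hx
  simp only [corootComb, sum_lie, form, Int.cast_sum, Finset.sum_smul]
  refine Finset.sum_congr rfl fun i _ => ?_
  rw [← Int.cast_smul_eq_zsmul ℂ, smul_lie, hx, smul_smul, Int.cast_mul]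

lemma corootComb_add (c d : Fin 8 → ℤ) :
    corootComb b (c + d) = corootComb b c + corootComb b d := by
  simp [corootComb, add_smul, Finset.sum_add_distrib]

lemma corootComb_single (i : Fin 8) : corootComb b (Pi.single i 1) = b.h i := by
  simp [corootComb, Pi.single_apply]

lemma pairing_injective : Function.Injective pairing := fun c d h => by
  rw [← sub_eq_zero]
  refine eq_zero_of_form_self_le ?_
  simp [form, pairing_sub, h]

lemma h_mem (i : Fin 8) : b.h i ∈ H := (b.h' i).2

lemma mem_cartan_iff : x ∈ H ↔ ∃ t : Fin 8 → ℂ, x = ∑ i, t i • b.h i := by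
  rw [← LieSubalgebra.mem_toSubmodule, b.coe_cartan_eq_span, Submodule.mem_span_range_iff_exists_fun]
  exact exists_congr fun t => eq_comm

lemma corootComb_mem (c : Fin 8 → ℤ) : corootComb b c ∈ H :=
  sum_mem fun i _ => zsmul_mem (h_mem i) _

lemma mem_wt_zero_of_mem (hx : x ∈ H) : x ∈ wt b 0 := by
  rw [mem_wt]
  intro i
  have := b.isLieAbelian_cartan
  have := congrArg Subtype.val (trivial_lie_zero H H ⟨b.h i, h_mem i⟩ ⟨x, hx⟩)
  simpa using this

lemma rootComb_zero (b : LieAlgebra.Basis (Fin 8) H) : rootComb b 0 = 0 := by simp [rootComb]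

variable (hb : b.A = CartanMatrix.E₈)
include hb

lemma e_mem_wt (i : Fin 8) : b.e i ∈ wt b (Pi.single i 1) := by
  rw [mem_wt]
  intro j
  rw [b.lie_h_e, pairing_single, hb, Int.cast_smul_eq_zsmul]

lemma f_mem_wt (i : Fin 8) : b.f i ∈ wt b (-Pi.single i 1) := by
  rw [mem_wt]
  intro j
  rw [b.lie_h_f, pairing_neg, pairing_single, hb, Int.cast_smul_eq_zsmul]

lemma rootComb_apply_h' (c : Fin 8 → ℤ) (i : Fin 8) :
    rootComb b c (b.h' i) = (pairing c i : ℂ) := by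
  simp [rootComb, LinearMap.sum_apply, hb, pairing]

lemma lie_of_mem_wt (hx : x ∈ wt b c) (z : H) : ⁅(z : L), x⁆ = rootComb b c z • x := by
  obtain ⟨t, ht⟩ := (mem_cartan_iff (b := b)).1 z.2
  have hz : z = ∑ i, t i • b.h' i := by
    apply Subtype.ext
    rw [ht]
    simp [LieAlgebra.Basis.h']
  rw [mem_wt] at hx
  rw [ht, sum_lie, hz, map_sum, Finset.sum_smul]
  refine Finset.sum_congr rfl fun i _ => ?_
  rw [smul_lie, hx, map_smul, rootComb_apply_h' hb, smul_smul, smul_eq_mul]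

lemma rootComb_injective : Function.Injective (rootComb b) := fun c d h => by
  refine pairing_injective (funext fun i => ?_)
  have := rootComb_apply_h' hb c i
  rw [h, rootComb_apply_h' hb] at this
  exact_mod_cast this.symm

variable [FiniteDimensional ℂ L] [H.IsCartanSubalgebra] [LieAlgebra.IsKilling ℂ L]

lemma mem_rootSpace_iff : x ∈ LieAlgebra.rootSpace H (rootComb b c) ↔ x ∈ wt b c := by
  constructor
  · intro hx
    rw [mem_wt]
    intro i
    have := LieAlgebra.IsKilling.lie_eq_smul_of_mem_rootSpace hx (b.h' i)
    rw [rootComb_apply_h' hb] at this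
    exact this
  · intro hx
    rw [LieModule.mem_genWeightSpace]
    refine fun z => ⟨1, ?_⟩
    have := lie_of_mem_wt hb hx z
    simp [this]

lemma mem_wt_zero_iff : x ∈ wt b 0 ↔ x ∈ H := by
  refine ⟨fun hx => ?_, mem_wt_zero_of_mem⟩
  rw [← mem_rootSpace_iff hb, rootComb_zero b] at hx
  rwa [show ((0 : Module.Dual ℂ H) : H → ℂ) = 0 from rfl, LieAlgebra.rootSpace_zero_eq] at hx

/-- The weight attached to a nonzero weight space. -/
def weightOf (hx : x ∈ wt b c) (hx0 : x ≠ 0) : LieModule.Weight ℂ H L where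
  toFun := rootComb b c
  genWeightSpace_ne_bot' := fun h => hx0 <| by
    have := (mem_rootSpace_iff hb).2 hx
    rw [LieAlgebra.rootSpace, h] at this
    simpa using this

lemma weightOf_isNonZero (hx : x ∈ wt b c) (hx0 : x ≠ 0) (hc : c ≠ 0) :
    (weightOf hb hx hx0).IsNonZero := fun h => hc <| by
  refine rootComb_injective hb ?_
  rw [rootComb_zero b]
  exact DFunLike.coe_injective h.eq

lemma exists_eq_smul (hc : c ≠ 0) (hx : x ∈ wt b c) (hx0 : x ≠ 0) (hy : y ∈ wt b c) :
    ∃ t : ℂ, y = t • x := by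
  have h := LieAlgebra.IsKilling.finrank_rootSpace_eq_one (weightOf hb hx hx0)
    (weightOf_isNonZero hb hx hx0 hc)
  obtain ⟨t, ht⟩ := (finrank_eq_one_iff_of_nonzero'
    (⟨x, (mem_rootSpace_iff hb).2 hx⟩ : LieAlgebra.rootSpace H (weightOf hb hx hx0))
    (fun h => hx0 (congrArg Subtype.val h))).1 h ⟨y, (mem_rootSpace_iff hb).2 hy⟩
  exact ⟨t, (congrArg Subtype.val ht).symm⟩

omit hb in
lemma exists_eq_rootComb (b : LieAlgebra.Basis (Fin 8) H) (χ : LieModule.Weight ℂ H L) :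
    ∃ c, (0 ≤ c ∨ c ≤ 0) ∧ (χ : H → ℂ) = rootComb b c := by
  by_cases h : χ.IsZero
  · refine ⟨0, Or.inl le_rfl, ?_⟩
    rw [rootComb_zero b, h.eq]
    rfl
  · have key : ∀ ψ ∈ AddSubmonoid.closure
        ((LieAlgebra.IsKilling.rootSystem H).root '' Set.range b.baseSupp'),
        ∃ c : Fin 8 → ℤ, 0 ≤ c ∧ ψ = rootComb b c := by
      intro ψ hψ
      induction hψ using AddSubmonoid.closure_induction with
      | mem ψ hψ =>
        obtain ⟨-, ⟨i, rfl⟩, rfl⟩ := hψ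
        refine ⟨Pi.single i 1, by simp [Pi.single_nonneg], ?_⟩
        simp [rootComb, Pi.single_apply, LieAlgebra.Basis.baseSupp']
        rfl
      | zero => exact ⟨0, le_rfl, (rootComb_zero b).symm⟩
      | add ψ₁ ψ₂ _ _ h₁ h₂ =>
        obtain ⟨c₁, hc₁, rfl⟩ := h₁
        obtain ⟨c₂, hc₂, rfl⟩ := h₂
        refine ⟨c₁ + c₂, add_nonneg hc₁ hc₂, ?_⟩
        simp [rootComb, add_smul, Finset.sum_add_distrib]
    have hχ := b.root_mem_or_mem_neg ⟨χ, by simpa using h⟩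
    rcases hχ with hχ | hχ
    · obtain ⟨c, hc, h⟩ := key _ hχ
      refine ⟨c, Or.inl hc, ?_⟩
      rw [← h]
      rfl
    · obtain ⟨c, hc, h⟩ := key _ hχ
      refine ⟨-c, Or.inr (neg_nonpos.2 hc), ?_⟩
      have : rootComb b (-c) = -rootComb b c := by simp [rootComb]
      rw [this, ← h, neg_neg]
      rfl

lemma nonneg_or_nonpos (hx : x ∈ wt b c) (hx0 : x ≠ 0) : 0 ≤ c ∨ c ≤ 0 := by
  obtain ⟨d, hd, h⟩ := exists_eq_rootComb b (weightOf hb hx hx0)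
  have : c = d := rootComb_injective hb (DFunLike.coe_injective h)
  rwa [this]

/-- A subspace stable under the Cartan subalgebra is the sum of its intersections with the weight
spaces. -/
lemma le_of_forall_wt {N P : Submodule ℂ L} (hN : ∀ i, ∀ x ∈ N, ⁅b.h i, x⁆ ∈ N)
    (h : ∀ c, ∀ x ∈ N, x ∈ wt b c → x ∈ P) : N ≤ P := by
  have hN' : ∀ (z : H) (x : L), x ∈ N → ⁅(z : L), x⁆ ∈ N := fun z x hx => by
    obtain ⟨t, ht⟩ := (mem_cartan_iff (b := b)).1 z.2
    rw [ht, sum_lie]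
    exact sum_mem fun i _ => by
      rw [smul_lie]
      exact N.smul_mem _ (hN i x hx)
  let N' : LieSubmodule ℂ H L := { N with lie_mem := fun {z x} hx => hN' z x hx }
  have h1 := LieModule.eq_iSup_inf_genWeightSpace (N := N')
  have h2 : N = ⨆ χ : LieModule.Weight ℂ H L,
      (N' ⊓ LieModule.genWeightSpace L χ : LieSubmodule ℂ H L).toSubmodule := by
    have := congrArg LieSubmodule.toSubmodule h1
    rwa [LieSubmodule.iSup_toSubmodule] at this
  rw [h2]
  refine iSup_le fun χ x hx => ?_
  obtain ⟨c, -, hc⟩ := exists_eq_rootComb b χ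
  rw [hc] at hx
  have hx' : x ∈ N' ∧ x ∈ LieAlgebra.rootSpace H (rootComb b c) := hx
  exact h c x hx'.1 ((mem_rootSpace_iff hb).1 hx'.2)

@[elab_as_elim]
lemma wt_induction {p : L → Prop} (hp : ∀ c, ∀ x ∈ wt b c, p x) (hadd : ∀ x y, p x → p y → p (x + y))
    (hsmul : ∀ (t : ℂ) x, p x → p (t • x)) (x : L) : p x := by
  have h0 : p 0 := hp 0 0 (zero_mem _)
  let P : Submodule ℂ L :=
    { carrier := {x | p x}, add_mem' := fun {x y} => hadd x y, zero_mem' := h0,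
      smul_mem' := fun t x => hsmul t x }
  exact le_of_forall_wt hb (N := ⊤) (P := P) (fun _ _ _ => trivial) (fun c x _ hx => hp c x hx)
    (Submodule.mem_top (x := x))

end RootSpaces

/-! ### The Killing form, coroots and root strings -/

section KillingForm

variable {L : Type*} [LieRing L] [LieAlgebra ℂ L] {H : LieSubalgebra ℂ L}
  {b : LieAlgebra.Basis (Fin 8) H} {c d : Fin 8 → ℤ} {x y : L}

lemma killingForm_wt_eq_zero (hx : x ∈ wt b c) (hy : y ∈ wt b d) (h : c + d ≠ 0) :
    killingForm ℂ L x y = 0 := by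
  obtain ⟨i, hi⟩ : ∃ i, pairing (c + d) i ≠ 0 := by
    by_contra hcon
    push Not at hcon
    exact h (pairing_injective (funext fun i => by simp [hcon]))
  rw [mem_wt] at hx hy
  refine killingForm_eq_zero_of_mem_eig (hx i) (hy i) ?_
  rw [pairing_add] at hi
  exact_mod_cast hi

/-- The value of the Killing form on a pair of simple root vectors. -/
def kap (b : LieAlgebra.Basis (Fin 8) H) : ℂ := killingForm ℂ L (b.e 0) (b.f 0)

variable (hb : b.A = CartanMatrix.E₈)
include hb

/-- Invariance gives `κ(eᵢ, fᵢ)` times the Cartan entry. Symmetry in `i` and `j` equates `κ(eᵢ, fᵢ)`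
along every edge of the connected simply laced diagram. -/
lemma killingForm_h_h (i j : Fin 8) :
    killingForm ℂ L (b.h i) (b.h j) = kap b * CartanMatrix.E₈ i j := by
  have h1 : ∀ i j, killingForm ℂ L (b.h i) (b.h j) =
      killingForm ℂ L (b.e i) (b.f i) * CartanMatrix.E₈ i j := fun i j => by
    rw [← (b.sl2 i).lie_e_f, killingForm_lie_left, ← lie_skew, b.lie_h_f, hb, neg_smul, neg_neg,
      ← Int.cast_smul_eq_zsmul ℂ, map_smul, smul_eq_mul, mul_comm]
  have h2 : ∀ i j, CartanMatrix.E₈ i j = -1 →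
      killingForm ℂ L (b.e i) (b.f i) = killingForm ℂ L (b.e j) (b.f j) := fun i j hij => by
    have := killingForm_symm (b.h i) (b.h j)
    rw [h1, h1, CartanMatrix.E₈_isSymm.apply i j, hij] at this
    simpa using this
  have e2 := h2 0 2 rfl
  have e3 := h2 2 3 rfl
  have e1 := h2 3 1 rfl
  have e4 := h2 3 4 rfl
  have e5 := h2 4 5 rfl
  have e6 := h2 5 6 rfl
  have e7 := h2 6 7 rfl
  have h3 : ∀ i, killingForm ℂ L (b.e i) (b.f i) = kap b := fun i => by
    simp only [kap]
    fin_cases i <;> simp [← e1, ← e2, ← e3, ← e4, ← e5, ← e6, ← e7]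
  rw [h1, h3]

lemma killingForm_corootComb (c d : Fin 8 → ℤ) :
    killingForm ℂ L (corootComb b c) (corootComb b d) = kap b * form c d := by
  simp only [corootComb, map_sum, LinearMap.sum_apply, ← Int.cast_smul_eq_zsmul ℂ, map_smul,
    LinearMap.smul_apply, killingForm_h_h hb, form, pairing, Int.cast_sum, Int.cast_mul,
    Finset.mul_sum, smul_eq_mul]
  refine Finset.sum_congr rfl fun i _ => Finset.sum_congr rfl fun j _ => ?_
  ring

variable [FiniteDimensional ℂ L] [H.IsCartanSubalgebra] [LieAlgebra.IsKilling ℂ L]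

omit hb [FiniteDimensional ℂ L] [H.IsCartanSubalgebra] in
lemma eq_zero_of_killingForm (hx : ∀ y, killingForm ℂ L x y = 0) : x = 0 := by
  have : x ∈ LinearMap.ker (killingForm ℂ L) := LinearMap.ext hx
  rwa [LieAlgebra.IsKilling.ker_killingForm_eq_bot] at this

lemma eq_zero_of_killingForm_wt (hx : x ∈ wt b c) (h : ∀ y ∈ wt b (-c), killingForm ℂ L x y = 0) :
    x = 0 := by
  refine eq_zero_of_killingForm fun y => ?_
  induction y using wt_induction hb with
  | hp d y hy =>
    by_cases hd : c + d = 0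
    · obtain rfl := eq_neg_of_add_eq_zero_right hd
      exact h y hy
    · exact killingForm_wt_eq_zero hx hy hd
  | hadd y z hy hz => rw [map_add, hy, hz, add_zero]
  | hsmul t y hy => rw [map_smul, hy, smul_zero]

lemma eq_zero_of_mem_cartan (hx : x ∈ H) (h : ∀ i, killingForm ℂ L x (b.h i) = 0) : x = 0 := by
  refine eq_zero_of_killingForm_wt hb (mem_wt_zero_of_mem hx) fun y hy => ?_
  rw [neg_zero, mem_wt_zero_iff hb] at hy
  obtain ⟨t, rfl⟩ := (mem_cartan_iff (b := b)).1 hy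
  simp [h]

lemma kap_ne_zero : kap b ≠ 0 := fun h => by
  have : b.h 0 = 0 := eq_zero_of_mem_cartan hb (h_mem 0) fun i => by
    rw [killingForm_h_h hb, h, zero_mul]
  exact b.linInd.ne_zero 0 this

/-- Both sides lie in the Cartan subalgebra and have the same Killing pairing with every simple
coroot. -/
lemma lie_eq_smul_corootComb (hx : x ∈ wt b c) (hy : y ∈ wt b (-c)) :
    ⁅x, y⁆ = (killingForm ℂ L x y / kap b) • corootComb b c := by
  have hxy := lie_mem_wt hx hy
  rw [add_neg_cancel, mem_wt_zero_iff hb] at hxy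
  rw [← sub_eq_zero]
  refine eq_zero_of_mem_cartan hb (sub_mem hxy (H.smul_mem _ (corootComb_mem c))) fun i => ?_
  rw [mem_wt] at hy
  rw [map_sub, LinearMap.sub_apply, killingForm_lie_left, ← lie_skew, hy i, map_smul,
    LinearMap.smul_apply, ← corootComb_single i, killingForm_corootComb hb, map_neg, map_smul,
    form_single_right, pairing_neg]
  have := kap_ne_zero hb
  simp
  field_simp
  ring

lemma exists_killingForm_eq (hx : x ∈ wt b c) (hx0 : x ≠ 0) (t : ℂ) :
    ∃ y ∈ wt b (-c), killingForm ℂ L x y = t := by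
  by_contra hcon
  push Not at hcon
  refine hx0 (eq_zero_of_killingForm_wt hb hx fun y hy => ?_)
  by_contra hne
  refine hcon ((t / killingForm ℂ L x y) • y) (Submodule.smul_mem _ _ hy) ?_
  rw [map_smul, smul_eq_mul, div_mul_cancel₀ _ hne]

/-- Let `N` be the norm. The coroot of `c` is `2/N` times the corresponding combination of simple
coroots, so its pairings with the simple roots are integers. Unimodularity turns this into `2c = N
d` with `d` in the lattice, so `N` times the norm of `d` is `4`. Both norms are even and `N` is not
negative, hence `N = 2`. -/
lemma form_self_eq_two (hc : c ≠ 0) (hx : x ∈ wt b c) (hx0 : x ≠ 0) : form c c = 2 := by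
  have hN : form c c ≠ 0 := fun h => hc (eq_zero_of_form_self_le h.le)
  have hN' : (form c c : ℂ) ≠ 0 := by exact_mod_cast hN
  have hk := kap_ne_zero hb
  -- This value of the Killing form makes `⁅x, y⁆` act on `x` by `2`.
  obtain ⟨y, hy, hxy⟩ := exists_killingForm_eq hb hx hx0 (2 * kap b / form c c)
  have hlie : ⁅x, y⁆ = (2 / form c c : ℂ) • corootComb b c := by
    rw [lie_eq_smul_corootComb hb hx hy, hxy]
    congr 1
    field_simp
  have ht : IsSl2Triple ⁅x, y⁆ x y := by
    refine ⟨fun h => ?_, rfl, ?_, ?_⟩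
    · have := congrArg (killingForm ℂ L (corootComb b c)) h
      rw [hlie, map_smul, killingForm_corootComb hb, map_zero, smul_eq_mul] at this
      simp [hk, hN'] at this
    · rw [hlie, smul_lie, lie_corootComb hx, smul_smul, div_mul_cancel₀ _ hN',
        ← Nat.cast_smul_eq_nsmul ℂ]
      simp
    · rw [hlie, smul_lie, lie_corootComb hy, smul_smul, form_neg_left, Int.cast_neg, mul_neg,
        div_mul_cancel₀ _ hN', ← Nat.cast_smul_eq_nsmul ℂ]
      simp
  have hco := ht.h_eq_coroot (weightOf_isNonZero hb hx hx0 hc) ((mem_rootSpace_iff hb).2 hx) (by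
    have h : rootComb b (-c) = -rootComb b c := by simp [rootComb]
    have := (mem_rootSpace_iff hb).2 hy
    rw [h] at this
    exact this)
  have hm : ∀ i, ∃ m : ℤ, (2 / form c c : ℂ) * pairing c i = m := fun i => by
    obtain ⟨m, hm⟩ : ∃ m : ℤ, (weightOf hb (e_mem_wt hb i) (b.sl2 i).e_ne_zero)
        (LieAlgebra.IsKilling.coroot (weightOf hb hx hx0)) = m :=
      ⟨_, LieAlgebra.IsKilling.apply_coroot_eq_cast _ _⟩
    refine ⟨m, ?_⟩
    have h1 : rootComb b (Pi.single i 1) (LieAlgebra.IsKilling.coroot (weightOf hb hx hx0)) = m := hm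
    have h2 := lie_of_mem_wt hb (e_mem_wt hb i) (LieAlgebra.IsKilling.coroot (weightOf hb hx hx0))
    rw [h1, ← hco, hlie, smul_lie, lie_corootComb (e_mem_wt hb i), smul_smul,
      form_symm (Pi.single i 1), form_single_right] at h2
    exact smul_left_injective ℂ (b.sl2 i).e_ne_zero h2
  choose m hm using hm
  have hm' : ∀ i, 2 * pairing c i = form c c * m i := fun i => by
    have := hm i
    field_simp at this
    exact_mod_cast this
  have hd : (fun i => 2 * c i) = fun i => form c c * dualCoord m i := by
    refine (eq_dualCoord (y := fun i => form c c * m i) fun i => ?_).trans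
      (funext fun i => dualCoord_smul _ _ i)
    rw [← hm' i, pairing, Finset.mul_sum]
    exact Finset.sum_congr rfl fun j _ => by push_cast; ring
  obtain ⟨d, hd⟩ : ∃ d : Fin 8 → ℤ, (fun i => 2 * c i) = fun i => form c c * d i := ⟨_, hd⟩
  have h4 : 4 * form c c = form c c * form c c * form d d := by
    have h : ∀ v : Fin 8 → ℤ, ∀ t : ℤ, form (fun i => t * v i) (fun i => t * v i) =
        t * t * form v v := fun v t => by
      simp only [form, pairing, Finset.mul_sum]
      exact Finset.sum_congr rfl fun i _ => Finset.sum_congr rfl fun j _ => by ring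
    have := h c 2
    rw [hd, h] at this
    linarith
  have h5 : form c c * form d d = 4 := by
    refine mul_left_cancel₀ hN ?_
    linarith
  obtain ⟨p, hp⟩ := form_self_even c
  obtain ⟨q, hq⟩ := form_self_even d
  rw [hp, hq] at h5
  have hp0 := form_self_nonneg c
  have h6 : p * q = 1 := by linarith
  rcases Int.eq_one_or_neg_one_of_mul_eq_one h6 with h | h <;> omega

lemma lie_eq_corootComb (hc : c ≠ 0) (hx : x ∈ wt b c) (hx0 : x ≠ 0) (hy : y ∈ wt b (-c))
    (h : ⁅⁅x, y⁆, x⁆ = (2 : ℂ) • x) : killingForm ℂ L x y = kap b ∧ ⁅x, y⁆ = corootComb b c := by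
  have h1 := lie_eq_smul_corootComb hb hx hy
  rw [h1, smul_lie, lie_corootComb hx, form_self_eq_two hb hc hx hx0, smul_smul] at h
  have h2 := smul_left_injective ℂ hx0 h
  have h3 : killingForm ℂ L x y / kap b = 1 := by
    push_cast at h2
    linear_combination h2 / 2
  rw [h1, h3, one_smul]
  exact ⟨(div_eq_one_iff_eq (kap_ne_zero hb)).1 h3, rfl⟩

lemma exists_isSl2Triple (hc : c ≠ 0) (hx : x ∈ wt b c) (hx0 : x ≠ 0) :
    ∃ y ∈ wt b (-c), killingForm ℂ L x y = kap b ∧ IsSl2Triple (corootComb b c) x y := by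
  obtain ⟨y, hy, hxy⟩ := exists_killingForm_eq hb hx hx0 (kap b)
  have h2 := form_self_eq_two hb hc hx hx0
  refine ⟨y, hy, hxy, fun h => ?_, ?_, ?_, ?_⟩
  · have := killingForm_corootComb hb c c
    rw [h, map_zero, h2] at this
    simp [kap_ne_zero hb] at this
  · rw [lie_eq_smul_corootComb hb hx hy, hxy, div_self (kap_ne_zero hb), one_smul]
  · rw [lie_corootComb hx, h2, ← Nat.cast_smul_eq_nsmul ℂ]
    simp
  · rw [lie_corootComb hy, form_neg_left, h2, ← Nat.cast_smul_eq_nsmul ℂ]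
    simp

/-- Otherwise `y` would be a primitive vector of negative weight for the triple of `c`, impossible
in finite dimension. -/
lemma lie_ne_zero (hc : c ≠ 0) (hx : x ∈ wt b c) (hx0 : x ≠ 0) (hy : y ∈ wt b d) (hy0 : y ≠ 0)
    (h : form c d < 0) : ⁅x, y⁆ ≠ 0 := fun hxy => by
  obtain ⟨z, hz, -, ht⟩ := exists_isSl2Triple hb hc hx hx0
  have P : ht.HasPrimitiveVectorWith y (form d c : ℂ) := ⟨hy0, lie_corootComb hy c, hxy⟩
  obtain ⟨n, hn⟩ := P.exists_nat
  rw [form_symm] at h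
  have : form d c = n := by exact_mod_cast hn
  omega

/-- Induction on height: a non-simple `c` can be lowered by some `αᵢ` to another such vector, and
`b.e i` takes its root vector back up without killing it. -/
lemma exists_ne_zero_of_form_eq_two (hc : 0 ≤ c) (h : form c c = 2) : ∃ x ∈ wt b c, x ≠ 0 := by
  obtain ⟨n, hn⟩ : ∃ n : ℕ, ∑ i, c i = n := ⟨(∑ i, c i).toNat, by
    rw [Int.toNat_of_nonneg (Finset.sum_nonneg fun i _ => hc i)]⟩
  induction n using Nat.strong_induction_on generalizing c with
  | _ n ih =>
    by_cases hs : ∃ i, c = Pi.single i 1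
    · obtain ⟨i, rfl⟩ := hs
      exact ⟨b.e i, e_mem_wt hb i, (b.sl2 i).e_ne_zero⟩
    push Not at hs
    obtain ⟨i, hi, hp⟩ := exists_pairing_eq_one hc h hs
    have hii : CartanMatrix.E₈ i i = 2 := CartanMatrix.E₈_diag i
    have hsum : ∑ j, (c - Pi.single i 1 : Fin 8 → ℤ) j = n - 1 := by
      simp [Finset.sum_sub_distrib, hn]
    have h0 : 0 ≤ c - Pi.single i 1 := fun j => by
      by_cases hj : j = i
      · subst hj
        simp
        omega
      · simpa [Pi.single_apply, hj] using hc j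
    have hn0 := Finset.sum_nonneg fun j (_ : j ∈ Finset.univ) => h0 j
    obtain ⟨x, hx, hx0⟩ := ih (n - 1) (by simp at hn0 hsum; omega) h0 (by
      rw [form_sub_right, form_sub_left, form_single_right, pairing_sub, pairing_single,
        form_symm (Pi.single i 1), form_single_right, h]
      omega) (by simp at hn0 hsum ⊢; omega)
    refine ⟨⁅b.e i, x⁆, ?_, ?_⟩
    · have := lie_mem_wt (e_mem_wt hb i) hx
      rwa [add_sub_cancel] at this
    · refine lie_ne_zero hb (by simp) (e_mem_wt hb i) (b.sl2 i).e_ne_zero hx hx0 ?_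
      rw [form_symm, form_single_right, pairing_sub, pairing_single]
      omega

lemma apply_zero_eq_of_ne_zero (hx : x ∈ wt b c) (hx0 : x ≠ 0) : -2 ≤ c 0 ∧ c 0 ≤ 2 := by
  by_cases hc : c = 0
  · simp [hc]
  · exact abs_apply_zero_le (form_self_eq_two hb hc hx hx0)

end KillingForm

/-! ### The pair of triples of the highest roots of `E₈` and `E₇` -/

section Coordinates

lemma form_thetaEight_self : form thetaEight thetaEight = 2 := by
  rw [form_thetaEight]; rfl

lemma form_thetaSeven_self : form thetaSeven thetaSeven = 2 := by
  rw [form_thetaSeven]; rfl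

lemma form_thetaEight_thetaSeven : form thetaEight thetaSeven = 0 := by
  rw [form_thetaSeven]; rfl

lemma form_sixRoots_self (k : Fin 6) : form (sixRoots k) (sixRoots k) = 2 := by
  have := form_sixRoots (sixRoots k) k
  fin_cases k <;> simp [sixRoots, dcoord, Fin.succ] at this ⊢ <;> omega

/-- The roots of level `2` orthogonal to `θ - θ'`. -/
def twelveRoots (p : Fin 6 × Bool) : Fin 8 → ℤ :=
  if p.2 then sixRoots p.1 else thetaEight + thetaSeven - sixRoots p.1

lemma sixRoots_zero (k : Fin 6) : sixRoots k 0 = 2 := by fin_cases k <;> rfl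

lemma sixRoots_seven (k : Fin 6) : sixRoots k 7 = 1 := by fin_cases k <;> rfl

lemma twelveRoots_zero (p : Fin 6 × Bool) : twelveRoots p 0 = 2 := by
  rcases p with ⟨k, _ | _⟩ <;> simp [twelveRoots, sixRoots_zero, thetaEight, thetaSeven]

lemma twelveRoots_seven (p : Fin 6 × Bool) : twelveRoots p 7 = 1 := by
  rcases p with ⟨k, _ | _⟩ <;> simp [twelveRoots, sixRoots_seven, thetaEight, thetaSeven]

lemma form_twelveRoots_false (c : Fin 8 → ℤ) (k : Fin 6) :
    form c (twelveRoots (k, false)) = c 0 - form c (sixRoots k) := by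
  simp [twelveRoots, form_add_right, form_sub_right, form_thetaEight, form_thetaSeven]

lemma form_twelveRoots_self (p : Fin 6 × Bool) : form (twelveRoots p) (twelveRoots p) = 2 := by
  rcases p with ⟨k, _ | _⟩
  · rw [form_twelveRoots_false, twelveRoots_zero, form_symm, form_twelveRoots_false,
      form_sixRoots_self, sixRoots_zero]
    rfl
  · simp [twelveRoots, form_sixRoots_self]

lemma thetaEight_nonneg : 0 ≤ thetaEight := fun i => by fin_cases i <;> simp [thetaEight]

lemma thetaSeven_nonneg : 0 ≤ thetaSeven := fun i => by fin_cases i <;> simp [thetaSeven]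

lemma twelveRoots_nonneg (p : Fin 6 × Bool) : 0 ≤ twelveRoots p := fun i => by
  rcases p with ⟨k, _ | _⟩ <;> fin_cases k <;> fin_cases i <;>
    simp [twelveRoots, thetaEight, thetaSeven, sixRoots]

/-- At level `0` some `D₇` coordinate is nonzero, and the fourteen roots of level `2` realize both
signs of every coordinate. -/
lemma exists_form_neg {c : Fin 8 → ℤ} (hc : c ≠ 0) (h0 : c 0 = 0) :
    form c thetaEight < 0 ∨ form c thetaSeven < 0 ∨ ∃ p, form c (twelveRoots p) < 0 := by
  obtain ⟨k, hk⟩ : ∃ k, dcoord c k ≠ 0 := by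
    by_contra hcon
    push Not at hcon
    exact hc (eq_zero_of_dcoord h0 hcon)
  rw [form_thetaEight, form_thetaSeven, h0]
  induction k using Fin.cases with
  | zero =>
    simp [dcoord, h0] at hk
    omega
  | succ k =>
    right; right
    have := form_sixRoots c k
    rcases lt_or_gt_of_ne hk with h | h
    · exact ⟨(k, true), by simp [twelveRoots]; omega⟩
    · exact ⟨(k, false), by rw [form_twelveRoots_false]; omega⟩

/-- The index `0` contributes at most `1` to the norm `2`, so some other index contributes
positively. This keeps the lowering inside level `1`. -/
lemma exists_pairing_eq_one_of_level_one {c : Fin 8 → ℤ} (hc : 0 ≤ c) (h : form c c = 2)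
    (h0 : c 0 = 1) (hs : c ≠ Pi.single 0 1) : ∃ i, i ≠ 0 ∧ pairing c i = 1 := by
  have hf : ∀ i, form (c - Pi.single i 1) (c - Pi.single i 1) = 4 - 2 * pairing c i := fun i => by
    rw [form_sub_right, form_sub_left, form_single_right, pairing_sub, pairing_single,
      form_symm (Pi.single i 1), form_single_right, h, CartanMatrix.E₈_diag]
    ring
  have hle : ∀ i, c ≠ Pi.single i 1 → pairing c i ≤ 1 := fun i hi => by
    by_contra hcon
    exact hi (sub_eq_zero.1 (eq_zero_of_form_self_le (by have := hf i; omega)))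
  have hsum : c 0 * pairing c 0 + ∑ i ∈ Finset.univ.erase 0, c i * pairing c i = 2 := by
    rw [Finset.add_sum_erase _ (fun i => c i * pairing c i) (Finset.mem_univ 0)]
    exact h
  have hp0 := hle 0 hs
  obtain ⟨i, hi0, hi⟩ : ∃ i ∈ Finset.univ.erase 0, 0 < c i * pairing c i := by
    refine Finset.exists_lt_of_sum_lt (f := fun _ => (0 : ℤ)) ?_
    rw [h0] at hsum
    simp only [Finset.sum_const_zero]
    omega
  have hi0 := (Finset.mem_erase.1 hi0).1
  have hpi : 0 < pairing c i := pos_of_mul_pos_right hi (hc i)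
  refine ⟨i, hi0, le_antisymm (hle i fun hcon => ?_) hpi⟩
  rw [hcon, Pi.single_apply, if_neg hi0.symm] at h0
  omega

/-- The difference has norm `4 - 2 θ₇ ≤ 0`, hence vanishes. -/
lemma eq_thetaEight {θ : Fin 8 → ℤ} (h : form θ θ = 2) (hle : thetaEight ≤ θ) :
    θ = thetaEight := by
  have h7 : 2 ≤ θ 7 := hle 7
  have h1 : form (θ - thetaEight) (θ - thetaEight) = 4 - 2 * θ 7 := by
    rw [form_sub_right, form_sub_left, form_sub_left, form_symm thetaEight θ, form_thetaEight,
      form_thetaEight_self, h]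
    ring
  have h3 : form (θ - thetaEight) (θ - thetaEight) ≤ 0 := by omega
  exact sub_eq_zero.1 (eq_zero_of_form_self_le h3)

lemma eq_thetaSeven {θ : Fin 8 → ℤ} (h : form θ θ = 2) (hle : thetaSeven ≤ θ) (h7 : θ 7 = 0) :
    θ = thetaSeven := by
  have h0 : 2 ≤ θ 0 := hle 0
  have h1 : form (θ - thetaSeven) (θ - thetaSeven) = 4 - 2 * (θ 0 - θ 7) := by
    rw [form_sub_right, form_sub_left, form_sub_left, form_symm thetaSeven θ, form_thetaSeven,
      form_thetaSeven_self, h]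
    ring
  have h3 : form (θ - thetaSeven) (θ - thetaSeven) ≤ 0 := by omega
  exact sub_eq_zero.1 (eq_zero_of_form_self_le h3)

end Coordinates

variable {L : Type*} [LieRing L] [LieAlgebra ℂ L] {H : LieSubalgebra ℂ L}
  {b : LieAlgebra.Basis (Fin 8) H} {D : Sl2Pair L}

/-- The triples of the pair belong to the highest roots of `E₈` and `E₇`. -/
structure IsRootPair (b : LieAlgebra.Basis (Fin 8) H) (D : Sl2Pair L) : Prop where
  E₁_mem : D.E₁ ∈ wt b thetaEight
  F₁_mem : D.F₁ ∈ wt b (-thetaEight)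
  E₂_mem : D.E₂ ∈ wt b thetaSeven
  F₂_mem : D.F₂ ∈ wt b (-thetaSeven)
  E₁_ne : D.E₁ ≠ 0
  E₂_ne : D.E₂ ≠ 0
  h₁_eq : D.h₁ = corootComb b thetaEight
  h₂_eq : D.h₂ = corootComb b thetaSeven
  killing_E₁_F₁ : killingForm ℂ L D.E₁ D.F₁ = kap b
  killing_E₂_F₂ : killingForm ℂ L D.E₂ D.F₂ = kap b

namespace IsRootPair

variable (hD : IsRootPair b D) {c : Fin 8 → ℤ} {x : L}
include hD

lemma lie_h₁ (hx : x ∈ wt b c) : ⁅D.h₁, x⁆ = (c 7 : ℂ) • x := by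
  rw [hD.h₁_eq, lie_corootComb hx, form_thetaEight]

lemma lie_h₂ (hx : x ∈ wt b c) : ⁅D.h₂, x⁆ = ((c 0 - c 7 : ℤ) : ℂ) • x := by
  rw [hD.h₂_eq, lie_corootComb hx, form_thetaSeven]

/-- The grading by `h` is the grading by the coefficient of `α₁`: the two contributions of `c 7`
cancel. -/
lemma mem_gr (hx : x ∈ wt b c) : x ∈ D.gr (c 0) :=
  add_mem_eig (hD.lie_h₁ hx) (hD.lie_h₂ hx) (by push_cast; ring)

lemma eq_of_mem_gr {t : ℂ} (hx : x ∈ wt b c) (hx0 : x ≠ 0) (h : x ∈ D.gr t) : (c 0 : ℂ) = t := by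
  have := hD.mem_gr hx
  rw [mem_eig] at this h
  rw [this] at h
  exact smul_left_injective ℂ hx0 h

lemma h_eq : D.h = corootComb b (thetaEight + thetaSeven) := by
  rw [Sl2Pair.h, hD.h₁_eq, hD.h₂_eq, corootComb_add]

lemma h_mem_eig (i : Fin 8) : b.h i ∈ eig D.h₁ 0 ∧ b.h i ∈ eig D.h₂ 0 := by
  have hi := mem_wt_zero_of_mem (b := b) (h_mem (b := b) i)
  have h1 := hD.lie_h₁ hi
  have h2 := hD.lie_h₂ hi
  simp only [Pi.zero_apply, sub_zero, Int.cast_zero] at h1 h2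
  exact ⟨h1, h2⟩

lemma h_mem_gr (i : Fin 8) : b.h i ∈ D.gr 0 :=
  add_mem_eig (hD.h_mem_eig i).1 (hD.h_mem_eig i).2 (add_zero 0)

lemma lie_h_mem_gr {t : ℂ} (i : Fin 8) (hx : x ∈ D.gr t) : ⁅b.h i, x⁆ ∈ D.gr t :=
  lie_mem_eig (hD.h_mem_gr i) hx (zero_add t)

lemma lie_h_mem_W (i : Fin 8) (hx : x ∈ D.W) : ⁅b.h i, x⁆ ∈ D.W :=
  ⟨lie_mem_eig (hD.h_mem_eig i).1 hx.1 (zero_add 1), lie_mem_eig (hD.h_mem_eig i).2 hx.2 (zero_add 1)⟩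

lemma mem_W (hx : x ∈ wt b c) (h0 : c 0 = 2) (h7 : c 7 = 1) : x ∈ D.W := by
  have h1 := hD.lie_h₁ hx
  have h2 := hD.lie_h₂ hx
  rw [h7] at h1
  rw [h0, h7] at h2
  norm_num at h1 h2
  exact ⟨h1.trans (one_smul ℂ x).symm, h2.trans (one_smul ℂ x).symm⟩

variable (hb : b.A = CartanMatrix.E₈) [FiniteDimensional ℂ L] [H.IsCartanSubalgebra]
  [LieAlgebra.IsKilling ℂ L]
include hb

lemma gr_eq_bot {t : ℂ} {n : ℤ} (hn : (n : ℂ) = t) (h : n < -2 ∨ 2 < n) : D.gr t = ⊥ := by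
  rw [eq_bot_iff]
  refine le_of_forall_wt hb (fun i x hx => hD.lie_h_mem_gr i hx) fun c x hx hxc => ?_
  rw [Submodule.mem_bot]
  by_contra hx0
  have h1 := hD.eq_of_mem_gr hxc hx0 hx
  rw [← hn] at h1
  have h2 : c 0 = n := by exact_mod_cast h1
  have h3 := apply_zero_eq_of_ne_zero hb hxc hx0
  omega

lemma mem_gr_two_induction {P : Submodule ℂ L} (hE₁ : D.E₁ ∈ P) (hE₂ : D.E₂ ∈ P)
    (hP : ∀ p, ∀ x ∈ wt b (twelveRoots p), x ∈ P) : D.gr 2 ≤ P := by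
  refine le_of_forall_wt hb (fun i x hx => hD.lie_h_mem_gr i hx) fun c x hx hxc => ?_
  by_cases hx0 : x = 0
  · rw [hx0]
    exact P.zero_mem
  have h1 := hD.eq_of_mem_gr hxc hx0 hx
  have h2 : c 0 = 2 := by exact_mod_cast h1
  have hc : c ≠ 0 := fun h => by
    rw [h] at h2
    simp at h2
  rcases eq_of_level_two (form_self_eq_two hb hc hxc hx0) h2 with rfl | rfl | ⟨k, rfl | rfl⟩
  · obtain ⟨t, rfl⟩ := exists_eq_smul hb hc hD.E₁_mem hD.E₁_ne hxc
    exact P.smul_mem t hE₁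
  · obtain ⟨t, rfl⟩ := exists_eq_smul hb hc hD.E₂_mem hD.E₂_ne hxc
    exact P.smul_mem t hE₂
  · exact hP (k, true) x hxc
  · exact hP (k, false) x hxc

/-- The annihilator is stable under the Cartan subalgebra, so only weight vectors matter. A root of
level `0` pairs negatively with some root of level `2`, so its root vectors act nontrivially. -/
lemma eq_zero_of_lie_gr_two (hx : x ∈ D.gr 0) (h : ∀ y ∈ D.gr 2, ⁅x, y⁆ = 0) : x = 0 := by
  let N : Submodule ℂ L :=
    { carrier := {x | x ∈ D.gr 0 ∧ ∀ y ∈ D.gr 2, ⁅x, y⁆ = 0}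
      add_mem' := fun {x x'} hx hx' => ⟨add_mem hx.1 hx'.1, fun y hy => by
        rw [add_lie, hx.2 y hy, hx'.2 y hy, add_zero]⟩
      zero_mem' := ⟨zero_mem _, fun y _ => zero_lie y⟩
      smul_mem' := fun t x hx => ⟨Submodule.smul_mem _ t hx.1, fun y hy => by
        rw [smul_lie, hx.2 y hy, smul_zero]⟩ }
  suffices hN : N ≤ ⊥ from (Submodule.mem_bot ℂ).1 (hN ⟨hx, h⟩)
  refine le_of_forall_wt hb (fun i x hx => ⟨hD.lie_h_mem_gr i hx.1, fun y hy => ?_⟩)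
    fun c x hx hxc => ?_
  · rw [lie_lie, hx.2 y hy, lie_zero, hx.2 _ (hD.lie_h_mem_gr i hy), sub_zero]
  rw [Submodule.mem_bot]
  by_contra hx0
  have h0 : c 0 = 0 := by exact_mod_cast hD.eq_of_mem_gr hxc hx0 hx.1
  obtain ⟨w, hw, hw0⟩ : ∃ w : Fin 6 × Bool → L, (∀ p, w p ∈ wt b (twelveRoots p)) ∧
      ∀ p, w p ≠ 0 := by
    have := fun p => exists_ne_zero_of_form_eq_two hb (twelveRoots_nonneg p)
      (form_twelveRoots_self p)
    choose w hw hw0 using this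
    exact ⟨w, hw, hw0⟩
  have hE₁ := hx.2 _ (by exact_mod_cast hD.mem_gr hD.E₁_mem)
  have hE₂ := hx.2 _ (by exact_mod_cast hD.mem_gr hD.E₂_mem)
  have hwp := fun p => hx.2 (w p) (by
    have := hD.mem_gr (hw p)
    rw [twelveRoots_zero] at this
    exact_mod_cast this)
  by_cases hc : c = 0
  · rw [hc, mem_wt_zero_iff hb] at hxc
    obtain ⟨t, rfl⟩ := (mem_cartan_iff (b := b)).1 hxc
    have key : ∀ {d y}, y ∈ wt b d → y ≠ 0 → ⁅∑ i, t i • b.h i, y⁆ = 0 →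
        ∑ i, t i * (pairing d i : ℂ) = 0 := fun {d y} hy hy0 h => by
      rw [mem_wt] at hy
      simp only [sum_lie, smul_lie, hy, smul_smul, ← Finset.sum_smul] at h
      exact (smul_eq_zero.1 h).resolve_right hy0
    have k1 := key hD.E₁_mem hD.E₁_ne hE₁
    have k2 := key hD.E₂_mem hD.E₂_ne hE₂
    have k3 := fun k => key (hw (k, true)) (hw0 _) (hwp _)
    have l0 := k3 0
    have l1 := k3 1
    have l2 := k3 2
    have l3 := k3 3
    have l4 := k3 4
    have l5 := k3 5
    simp [Fin.sum_univ_eight, pairing_explicit, thetaEight, thetaSeven, twelveRoots, sixRoots]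
      at k1 k2 l0 l1 l2 l3 l4 l5
    -- The weights `θ`, `θ'` and the six of `sixRoots` are linearly independent, so an element of
    -- the Cartan subalgebra annihilated by all eight is zero.
    have ht : t = 0 := by
      funext i
      fin_cases i <;> simp <;> grind
    exact hx0 (by simp [ht])
  · rcases exists_form_neg hc h0 with h | h | ⟨p, h⟩
    · exact lie_ne_zero hb hc hxc hx0 hD.E₁_mem hD.E₁_ne h hE₁
    · exact lie_ne_zero hb hc hxc hx0 hD.E₂_mem hD.E₂_ne h hE₂
    · exact lie_ne_zero hb hc hxc hx0 (hw p) (hw0 p) h (hwp p)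

lemma exists_decomp (x : L) : ∃ x₂ ∈ D.gr 2, ∃ x₁ ∈ D.gr 1, ∃ x₀ ∈ D.gr 0, ∃ y₁ ∈ D.gr (-1),
    ∃ y₂ ∈ D.gr (-2), x = x₂ + x₁ + x₀ + y₁ + y₂ := by
  induction x using wt_induction hb with
  | hp c x hx =>
    by_cases hx0 : x = 0
    · exact ⟨0, zero_mem _, 0, zero_mem _, 0, zero_mem _, 0, zero_mem _, 0, zero_mem _,
        by simp [hx0]⟩
    have h := apply_zero_eq_of_ne_zero hb hx hx0
    have hm := hD.mem_gr hx
    rcases (by omega : c 0 = 2 ∨ c 0 = 1 ∨ c 0 = 0 ∨ c 0 = -1 ∨ c 0 = -2) with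
      h | h | h | h | h <;> rw [h] at hm <;> push_cast at hm
    · exact ⟨x, hm, 0, zero_mem _, 0, zero_mem _, 0, zero_mem _, 0,
        zero_mem _, by simp⟩
    · exact ⟨0, zero_mem _, x, hm, 0, zero_mem _, 0, zero_mem _, 0,
        zero_mem _, by simp⟩
    · exact ⟨0, zero_mem _, 0, zero_mem _, x, hm, 0, zero_mem _, 0,
        zero_mem _, by simp⟩
    · exact ⟨0, zero_mem _, 0, zero_mem _, 0, zero_mem _, x, hm, 0,
        zero_mem _, by simp⟩
    · exact ⟨0, zero_mem _, 0, zero_mem _, 0, zero_mem _, 0, zero_mem _, x,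
        hm, by simp⟩
  | hadd x y hx hy =>
    obtain ⟨a, ha, a', ha', a'', ha'', a₃, ha₃, a₄, ha₄, rfl⟩ := hx
    obtain ⟨c, hc, c', hc', c'', hc'', c₃, hc₃, c₄, hc₄, rfl⟩ := hy
    exact ⟨_, add_mem ha hc, _, add_mem ha' hc', _, add_mem ha'' hc'', _, add_mem ha₃ hc₃, _,
      add_mem ha₄ hc₄, by abel⟩
  | hsmul t x hx =>
    obtain ⟨a, ha, a', ha', a'', ha'', a₃, ha₃, a₄, ha₄, rfl⟩ := hx
    exact ⟨_, Submodule.smul_mem _ t ha, _, Submodule.smul_mem _ t ha', _,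
      Submodule.smul_mem _ t ha'', _, Submodule.smul_mem _ t ha₃, _, Submodule.smul_mem _ t ha₄,
      by simp only [smul_add]⟩

lemma exists_of_mem_gr_two (x : L) (hx : x ∈ D.gr 2) :
    ∃ w ∈ D.W, ∃ a c : ℂ, x = w + a • D.E₁ + c • D.E₂ := by
  have hP : D.gr 2 ≤ D.W ⊔ (ℂ ∙ D.E₁) ⊔ ℂ ∙ D.E₂ := by
    refine hD.mem_gr_two_induction hb ?_ ?_ fun p y hy => ?_
    · exact Submodule.mem_sup_left (Submodule.mem_sup_right (Submodule.mem_span_singleton_self _))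
    · exact Submodule.mem_sup_right (Submodule.mem_span_singleton_self _)
    · exact Submodule.mem_sup_left (Submodule.mem_sup_left
        (hD.mem_W hy (twelveRoots_zero p) (twelveRoots_seven p)))
  obtain ⟨y', hy', z, hz, rfl⟩ := Submodule.mem_sup.1 (hP hx)
  obtain ⟨w, hw, y, hy, rfl⟩ := Submodule.mem_sup.1 hy'
  obtain ⟨a, rfl⟩ := Submodule.mem_span_singleton.1 hy
  obtain ⟨a', rfl⟩ := Submodule.mem_span_singleton.1 hz
  exact ⟨w, hw, a, a', rfl⟩

lemma isSpecial : D.IsSpecial where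
  killing_eq := hD.killing_E₁_F₁.trans hD.killing_E₂_F₂.symm
  killing_ne := by rw [hD.killing_E₁_F₁]; exact kap_ne_zero hb
  exists_decomp := hD.exists_decomp hb
  gr_three := hD.gr_eq_bot hb (n := 3) (by norm_num) (by norm_num)
  gr_neg_three := hD.gr_eq_bot hb (n := -3) (by norm_num) (by norm_num)
  gr_four := hD.gr_eq_bot hb (n := 4) (by norm_num) (by norm_num)
  gr_neg_four := hD.gr_eq_bot hb (n := -4) (by norm_num) (by norm_num)
  exists_of_mem_gr_two := hD.exists_of_mem_gr_two hb
  faithful _ hx h := hD.eq_zero_of_lie_gr_two hb hx h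

lemma W_induction {P : Submodule ℂ L} (hP : ∀ p, ∀ x ∈ wt b (twelveRoots p), x ∈ P) :
    D.W ≤ P := by
  refine le_of_forall_wt hb (fun i x hx => hD.lie_h_mem_W i hx) fun c x hx hxc => ?_
  by_cases hx0 : x = 0
  · rw [hx0]
    exact P.zero_mem
  have h2 : c 0 = 2 := by exact_mod_cast hD.eq_of_mem_gr hxc hx0 (D.W_le hx)
  have h7 : c 7 = 1 := by
    have h1 : ⁅D.h₁, x⁆ = (1 : ℂ) • x := hx.1
    rw [hD.lie_h₁ hxc] at h1
    exact_mod_cast smul_left_injective ℂ hx0 h1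
  have hc : c ≠ 0 := fun h => by
    rw [h] at h2
    simp at h2
  rcases eq_of_level_two (form_self_eq_two hb hc hxc hx0) h2 with rfl | rfl | ⟨k, rfl | rfl⟩
  · simp [thetaEight] at h7
  · simp [thetaSeven] at h7
  · exact hP (k, true) x hxc
  · exact hP (k, false) x hxc

lemma finrank_W : Module.finrank ℂ D.W = 12 := by
  have := fun p => exists_ne_zero_of_form_eq_two hb (twelveRoots_nonneg p) (form_twelveRoots_self p)
  choose w hw hw0 using this
  -- Chosen with `D₇` coordinates `0, 2, 4, …, 12`, so that it takes the twelve distinct values `15,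
  -- …, 20` and `22, …, 27` on the weights of `W`.
  let g : Fin 8 → ℤ := ![42, 42, 69, 95, 78, 60, 41, 21]
  have hg : Function.Injective fun p => (form (twelveRoots p) g : ℂ) := fun p q h => by
    have h' : form g (twelveRoots p) = form g (twelveRoots q) := by
      rw [form_symm, form_symm g]
      exact Int.cast_injective (α := ℂ) h
    have hk : ∀ k, form g (sixRoots k) = 22 + k := fun k => by
      have := form_sixRoots g k
      fin_cases k <;> simp [dcoord, g, Fin.succ] at this ⊢ <;> omega
    have ht : ∀ k, form g (twelveRoots (k, true)) = 22 + k := hk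
    have hf : ∀ k, form g (twelveRoots (k, false)) = 20 - k := fun k => by
      have hg0 : g 0 = 42 := rfl
      rw [form_twelveRoots_false, hk, hg0]
      ring
    rcases p with ⟨k, _ | _⟩ <;> rcases q with ⟨l, _ | _⟩ <;>
      simp only [hf, ht] at h' <;> simp [Fin.ext_iff] <;> omega
  have hli : LinearIndependent ℂ w :=
    Module.End.eigenvectors_linearIndependent' (LieAlgebra.ad ℂ L (corootComb b g))
      (fun p => (form (twelveRoots p) g : ℂ)) hg w fun p => by
        refine ⟨?_, hw0 p⟩
        rw [Module.End.mem_eigenspace_iff]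
        exact lie_corootComb (hw p) g
  have hW : D.W = Submodule.span ℂ (Set.range w) := by
    refine le_antisymm (hD.W_induction hb fun p x hx => ?_) (Submodule.span_le.2 ?_)
    · obtain ⟨t, rfl⟩ := exists_eq_smul hb (fun h => by
        have := twelveRoots_zero p
        rw [h] at this
        simp at this) (hw p) (hw0 p) hx
      exact Submodule.smul_mem _ _ (Submodule.subset_span ⟨p, rfl⟩)
    · rintro - ⟨p, rfl⟩
      exact hD.mem_W (hw p) (twelveRoots_zero p) (twelveRoots_seven p)
  rw [hW, finrank_span_eq_card hli]
  rfl

/-- Every root of level `1` descends to `α₁` through `b.f i` with `i ≠ 0`, which has degree `0`.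
Each step is undone up to a nonzero scalar by `b.e i`, so membership in `N` passes both ways. -/
lemma mem_iff_of_level_one {N : Submodule ℂ L} (hN : ∀ x ∈ D.gr 0, ∀ w ∈ N, ⁅x, w⁆ ∈ N)
    (hx : x ∈ wt b c) (hx0 : x ≠ 0) (h0 : c 0 = 1) : x ∈ N ↔ b.e 0 ∈ N := by
  have aux : ∀ {d : Fin 8 → ℤ}, d 0 = 1 → d ≠ 0 := fun hd h => by
    rw [h] at hd
    simp at hd
  have aux' : ∀ {d : Fin 8 → ℤ} {y}, d 0 = 1 → y ∈ wt b d → y ≠ 0 → 0 ≤ d := fun hd hy hy0 => by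
    rcases nonneg_or_nonpos hb hy hy0 with h | h
    · exact h
    · have := h 0
      simp [hd] at this
  have hc := aux h0
  have hpos := aux' h0 hx hx0
  obtain ⟨n, hn⟩ : ∃ n : ℕ, ∑ i, c i = n := ⟨(∑ i, c i).toNat, by
    rw [Int.toNat_of_nonneg (Finset.sum_nonneg fun i _ => hpos i)]⟩
  induction n generalizing c x with
  | zero =>
    have := (Finset.sum_eq_zero_iff_of_nonneg fun i _ => hpos i).1 hn 0 (Finset.mem_univ 0)
    omega
  | succ n ih =>
    by_cases hs : c = Pi.single 0 1
    · subst hs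
      obtain ⟨t, ht⟩ := exists_eq_smul hb hc (e_mem_wt hb 0) (b.sl2 0).e_ne_zero hx
      obtain ⟨s, hs⟩ := exists_eq_smul hb hc hx hx0 (e_mem_wt hb 0)
      exact ⟨fun h => hs ▸ N.smul_mem s h, fun h => ht ▸ N.smul_mem t h⟩
    obtain ⟨i, hi, hp⟩ := exists_pairing_eq_one_of_level_one hpos
      (form_self_eq_two hb hc hx hx0) h0 hs
    have hy := lie_mem_wt (f_mem_wt hb i) hx
    have hy0 : ⁅b.f i, x⁆ ≠ 0 := lie_ne_zero hb (by simp) (f_mem_wt hb i) (b.sl2 i).f_ne_zero hx hx0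
      (by rw [form_symm, form_neg_right, form_single_right, hp]; norm_num)
    have hz := lie_mem_wt (e_mem_wt hb i) hy
    rw [add_neg_cancel_left] at hz
    have hz0 : ⁅b.e i, ⁅b.f i, x⁆⁆ ≠ 0 := lie_ne_zero hb (by simp) (e_mem_wt hb i)
      (b.sl2 i).e_ne_zero hy hy0 (by
        rw [form_symm, form_single_right, pairing_add, pairing_neg, pairing_single,
          CartanMatrix.E₈_diag, hp]
        norm_num)
    have hd0 : (-Pi.single i 1 + c : Fin 8 → ℤ) 0 = 1 := by simp [hi.symm, h0]
    have he : b.e i ∈ D.gr 0 := by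
      have := hD.mem_gr (e_mem_wt hb i)
      simpa [Pi.single_apply, hi.symm] using this
    have hf : b.f i ∈ D.gr 0 := by
      have := hD.mem_gr (f_mem_wt hb i)
      simpa [Pi.single_apply, hi.symm] using this
    have key := ih hy hy0 hd0 (aux hd0) (aux' hd0 hy hy0)
      (by simp [Finset.sum_add_distrib, hn])
    refine Iff.trans ?_ key
    refine ⟨fun h => hN _ hf _ h, fun h => ?_⟩
    obtain ⟨t, ht⟩ := exists_eq_smul hb hc hz hz0 hx
    rw [ht]
    exact N.smul_mem t (hN _ he _ h)

lemma gr_one_irreducible (N : Submodule ℂ L) (hN1 : N ≤ D.gr 1)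
    (hN : ∀ x ∈ D.gr 0, ∀ w ∈ N, ⁅x, w⁆ ∈ N) : N = ⊥ ∨ N = D.gr 1 := by
  by_cases h : b.e 0 ∈ N
  · right
    refine le_antisymm hN1 (le_of_forall_wt hb (fun i x hx => hD.lie_h_mem_gr i hx)
      fun c x hx hxc => ?_)
    by_cases hx0 : x = 0
    · rw [hx0]
      exact N.zero_mem
    · exact (hD.mem_iff_of_level_one hb hN hxc hx0
        (by exact_mod_cast hD.eq_of_mem_gr hxc hx0 hx)).2 h
  · left
    rw [eq_bot_iff]
    refine le_of_forall_wt hb (fun i x hx => hN _ (hD.h_mem_gr i) _ hx) fun c x hx hxc => ?_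
    rw [Submodule.mem_bot]
    by_contra hx0
    exact h ((hD.mem_iff_of_level_one hb hN hxc hx0
      (by exact_mod_cast hD.eq_of_mem_gr hxc hx0 (hN1 hx))).1 hx)

omit [FiniteDimensional ℂ L] [H.IsCartanSubalgebra] [LieAlgebra.IsKilling ℂ L] in
lemma e_zero_mem : b.e 0 ∈ D.gr 1 := by
  simpa using hD.mem_gr (e_mem_wt hb 0)

end IsRootPair

/-! ### Centralizers and regular subalgebras -/

section Regular

variable {L : Type*} [LieRing L] [LieAlgebra ℂ L]

/-- The centralizer of an element. -/
def annihilator (z : L) : LieSubalgebra ℂ L where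
  carrier := {x | ⁅x, z⁆ = 0}
  add_mem' {x x'} hx hx' := by
    rw [Set.mem_ofPred_eq] at hx hx' ⊢
    rw [add_lie, hx, hx', add_zero]
  zero_mem' := zero_lie z
  smul_mem' c x hx := by
    rw [Set.mem_ofPred_eq] at hx ⊢
    rw [smul_lie, hx, smul_zero]
  lie_mem' {x x'} hx hx' := by
    change ⁅x, z⁆ = 0 at hx
    change ⁅x', z⁆ = 0 at hx'
    change ⁅⁅x, x'⁆, z⁆ = 0
    rw [lie_lie, hx, hx', lie_zero, lie_zero, sub_zero]

lemma mem_annihilator {x z : L} : x ∈ annihilator z ↔ ⁅x, z⁆ = 0 := Iff.rfl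

lemma mem_centralizer {x : L} {K : LieSubalgebra ℂ L} :
    x ∈ centralizer K ↔ ∀ y ∈ K, ⁅x, y⁆ = 0 := Iff.rfl

/-- The part of degree zero orthogonal to the grading element. -/
def Sl2Pair.levi (D : Sl2Pair L) : LieSubalgebra ℂ L where
  carrier := {x | x ∈ D.gr 0 ∧ killingForm ℂ L x D.h = 0}
  add_mem' {x x'} hx hx' := ⟨add_mem hx.1 hx'.1, by
    rw [map_add, LinearMap.add_apply, hx.2, hx'.2, add_zero]⟩
  zero_mem' := ⟨zero_mem _, by rw [map_zero, LinearMap.zero_apply]⟩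
  smul_mem' c x hx := ⟨Submodule.smul_mem _ c hx.1, by
    rw [map_smul, LinearMap.smul_apply, hx.2, smul_zero]⟩
  lie_mem' {x x'} hx hx' := by
    refine ⟨lie_mem_eig hx.1 hx'.1 (add_zero 0), ?_⟩
    have h : ⁅D.h, x'⁆ = 0 := hx'.1.trans (zero_smul ℂ x')
    rw [killingForm_lie_left, ← lie_skew, h, neg_zero, map_zero]

variable {H : LieSubalgebra ℂ L} {b : LieAlgebra.Basis (Fin 8) H} {c d : Fin 8 → ℤ} {x y : L}
  (hb : b.A = CartanMatrix.E₈) [FiniteDimensional ℂ L] [H.IsCartanSubalgebra]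
  [LieAlgebra.IsKilling ℂ L]
include hb

lemma mem_rootsOn {J : Set (Fin 8)} :
    c ∈ rootsOn b J ↔ c ≠ 0 ∧ (∀ i ∉ J, c i = 0) ∧ ∃ x ∈ wt b c, x ≠ 0 := by
  have h : LieAlgebra.rootSpace H (rootComb b c) ≠ ⊥ ↔ ∃ x ∈ wt b c, x ≠ 0 := by
    rw [ne_eq, LieSubmodule.eq_bot_iff]
    push Not
    simp only [mem_rootSpace_iff hb]
  exact and_congr Iff.rfl (and_congr Iff.rfl h)

lemma mem_regularSubalgebra {J : Set (Fin 8)} (hc : c ≠ 0) (hJ : ∀ i ∉ J, c i = 0)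
    (hx : x ∈ wt b c) : x ∈ regularSubalgebra b J := by
  by_cases hx0 : x = 0
  · rw [hx0]
    exact zero_mem _
  · exact LieSubalgebra.subset_lieSpan
      ⟨c, (mem_rootsOn hb).2 ⟨hc, hJ, x, hx, hx0⟩, (mem_rootSpace_iff hb).2 hx⟩

lemma h_mem_regularSubalgebra {J : Set (Fin 8)} {i : Fin 8} (hi : i ∈ J) :
    b.h i ∈ regularSubalgebra b J := by
  have hJ : ∀ j ∉ J, (Pi.single i 1 : Fin 8 → ℤ) j = 0 := fun j hj =>
    Pi.single_eq_of_ne (fun h => hj (by rwa [h])) _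
  rw [← (b.sl2 i).lie_e_f]
  refine LieSubalgebra.lie_mem _ (mem_regularSubalgebra hb (by simp) hJ (e_mem_wt hb i))
    (mem_regularSubalgebra hb (by simp) (fun j hj => ?_) (f_mem_wt hb i))
  rw [Pi.neg_apply, hJ j hj, neg_zero]

lemma regularSubalgebra_le {J : Set (Fin 8)} {K : LieSubalgebra ℂ L}
    (h : ∀ c ≠ 0, (∀ i ∉ J, c i = 0) → ∀ x ∈ wt b c, x ≠ 0 → x ∈ K) :
    regularSubalgebra b J ≤ K := by
  refine LieSubalgebra.lieSpan_le.2 ?_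
  rintro x ⟨c, hc, hx⟩
  rw [mem_rootsOn hb] at hc
  rw [mem_rootSpace_iff hb] at hx
  by_cases hx0 : x = 0
  · rw [hx0]
    exact zero_mem K
  · exact h c hc.1 hc.2.1 x hx hx0

/-- A nonzero bracket would have weight of norm `4 + 2 (c, d) ≥ 4`, but roots have norm `2`. -/
lemma lie_eq_zero_of_form_nonneg (hc : c ≠ 0) (hd : d ≠ 0) (hx : x ∈ wt b c) (hy : y ∈ wt b d)
    (hcd : c + d ≠ 0) (h : 0 ≤ form c d) : ⁅x, y⁆ = 0 := by
  by_contra hne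
  have hx0 : x ≠ 0 := fun h => hne (by rw [h, zero_lie])
  have hy0 : y ≠ 0 := fun h => hne (by rw [h, lie_zero])
  have := form_self_eq_two hb hcd (lie_mem_wt hx hy) hne
  rw [form_add_left, form_add_right, form_add_right, form_symm d c,
    form_self_eq_two hb hc hx hx0, form_self_eq_two hb hd hy hy0] at this
  omega

namespace IsRootPair

variable {D : Sl2Pair L} (hD : IsRootPair b D)
include hD

lemma mem_cent_inf_annihilator : x ∈ D.cent ⊓ annihilator D.u ↔
    x ∈ D.gr 0 ∧ ⁅x, D.E₁⁆ = 0 ∧ ⁅x, D.E₂⁆ = 0 := by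
  rw [LieSubalgebra.mem_inf, mem_annihilator]
  constructor
  · rintro ⟨h1, h2⟩
    have h3 : ⁅x, D.E₁ + D.E₂⁆ = 0 := h1.1
    have h4 : ⁅x, D.E₁ - D.E₂⁆ = 0 := h2
    rw [lie_add] at h3
    rw [lie_sub] at h4
    have h5 : (2 : ℂ) • ⁅x, D.E₁⁆ = 0 := by
      rw [two_smul]
      calc ⁅x, D.E₁⁆ + ⁅x, D.E₁⁆ = ⁅x, D.E₁⁆ + ⁅x, D.E₂⁆ + (⁅x, D.E₁⁆ - ⁅x, D.E₂⁆) := by abel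
        _ = 0 := by rw [h3, h4, add_zero]
    have h6 := (smul_eq_zero.1 h5).resolve_left two_ne_zero
    exact ⟨D.cent_le h1, h6, by rwa [h6, zero_add] at h3⟩
  · rintro ⟨h1, h2, h3⟩
    refine ⟨(hD.isSpecial hb).mem_cent_of_lie_E h1 ?_, ?_⟩
    · rw [show D.E = D.E₁ + D.E₂ from rfl, lie_add, h2, h3, add_zero]
    · rw [show D.u = D.E₁ - D.E₂ from rfl, lie_sub, h2, h3, sub_zero]

/-- Vanishing of the first and last coefficients means orthogonality to `θ` and `θ'`, equivalently
commuting with `E₁` and `E₂`. -/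
lemma regularSubalgebra_so12 :
    regularSubalgebra b {1, 2, 3, 4, 5, 6} = D.cent ⊓ annihilator D.u := by
  have hJ : ∀ c : Fin 8 → ℤ, (∀ i ∉ ({1, 2, 3, 4, 5, 6} : Set (Fin 8)), c i = 0) ↔
      c 0 = 0 ∧ c 7 = 0 := fun c => by
    refine ⟨fun h => ⟨h 0 (by simp), h 7 (by simp)⟩, fun h i hi => ?_⟩
    fin_cases i <;> simp_all
  refine le_antisymm (regularSubalgebra_le hb fun c hc hcJ x hx hx0 => ?_) ?_
  · rw [hJ] at hcJ
    have aux : ∀ (d : Fin 8 → ℤ) (y : L), y ∈ wt b d → d 0 = 2 → form c d = 0 →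
        ⁅x, y⁆ = 0 := fun d y hy hd hf => by
      refine lie_eq_zero_of_form_nonneg hb hc (fun h => ?_) hx hy (fun h => ?_) hf.ge
      · rw [h] at hd
        simp at hd
      · have := congrFun h 0
        simp [hcJ.1, hd] at this
    refine (hD.mem_cent_inf_annihilator hb).2 ⟨?_, aux _ _ hD.E₁_mem rfl ?_, aux _ _ hD.E₂_mem rfl ?_⟩
    · have := hD.mem_gr hx
      rwa [hcJ.1, Int.cast_zero] at this
    · rw [form_thetaEight, hcJ.2]
    · rw [form_thetaSeven, hcJ.1, hcJ.2, sub_zero]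
  · refine le_of_forall_wt hb (N := (D.cent ⊓ annihilator D.u).toSubmodule)
      (P := (regularSubalgebra b {1, 2, 3, 4, 5, 6}).toSubmodule)
      (fun i x hx => ?_) fun c x hx hxc => ?_
    · rw [LieSubalgebra.mem_toSubmodule, hD.mem_cent_inf_annihilator hb] at hx ⊢
      refine ⟨hD.lie_h_mem_gr i hx.1, ?_, ?_⟩
      · rw [lie_lie, hx.2.1, lie_zero, mem_wt.1 hD.E₁_mem, lie_smul, hx.2.1, smul_zero, sub_zero]
      · rw [lie_lie, hx.2.2, lie_zero, mem_wt.1 hD.E₂_mem, lie_smul, hx.2.2, smul_zero, sub_zero]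
    · rw [LieSubalgebra.mem_toSubmodule, hD.mem_cent_inf_annihilator hb] at hx
      obtain ⟨h0, h1, h2⟩ := hx
      by_cases hx0 : x = 0
      · rw [hx0]
        exact zero_mem _
      have hc0 : c 0 = 0 := by exact_mod_cast hD.eq_of_mem_gr hxc hx0 h0
      by_cases hc : c = 0
      · rw [hc, mem_wt_zero_iff hb] at hxc
        obtain ⟨t, rfl⟩ := (mem_cartan_iff (b := b)).1 hxc
        have key : ∀ {d y}, y ∈ wt b d → y ≠ 0 → ⁅∑ i, t i • b.h i, y⁆ = 0 →
            ∑ i, t i * (pairing d i : ℂ) = 0 := fun {d y} hy hy0 h => by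
          rw [mem_wt] at hy
          simp only [sum_lie, smul_lie, hy, smul_smul, ← Finset.sum_smul] at h
          exact (smul_eq_zero.1 h).resolve_right hy0
        have k1 := key hD.E₁_mem hD.E₁_ne h1
        have k2 := key hD.E₂_mem hD.E₂_ne h2
        simp [Fin.sum_univ_eight, pairing_explicit, thetaEight, thetaSeven] at k1 k2
        rw [k1, neg_zero, add_zero] at k2
        refine sum_mem fun i _ => ?_
        by_cases hi : i ∈ ({1, 2, 3, 4, 5, 6} : Set (Fin 8))
        · exact Submodule.smul_mem _ _ (h_mem_regularSubalgebra hb hi)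
        · have : t i = 0 := by fin_cases i <;> simp_all
          rw [this, zero_smul]
          exact zero_mem _
      · refine mem_regularSubalgebra hb hc ((hJ c).2 ⟨hc0, ?_⟩) hxc
        have h8 : ¬form c thetaEight < 0 := fun h => lie_ne_zero hb hc hxc hx0 hD.E₁_mem hD.E₁_ne h h1
        have h7 : ¬form c thetaSeven < 0 := fun h => lie_ne_zero hb hc hxc hx0 hD.E₂_mem hD.E₂_ne h h2
        rw [form_thetaEight] at h8
        rw [form_thetaSeven] at h7
        omega

omit [FiniteDimensional ℂ L] [H.IsCartanSubalgebra] [LieAlgebra.IsKilling ℂ L] in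
lemma killing_h_h (i : Fin 8) :
    killingForm ℂ L (b.h i) D.h = kap b * (if i = 0 then 1 else 0 : ℤ) := by
  rw [hD.h_eq, ← corootComb_single i, killingForm_corootComb hb, form_add_right, form_thetaEight,
    form_thetaSeven, add_sub_cancel, Pi.single_apply]
  simp only [eq_comm]

/-- Only the Cartan part needs care: among the simple coroots just the first pairs nontrivially with
`h`, so orthogonality to `h` removes exactly its coefficient. -/
lemma regularSubalgebra_so14 : regularSubalgebra b {1, 2, 3, 4, 5, 6, 7} = D.levi := by
  have hJ : ∀ c : Fin 8 → ℤ, (∀ i ∉ ({1, 2, 3, 4, 5, 6, 7} : Set (Fin 8)), c i = 0) ↔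
      c 0 = 0 := fun c => by
    refine ⟨fun h => h 0 (by simp), fun h i hi => ?_⟩
    fin_cases i <;> simp_all
  refine le_antisymm (regularSubalgebra_le hb fun c hc hcJ x hx hx0 => ?_) ?_
  · rw [hJ] at hcJ
    refine ⟨?_, ?_⟩
    · have := hD.mem_gr hx
      rwa [hcJ, Int.cast_zero] at this
    · refine killingForm_wt_eq_zero hx (mem_wt_zero_of_mem (b := b) ?_) (by rwa [add_zero])
      rw [hD.h_eq]
      exact corootComb_mem _
  · refine le_of_forall_wt hb (N := D.levi.toSubmodule)
      (P := (regularSubalgebra b {1, 2, 3, 4, 5, 6, 7}).toSubmodule)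
      (fun i x hx => ?_) fun c x hx hxc => ?_
    · refine ⟨hD.lie_h_mem_gr i hx.1, ?_⟩
      have h : ⁅D.h, x⁆ = 0 := hx.1.trans (zero_smul ℂ x)
      rw [killingForm_lie_left, ← lie_skew, h, neg_zero, map_zero]
    · by_cases hx0 : x = 0
      · rw [hx0]
        exact zero_mem _
      have hc0 : c 0 = 0 := by exact_mod_cast hD.eq_of_mem_gr hxc hx0 hx.1
      by_cases hc : c = 0
      · rw [hc, mem_wt_zero_iff hb] at hxc
        obtain ⟨t, rfl⟩ := (mem_cartan_iff (b := b)).1 hxc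
        have h := hx.2
        simp only [map_sum, LinearMap.sum_apply, map_smul, LinearMap.smul_apply,
          hD.killing_h_h hb] at h
        simp [kap_ne_zero hb] at h
        refine sum_mem fun i _ => ?_
        by_cases hi : i ∈ ({1, 2, 3, 4, 5, 6, 7} : Set (Fin 8))
        · exact Submodule.smul_mem _ _ (h_mem_regularSubalgebra hb hi)
        · have : t i = 0 := by fin_cases i <;> simp_all
          rw [this, zero_smul]
          exact zero_mem _
      · exact mem_regularSubalgebra hb hc ((hJ c).2 hc0) hxc

end IsRootPair

end Regular

/-! ### The pinning of the centralizer -/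

section SubalgebraBasis

variable {L : Type*} [LieRing L] [LieAlgebra ℂ L]

/-- A basis of a subalgebra in terms of elements of the ambient Lie algebra. -/
def subalgebraBasis {n : ℕ} (H K : LieSubalgebra ℂ L) (A : Matrix (Fin n) (Fin n) ℤ)
    (hA : A.Nondegenerate) (h e f : Fin n → L) (hh : ∀ i, h i ∈ K) (he : ∀ i, e i ∈ K)
    (hf : ∀ i, f i ∈ K) (hH : ∀ i, h i ∈ H)
    (hHK : ∀ x ∈ H, x ∈ K → ∃ s : Fin n → ℂ, x = ∑ i, s i • h i)
    (hspan : ∀ K' : LieSubalgebra ℂ L, (∀ i, e i ∈ K') → (∀ i, f i ∈ K') → K ≤ K')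
    (hli : LinearIndependent ℂ h) (hsl : ∀ i, IsSl2Triple (h i) (e i) (f i))
    (hhh : ∀ i j, ⁅h i, h j⁆ = 0) (hhe : ∀ i j, ⁅h j, e i⁆ = A i j • e i)
    (hhf : ∀ i j, ⁅h j, f i⁆ = -A i j • f i) (hef : ∀ i j, i ≠ j → ⁅e i, f j⁆ = 0) :
    LieAlgebra.Basis (Fin n) (H.comap K.incl) where
  A := A
  h i := ⟨h i, hh i⟩
  e i := ⟨e i, he i⟩
  f i := ⟨f i, hf i⟩
  cartan_eq_lieSpan := by
    refine le_antisymm (fun x hx => ?_) (LieSubalgebra.lieSpan_le.2 ?_)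
    · obtain ⟨s, hs⟩ := hHK x hx x.2
      have : x = ∑ i, s i • (⟨h i, hh i⟩ : K) := Subtype.ext (by simp [hs])
      rw [this]
      exact sum_mem fun i _ => LieSubalgebra.smul_mem _ _
        (LieSubalgebra.subset_lieSpan (Set.mem_range_self i))
    · rintro - ⟨i, rfl⟩
      exact hH i
  span_ef := by
    refine eq_top_iff.2 fun x _ => ?_
    set M := LieSubalgebra.lieSpan ℂ K
      (Set.range (fun i => (⟨e i, he i⟩ : K)) ∪ Set.range fun i => (⟨f i, hf i⟩ : K))
    have hM := hspan (M.map K.incl)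
      (fun i => ⟨⟨e i, he i⟩, LieSubalgebra.subset_lieSpan (Or.inl ⟨i, rfl⟩), rfl⟩)
      (fun i => ⟨⟨f i, hf i⟩, LieSubalgebra.subset_lieSpan (Or.inr ⟨i, rfl⟩), rfl⟩)
    obtain ⟨y, hy, hyx⟩ := hM x.2
    have : y = x := Subtype.ext hyx
    rwa [← this]
  linInd := LinearIndependent.of_comp K.toSubmodule.subtype hli
  nondegen := hA
  sl2 i :=
    { h_ne_zero := fun h0 => (hsl i).h_ne_zero (congrArg Subtype.val h0)
      lie_e_f := Subtype.ext (hsl i).lie_e_f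
      lie_h_e_nsmul := Subtype.ext (hsl i).lie_h_e_nsmul
      lie_h_f_nsmul := Subtype.ext (hsl i).lie_h_f_nsmul }
  lie_h_h i j := Subtype.ext (hhh i j)
  lie_h_e i j := Subtype.ext (hhe i j)
  lie_h_f i j := Subtype.ext (hhf i j)
  lie_e_f_ne i j hij := Subtype.ext (hef i j hij)

end SubalgebraBasis

section Coordinates

/-- The simple roots of `E₈` that are simple roots of the centralizer. -/
def simpleIndex (i : Fin 5) : Fin 8 := ⟨i + 2, by omega⟩

lemma so13Coroots_castSucc (i : Fin 5) :
    so13Coroots i.castSucc = Pi.single (simpleIndex i) 1 := by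
  funext j
  fin_cases i <;> fin_cases j <;> rfl

lemma form_so13Coroots_last (c : Fin 8 → ℤ) : form c (so13Coroots (Fin.last 5)) = dcoord c 1 := by
  simp only [form, pairing_explicit, Fin.sum_univ_eight]
  simp [so13Coroots, dcoord, Fin.last]
  ring

lemma so13Coroots_zero (i : Fin 6) : so13Coroots i 0 = 0 := by fin_cases i <;> rfl

lemma so13Coroots_seven (i : Fin 6) : so13Coroots i 7 = 0 := by fin_cases i <;> rfl

lemma dcoord_twelveRoots (p : Fin 6 × Bool) : dcoord (twelveRoots p) 1 =
    if p = (0, true) then 2 else if p = (0, false) then -2 else 0 := by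
  rcases p with ⟨k, _ | _⟩ <;> fin_cases k <;> rfl

lemma B_castSucc_castSucc (i j : Fin 5) : CartanMatrix.B 6 i.castSucc j.castSucc =
    CartanMatrix.E₈ (simpleIndex i) (simpleIndex j) := by
  fin_cases i <;> fin_cases j <;> rfl

lemma B_castSucc_last (i : Fin 5) : CartanMatrix.B 6 i.castSucc (Fin.last 5) =
    dcoord (Pi.single (simpleIndex i) 1) 1 := by
  fin_cases i <;> rfl

lemma B_last_castSucc (j : Fin 5) : CartanMatrix.B 6 (Fin.last 5) j.castSucc =
    pairing (sixRoots 0) (simpleIndex j) := by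
  rw [pairing_explicit]
  fin_cases j <;> rfl

lemma B_six_nondegenerate : (CartanMatrix.B 6).Nondegenerate := by
  rw [Matrix.nondegenerate_iff_det_ne_zero]
  have h : CartanMatrix.B 6 = !![2, -1, 0, 0, 0, 0; -1, 2, -1, 0, 0, 0; 0, -1, 2, -1, 0, 0;
      0, 0, -1, 2, -1, 0; 0, 0, 0, -1, 2, -2; 0, 0, 0, 0, -1, 2] := by
    ext i j
    fin_cases i <;> fin_cases j <;> rfl
  rw [h]
  simp only [norm_det]
  norm_num

end Coordinates

namespace Sl2Pair.IsSpecial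

variable {L : Type*} [LieRing L] [LieAlgebra ℂ L] {D : Sl2Pair L} (hD : D.IsSpecial)
include hD

omit hD in
lemma X_swap (x y : L) : D.X x y = -D.X y x := by rw [X, X, lie_skew]

lemma lie_X_X_u {x y : L} (hx : x ∈ D.W) (hy : y ∈ D.W) :
    ⁅D.X x D.u, D.X y D.u⁆ = (4 : ℂ) • D.X y x := by
  have hxV := D.W_le_V hx
  have hyV := D.W_le_V hy
  have huy : D.b D.u y = 0 := by rw [hD.b_symm D.u_mem (D.W_le hy), b_W_u hy]
  rw [lie_cent_X (hD.X_mem_cent hxV D.u_mem_V), hD.lie_X hxV D.u_mem_V hyV,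
    hD.lie_X hxV D.u_mem_V D.u_mem_V, huy, hD.b_u_u, b_W_u hx]
  simp only [X, mul_zero, zero_smul, zero_sub, mul_one, sub_zero, lie_neg, lie_smul, neg_lie,
    smul_lie, lie_self, smul_zero, neg_zero, zero_add]

/-- Rotations involving `u` generate the others by `lie_X_X_u`, and all rotations together span the
centralizer. -/
lemma cent_le_of_X_mem [FiniteDimensional ℂ L] [LieAlgebra.IsKilling ℂ L]
    (hW : Module.finrank ℂ D.W = 12) {K : LieSubalgebra ℂ L}
    (hK : ∀ w ∈ D.W, D.X w D.u ∈ K) : D.cent ≤ K := by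
  have hWW : ∀ x ∈ D.W, ∀ y ∈ D.W, D.X x y ∈ K := fun x hx y hy => by
    have h := K.lie_mem (hK y hy) (hK x hx)
    rw [hD.lie_X_X_u hy hx] at h
    have := K.smul_mem (1 / 4 : ℂ) h
    rwa [smul_smul, show (1 / 4 : ℂ) * 4 = 1 by norm_num, one_smul] at this
  have hVV : ∀ x ∈ D.V, ∀ y ∈ D.V, D.X x y ∈ K := fun x hx y hy => by
    obtain ⟨w, hw, a, rfl⟩ := D.mem_V hx
    obtain ⟨w', hw', a', rfl⟩ := D.mem_V hy
    have e : D.X (w + a • D.u) (w' + a' • D.u) =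
        D.X w w' + a' • D.X w D.u - a • D.X w' D.u := by
      rw [X_swap w' D.u, smul_neg, sub_neg_eq_add]
      simp only [X, lie_add, add_lie, lie_smul, smul_lie, lie_self, smul_zero, add_zero]
      abel
    rw [e]
    exact sub_mem (add_mem (hWW w hw w' hw') (K.smul_mem _ (hK w hw))) (K.smul_mem _ (hK w' hw'))
  intro x hx
  obtain ⟨B⟩ := hD.exists_orthonormalFamily hW
  obtain ⟨ψ, hψ⟩ := B.exists_so13_equiv hD
  have h := hψ (ψ.symm ⟨x, hx⟩)
  rw [LieEquiv.apply_symm_apply] at h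
  have h2 : (⟨x, hx⟩ : D.cent) = x := rfl
  have h' : x = soMap (fun i j => (1 / 4 : ℂ) • D.X (B.w i) (B.w j)) (ψ.symm ⟨x, hx⟩) := h
  rw [h']
  refine (Submodule.span_le (p := K.toSubmodule)).2 ?_ (soMap_mem_span _ _)
  rintro - ⟨⟨i, j⟩, rfl⟩
  exact K.smul_mem _ (hVV _ (B.mem i) _ (B.mem j))

end Sl2Pair.IsSpecial

section Pinning

variable {L : Type*} [LieRing L] [LieAlgebra ℂ L] {H : LieSubalgebra ℂ L}
  {b : LieAlgebra.Basis (Fin 8) H} {D : Sl2Pair L}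

lemma exists_mem_wt_twelveRoots (hb : b.A = CartanMatrix.E₈) [FiniteDimensional ℂ L]
    [H.IsCartanSubalgebra] [LieAlgebra.IsKilling ℂ L] (p : Fin 6 × Bool) :
    ∃ x ∈ wt b (twelveRoots p), x ≠ 0 :=
  exists_ne_zero_of_form_eq_two hb (twelveRoots_nonneg p) (form_twelveRoots_self p)

lemma twelveRoots_ne_zero (p : Fin 6 × Bool) : twelveRoots p ≠ 0 := fun h => by
  have := twelveRoots_zero p
  rw [h] at this
  simp at this

namespace IsRootPair

variable (hD : IsRootPair b D) (hb : b.A = CartanMatrix.E₈) [FiniteDimensional ℂ L]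
  [H.IsCartanSubalgebra] [LieAlgebra.IsKilling ℂ L] {c d : Fin 8 → ℤ} {x y : L}
include hD hb

omit hb [FiniteDimensional ℂ L] [H.IsCartanSubalgebra] [LieAlgebra.IsKilling ℂ L] in
lemma exists_eq_sum_corootComb {z : L} (hz : z ∈ H)
    (h1 : ⁅z, D.E₁⁆ = 0) (h2 : ⁅z, D.E₂⁆ = 0) :
    ∃ s : Fin 6 → ℂ, z = ∑ i, s i • corootComb b (so13Coroots i) := by
  obtain ⟨t, rfl⟩ := (mem_cartan_iff (b := b)).1 hz
  have key : ∀ {d y}, y ∈ wt b d → y ≠ 0 → ⁅∑ i, t i • b.h i, y⁆ = 0 →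
      ∑ i, t i * (pairing d i : ℂ) = 0 := fun {d y} hy hy0 h => by
    rw [mem_wt] at hy
    simp only [sum_lie, smul_lie, hy, smul_smul, ← Finset.sum_smul] at h
    exact (smul_eq_zero.1 h).resolve_right hy0
  have k1 := key hD.E₁_mem hD.E₁_ne h1
  have k2 := key hD.E₂_mem hD.E₂_ne h2
  simp [Fin.sum_univ_eight, pairing_explicit, thetaEight, thetaSeven] at k1 k2
  rw [k1, neg_zero, add_zero] at k2
  -- Only `β₆^∨` involves `α₂^∨`, with coefficient `-1`, so its coefficient is `-t 1`; the others
  -- are then corrected accordingly.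
  refine ⟨![t 2 - t 1, t 3 - 2 * t 1, t 4 - 2 * t 1, t 5 - 2 * t 1, t 6 - 2 * t 1, -t 1], ?_⟩
  simp only [corootComb, Fin.sum_univ_eight, Fin.sum_univ_six, so13Coroots]
  simp [k1, k2]
  module

omit hD hb [FiniteDimensional ℂ L] [H.IsCartanSubalgebra] [LieAlgebra.IsKilling ℂ L] in
lemma linearIndependent_corootComb :
    LinearIndependent ℂ fun i => corootComb b (so13Coroots i) := by
  rw [Fintype.linearIndependent_iff]
  intro s hs
  have h := Fintype.linearIndependent_iff.1 b.linInd
    (fun j => ∑ i, s i * (so13Coroots i j : ℂ)) (by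
      rw [← hs]
      simp only [corootComb, Finset.sum_smul, Finset.smul_sum, ← Int.cast_smul_eq_zsmul ℂ,
        smul_smul]
      exact Finset.sum_comm)
  have h1 := h 1
  have h2 := h 2
  have h3 := h 3
  have h4 := h 4
  have h5 := h 5
  have h6 := h 6
  simp [Fin.sum_univ_six, so13Coroots] at h1 h2 h3 h4 h5 h6
  rw [h1] at h2 h3 h4 h5 h6
  simp at h2 h3 h4 h5 h6
  intro i
  fin_cases i <;> simp [*]

omit hb [FiniteDimensional ℂ L] [H.IsCartanSubalgebra] [LieAlgebra.IsKilling ℂ L] in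
lemma lie_corootComb_eq_zero (i : Fin 6) : ⁅corootComb b (so13Coroots i), D.E₁⁆ = 0 ∧
    ⁅corootComb b (so13Coroots i), D.E₂⁆ = 0 := by
  rw [lie_corootComb hD.E₁_mem, lie_corootComb hD.E₂_mem, form_symm, form_thetaEight,
    form_symm, form_thetaSeven, so13Coroots_zero, so13Coroots_seven]
  simp

lemma corootComb_mem_cent_inf (i : Fin 6) :
    corootComb b (so13Coroots i) ∈ D.cent ⊓ annihilator D.u := by
  obtain ⟨h1, h2⟩ := hD.lie_corootComb_eq_zero i
  rw [hD.mem_cent_inf_annihilator hb]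
  exact ⟨sum_mem fun j _ => zsmul_mem (hD.h_mem_gr j) _, h1, h2⟩

lemma mem_cent_inf_of_wt (hx : x ∈ wt b c) (hc : c ≠ 0) (h0 : c 0 = 0) (h7 : c 7 = 0) :
    x ∈ D.cent ⊓ annihilator D.u := by
  rw [← hD.regularSubalgebra_so12 hb]
  refine mem_regularSubalgebra hb hc (fun i hi => ?_) hx
  fin_cases i <;> simp_all

lemma e_mem_cent (i : Fin 5) : b.e (simpleIndex i) ∈ D.cent ⊓ annihilator D.u :=
  hD.mem_cent_inf_of_wt hb (e_mem_wt hb _) (by simp) (by fin_cases i <;> rfl)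
    (by fin_cases i <;> rfl)

lemma f_mem_cent (i : Fin 5) : b.f (simpleIndex i) ∈ D.cent ⊓ annihilator D.u :=
  hD.mem_cent_inf_of_wt hb (f_mem_wt hb _) (by simp) (by fin_cases i <;> rfl)
    (by fin_cases i <;> rfl)

-- As `x` kills both `F` and `u`, the map `w ↦ X w u` intertwines its action; brackets in the
-- centralizer become brackets in `W`.
omit hD hb [FiniteDimensional ℂ L] [H.IsCartanSubalgebra] [LieAlgebra.IsKilling ℂ L] in
lemma lie_X_u (hx : x ∈ D.cent ⊓ annihilator D.u) (w : L) :
    ⁅x, D.X w D.u⁆ = D.X ⁅x, w⁆ D.u := by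
  have h : ⁅x, D.u⁆ = 0 := hx.2
  rw [Sl2Pair.IsSpecial.lie_cent_X hx.1, h]
  simp [Sl2Pair.X]

lemma lie_corootComb_X (hy : y ∈ wt b d) (i : Fin 6) :
    ⁅corootComb b (so13Coroots i), D.X y D.u⁆ = (form d (so13Coroots i) : ℂ) • D.X y D.u := by
  rw [lie_X_u (hD.corootComb_mem_cent_inf hb i), lie_corootComb hy]
  simp [Sl2Pair.X]

/-- Invariance of `b` under `β₆^∨`, whose eigenvalue on a weight vector is the `D₇` coordinate with
index `1`. -/
lemma b_eq_zero (hx : x ∈ wt b c) (hy : y ∈ wt b d) (h : dcoord c 1 + dcoord d 1 ≠ 0) :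
    D.b x y = 0 := by
  have := Sl2Pair.IsSpecial.b_cent (hD.corootComb_mem_cent_inf hb (Fin.last 5)).1 x y
  rw [lie_corootComb hx, lie_corootComb hy, form_so13Coroots_last, form_so13Coroots_last, map_smul,
    map_smul, LinearMap.smul_apply, smul_eq_mul, smul_eq_mul] at this
  have h' : ((dcoord c 1 + dcoord d 1 : ℤ) : ℂ) ≠ 0 := by exact_mod_cast h
  refine (mul_eq_zero.1 (?_ : ((dcoord c 1 + dcoord d 1 : ℤ) : ℂ) * D.b x y = 0)).resolve_left h'
  push_cast
  linear_combination this

omit hb [FiniteDimensional ℂ L] [H.IsCartanSubalgebra] [LieAlgebra.IsKilling ℂ L] in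
lemma mem_W_twelveRoots {p : Fin 6 × Bool} (hx : x ∈ wt b (twelveRoots p)) : x ∈ D.W :=
  hD.mem_W hx (twelveRoots_zero p) (twelveRoots_seven p)

/-- The line of `x` is orthogonal to every weight space of `W` except the opposite one, so
nondegeneracy forces a nonzero pairing there. -/
lemma b_ne_zero (hx : x ∈ wt b (twelveRoots (0, true))) (hx0 : x ≠ 0)
    (hy : y ∈ wt b (twelveRoots (0, false))) (hy0 : y ≠ 0) : D.b x y ≠ 0 := fun h => by
  refine hx0 ((hD.isSpecial hb).nondegenerate_W (hD.mem_W_twelveRoots hx) fun z hz => ?_)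
  have hle : D.W ≤ LinearMap.ker (D.b x) := by
    refine hD.W_induction hb fun p z hz => ?_
    rw [LinearMap.mem_ker]
    by_cases hp : p = (0, false)
    · rw [hp] at hz
      obtain ⟨t, rfl⟩ := exists_eq_smul hb (twelveRoots_ne_zero _) hy hy0 hz
      rw [map_smul, h, smul_zero]
    · refine hD.b_eq_zero hb hx hz ?_
      rw [dcoord_twelveRoots, dcoord_twelveRoots, if_pos rfl, if_neg hp]
      split_ifs <;> norm_num
  exact hle hz

/-- By faithfulness on `V` it suffices that both sides act equally: by `2` on `x`, by `-2` on `y`,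
and by `0` on `u` and the other weights of `W`. The scalar normalizes the first of these
eigenvalues. -/
lemma lie_X_X_eq (hx : x ∈ wt b (twelveRoots (0, true))) (hx0 : x ≠ 0)
    (hy : y ∈ wt b (twelveRoots (0, false))) (hy0 : y ≠ 0) :
    ⁅D.X x D.u, (-(8 * D.b x y)⁻¹) • D.X y D.u⁆ = corootComb b (so13Coroots (Fin.last 5)) := by
  have hS := hD.isSpecial hb
  have hxW := hD.mem_W_twelveRoots hx
  have hyW := hD.mem_W_twelveRoots hy
  have hxV := D.W_le_V hxW
  have hyV := D.W_le_V hyW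
  have hxy := hD.b_ne_zero hb hx hx0 hy hy0
  have hyx : D.b y x = D.b x y := hS.b_symm (D.W_le hyW) (D.W_le hxW)
  have hco := hD.corootComb_mem_cent_inf hb (Fin.last 5)
  rw [lie_smul, hS.lie_X_X_u hxW hyW, ← sub_eq_zero]
  refine hS.eq_zero_of_mem_cent (sub_mem (D.cent.smul_mem _ (D.cent.smul_mem _
    (hS.X_mem_cent hyV hxV))) hco.1) fun v hv => ?_
  obtain ⟨w, hw, a, rfl⟩ := D.mem_V hv
  have hu : ⁅corootComb b (so13Coroots (Fin.last 5)), D.u⁆ = 0 := hco.2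
  have huX : ⁅D.X y x, D.u⁆ = 0 := by
    rw [hS.lie_X hyV hxV D.u_mem_V, Sl2Pair.IsSpecial.b_W_u hxW, Sl2Pair.IsSpecial.b_W_u hyW]
    simp
  have hle : D.W ≤ LinearMap.ker ((LieAlgebra.ad ℂ L (-(8 * D.b x y)⁻¹ • (4 : ℂ) • D.X y x -
      corootComb b (so13Coroots (Fin.last 5))) : Module.End ℂ L)) := by
    refine hD.W_induction hb fun p z hz => ?_
    rw [LinearMap.mem_ker, LieAlgebra.ad_apply, sub_lie, smul_lie, smul_lie, lie_corootComb hz,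
      form_so13Coroots_last,
      hS.lie_X hyV hxV (D.W_le_V (hD.mem_W_twelveRoots hz)), dcoord_twelveRoots]
    have hxz : p ≠ (0, false) → D.b x z = 0 := fun hp => hD.b_eq_zero hb hx hz (by
      rw [dcoord_twelveRoots, dcoord_twelveRoots, if_pos rfl, if_neg hp]
      split_ifs <;> norm_num)
    have hyz : p ≠ (0, true) → D.b y z = 0 := fun hp => hD.b_eq_zero hb hy hz (by
      rw [dcoord_twelveRoots, dcoord_twelveRoots, if_neg (by simp), if_pos rfl, if_neg hp]
      split_ifs <;> norm_num)
    by_cases hp : p = (0, true)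
    · rw [hxz (by simp [hp]), if_pos hp]
      rw [hp] at hz
      obtain ⟨t, rfl⟩ := exists_eq_smul hb (twelveRoots_ne_zero _) hx hx0 hz
      rw [map_smul, hyx, smul_eq_mul, mul_zero, zero_smul, zero_sub, smul_neg, smul_neg, smul_smul,
        smul_smul, smul_smul, ← neg_smul, ← sub_smul]
      convert zero_smul ℂ x
      push_cast
      field_simp
      ring
    · rw [hyz hp, if_neg hp]
      by_cases hp' : p = (0, false)
      · rw [if_pos hp']
        rw [hp'] at hz
        obtain ⟨t, rfl⟩ := exists_eq_smul hb (twelveRoots_ne_zero _) hy hy0 hz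
        rw [map_smul, smul_eq_mul, mul_zero, zero_smul, sub_zero, smul_smul,
          smul_smul, smul_smul, ← sub_smul]
        convert zero_smul ℂ y
        push_cast
        field_simp
        ring
      · rw [hxz hp', if_neg hp']
        simp
  rw [lie_add, lie_smul, sub_lie _ _ D.u, smul_lie, smul_lie, huX, hu, smul_zero, smul_zero,
    sub_zero, smul_zero, add_zero]
  exact hle hw

/-- A subspace of `W` stable under the simple root vectors of the centralizer in `E₈` is everything
as soon as it contains an extreme pair of weight spaces. -/
lemma W_le_of_stable {M : Submodule ℂ L} (hMe : ∀ i, ∀ w ∈ M, ⁅b.e (simpleIndex i), w⁆ ∈ M)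
    (hMf : ∀ i, ∀ w ∈ M, ⁅b.f (simpleIndex i), w⁆ ∈ M)
    (h1 : wt b (twelveRoots (0, true)) ≤ M) (h2 : wt b (twelveRoots (0, false)) ≤ M) :
    D.W ≤ M := by
  have up : ∀ (p q : Fin 6 × Bool) (i : Fin 5),
      twelveRoots q = Pi.single (simpleIndex i) 1 + twelveRoots p →
      pairing (twelveRoots p) (simpleIndex i) = -1 → wt b (twelveRoots p) ≤ M →
      wt b (twelveRoots q) ≤ M := fun p q i hq hp hM y hy => by
    obtain ⟨x, hx, hx0⟩ := exists_mem_wt_twelveRoots hb p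
    have hz := lie_mem_wt (e_mem_wt hb (simpleIndex i)) hx
    have hz0 := lie_ne_zero hb (by simp) (e_mem_wt hb (simpleIndex i)) (b.sl2 _).e_ne_zero hx hx0
      (by rw [form_symm, form_single_right, hp]; norm_num)
    rw [← hq] at hz
    obtain ⟨t, rfl⟩ := exists_eq_smul hb (twelveRoots_ne_zero q) hz hz0 hy
    exact M.smul_mem t (hMe i x (hM hx))
  have down : ∀ (p q : Fin 6 × Bool) (i : Fin 5),
      twelveRoots q = -Pi.single (simpleIndex i) 1 + twelveRoots p →
      pairing (twelveRoots p) (simpleIndex i) = 1 → wt b (twelveRoots p) ≤ M →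
      wt b (twelveRoots q) ≤ M := fun p q i hq hp hM y hy => by
    obtain ⟨x, hx, hx0⟩ := exists_mem_wt_twelveRoots hb p
    have hz := lie_mem_wt (f_mem_wt hb (simpleIndex i)) hx
    have hz0 := lie_ne_zero hb (by simp) (f_mem_wt hb (simpleIndex i)) (b.sl2 _).f_ne_zero hx hx0
      (by rw [form_symm, form_neg_right, form_single_right, hp]; norm_num)
    rw [← hq] at hz
    obtain ⟨t, rfl⟩ := exists_eq_smul hb (twelveRoots_ne_zero q) hz hz0 hy
    exact M.smul_mem t (hMf i x (hM hx))
  -- Two chains of length six cover all twelve weights: one climbs through `α₇, α₆, α₅, α₄, α₃`, the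
  -- other descends through the same roots.
  have u1 := up (0, true) (1, true) 4 (by decide) (by decide) h1
  have u2 := up (1, true) (2, true) 3 (by decide) (by decide) u1
  have u3 := up (2, true) (3, true) 2 (by decide) (by decide) u2
  have u4 := up (3, true) (4, true) 1 (by decide) (by decide) u3
  have u5 := up (4, true) (5, true) 0 (by decide) (by decide) u4
  have d1 := down (0, false) (1, false) 4 (by decide) (by decide) h2
  have d2 := down (1, false) (2, false) 3 (by decide) (by decide) d1
  have d3 := down (2, false) (3, false) 2 (by decide) (by decide) d2
  have d4 := down (3, false) (4, false) 1 (by decide) (by decide) d3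
  have d5 := down (4, false) (5, false) 0 (by decide) (by decide) d4
  refine hD.W_induction hb ?_
  rintro ⟨k, _ | _⟩ x hx <;> fin_cases k
  exacts [h2 hx, d1 hx, d2 hx, d3 hx, d4 hx, d5 hx, h1 hx, u1 hx, u2 hx, u3 hx, u4 hx, u5 hx]

end IsRootPair

end Pinning

/-! ### Dimension of `𝔰𝔬ₙ` and assembly of the theorem -/

lemma finrank_so (n : ℕ) :
    Module.finrank ℂ (so n) = Fintype.card {p : Fin n × Fin n // p.1 < p.2} := by
  let T : so n →ₗ[ℂ] ({p : Fin n × Fin n // p.1 < p.2} → ℂ) :=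
    { toFun := fun A p => (A : Matrix (Fin n) (Fin n) ℂ) p.1.1 p.1.2
      map_add' := fun _ _ => rfl
      map_smul' := fun _ _ => rfl }
  have hinj : Function.Injective T := by
    rw [injective_iff_map_eq_zero]
    intro A hA
    have h : ∀ i j, i < j → (A : Matrix (Fin n) (Fin n) ℂ) i j = 0 := fun i j hij =>
      congrFun hA ⟨(i, j), hij⟩
    refine Subtype.ext (Matrix.ext fun i j => ?_)
    change (A : Matrix (Fin n) (Fin n) ℂ) i j = 0
    rcases lt_trichotomy i j with hij | rfl | hij
    · exact h i j hij
    · have := so_apply_swap A i i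
      exact self_eq_neg.1 this
    · rw [so_apply_swap, h j i hij, neg_zero]
  have hsurj : Function.Surjective T := fun g => by
    refine ⟨⟨Matrix.of fun i j => if h : i < j then g ⟨(i, j), h⟩ else
      if h : j < i then -g ⟨(j, i), h⟩ else 0, ?_⟩, funext fun p => ?_⟩
    · rw [LieAlgebra.Orthogonal.mem_so]
      ext i j
      rw [Matrix.transpose_apply, Matrix.neg_apply, Matrix.of_apply, Matrix.of_apply]
      rcases lt_trichotomy i j with hij | rfl | hij
      · simp [hij, hij.not_gt]
      · simp
      · simp [hij, hij.not_gt]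
    · change (if h : _ then _ else _) = _
      rw [dif_pos p.2]
  rw [(LinearEquiv.ofBijective T ⟨hinj, hsurj⟩).finrank_eq, Module.finrank_fintype_fun_eq_card]

section Main

variable {L : Type*} [LieRing L] [LieAlgebra ℂ L] {H : LieSubalgebra ℂ L}
  {b : LieAlgebra.Basis (Fin 8) H} {D : Sl2Pair L}

namespace IsRootPair

variable (hD : IsRootPair b D) (hb : b.A = CartanMatrix.E₈) [FiniteDimensional ℂ L]
  [H.IsCartanSubalgebra] [LieAlgebra.IsKilling ℂ L]
include hD hb

/-- The pinning of the centralizer of the diagonal `𝔰𝔩₂`. -/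
lemma exists_basis_cent : ∃ b' : LieAlgebra.Basis (Fin 6) (H.comap D.cent.incl),
    b'.A = CartanMatrix.B 6 ∧ ∀ i, (b'.h i : L) = corootComb b (so13Coroots i) := by
  have hS := hD.isSpecial hb
  obtain ⟨x, hx, hx0⟩ := exists_mem_wt_twelveRoots hb (0, true)
  obtain ⟨y, hy, hy0⟩ := exists_mem_wt_twelveRoots hb (0, false)
  have hxV := D.W_le_V (hD.mem_W_twelveRoots hx)
  have hyV := D.W_le_V (hD.mem_W_twelveRoots hy)
  have hxy := hD.b_ne_zero hb hx hx0 hy hy0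
  have hef := hD.lie_X_X_eq hb hx hx0 hy hy0
  have hco := hD.corootComb_mem_cent_inf hb
  set t := -(8 * D.b x y)⁻¹ with ht
  let e : Fin 6 → L := Fin.lastCases (D.X x D.u) fun i => b.e (simpleIndex i)
  let f : Fin 6 → L := Fin.lastCases (t • D.X y D.u) fun i => b.f (simpleIndex i)
  let h : Fin 6 → L := fun i => corootComb b (so13Coroots i)
  have e_last : e (Fin.last 5) = D.X x D.u := Fin.lastCases_last
  have f_last : f (Fin.last 5) = t • D.X y D.u := Fin.lastCases_last
  have e_cast (i : Fin 5) : e i.castSucc = b.e (simpleIndex i) := Fin.lastCases_castSucc i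
  have f_cast (i : Fin 5) : f i.castSucc = b.f (simpleIndex i) := Fin.lastCases_castSucc i
  have h_cast (i : Fin 5) : h i.castSucc = b.h (simpleIndex i) := by
    simp only [h]
    rw [so13Coroots_castSucc, corootComb_single]
  have hform (j : Fin 6) : form (twelveRoots (0, true)) (so13Coroots j) =
      CartanMatrix.B 6 (Fin.last 5) j := by
    induction j using Fin.lastCases with
    | last => rw [form_so13Coroots_last]; rfl
    | cast j => rw [so13Coroots_castSucc, form_single_right, B_last_castSucc]; rfl
  have hform' (j : Fin 6) : form (twelveRoots (0, false)) (so13Coroots j) =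
      -CartanMatrix.B 6 (Fin.last 5) j := by
    rw [form_symm, form_twelveRoots_false, so13Coroots_zero, ← hform, form_symm, zero_sub]
    rfl
  have hformc (i : Fin 5) (j : Fin 6) : form (Pi.single (simpleIndex i) 1) (so13Coroots j) =
      CartanMatrix.B 6 i.castSucc j := by
    induction j using Fin.lastCases with
    | last => rw [form_so13Coroots_last, B_castSucc_last]
    | cast j => rw [so13Coroots_castSucc, form_single_right, pairing_single, B_castSucc_castSucc]
  have lhe (i j : Fin 6) : ⁅h j, e i⁆ = CartanMatrix.B 6 i j • e i := by
    induction i using Fin.lastCases with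
    | last => rw [e_last, hD.lie_corootComb_X hb hx, hform, Int.cast_smul_eq_zsmul]
    | cast i => rw [e_cast, lie_corootComb (e_mem_wt hb _), hformc, Int.cast_smul_eq_zsmul]
  have lhf (i j : Fin 6) : ⁅h j, f i⁆ = -CartanMatrix.B 6 i j • f i := by
    induction i using Fin.lastCases with
    | last =>
      rw [f_last, lie_smul, hD.lie_corootComb_X hb hy, hform', Int.cast_smul_eq_zsmul, smul_comm]
    | cast i =>
      rw [f_cast, lie_corootComb (f_mem_wt hb _), form_neg_left, hformc, Int.cast_smul_eq_zsmul]
  have hdiag (i : Fin 6) : CartanMatrix.B 6 i i = 2 := by fin_cases i <;> rfl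
  have hlief (i : Fin 6) : ⁅e i, f i⁆ = h i := by
    induction i using Fin.lastCases with
    | last => rw [e_last, f_last, hef]
    | cast i => rw [e_cast, f_cast, h_cast, (b.sl2 _).lie_e_f]
  have hli : LinearIndependent ℂ h := linearIndependent_corootComb
  refine ⟨subalgebraBasis H D.cent (CartanMatrix.B 6) B_six_nondegenerate h e f
    (fun i => (hco i).1) (fun i => ?_) (fun i => ?_) (fun i => corootComb_mem _)
    (fun z hz hzc => ?_) (fun K he hf => ?_) hli (fun i => ⟨hli.ne_zero i, hlief i, ?_, ?_⟩)
    (fun i j => ?_) lhe lhf (fun i j hij => ?_), rfl, fun i => rfl⟩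
  · induction i using Fin.lastCases with
    | last => rw [e_last]; exact hS.X_mem_cent hxV D.u_mem_V
    | cast i => rw [e_cast]; exact (hD.e_mem_cent hb i).1
  · induction i using Fin.lastCases with
    | last => rw [f_last]; exact D.cent.smul_mem _ (hS.X_mem_cent hyV D.u_mem_V)
    | cast i => rw [f_cast]; exact (hD.f_mem_cent hb i).1
  · have hz0 := mem_wt_zero_of_mem (b := b) hz
    have hu : ⁅D.h₁, z⁆ = 0 := by
      rw [hD.lie_h₁ hz0]
      simp
    have h8 := lie_mem_wt hz0 hD.E₁_mem
    have h7 := lie_mem_wt hz0 hD.E₂_mem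
    rw [zero_add] at h8 h7
    have hE : ⁅z, D.E₁⁆ + ⁅z, D.E₂⁆ = 0 := by
      rw [← lie_add]
      exact hzc.1
    -- `⁅z, E₁⁆` and `⁅z, E₂⁆` have distinct `h₁`-eigenvalues `2` and `0`, so the vanishing of their
    -- sum makes each vanish.
    have h1 := congrArg (fun v => ⁅D.h₁, v⁆) hE
    simp only [lie_add, lie_zero, hD.lie_h₁ h8, hD.lie_h₁ h7] at h1
    have hz1 : ⁅z, D.E₁⁆ = 0 := by simpa [thetaEight, thetaSeven] using h1
    exact hD.exists_eq_sum_corootComb hz hz1 (by rwa [hz1, zero_add] at hE)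
  · refine hS.cent_le_of_X_mem (hD.finrank_W hb) fun w hw => ?_
    -- Generation is transported to `W`: this subspace is stable under `b.e` and `b.f` for `α₃, …,
    -- α₇`, and it contains the two extreme weight spaces.
    let M : Submodule ℂ L :=
      { carrier := {w | D.X w D.u ∈ K}
        add_mem' := fun {v w} hv hw => by
          have := K.add_mem (show D.X v D.u ∈ K from hv) (show D.X w D.u ∈ K from hw)
          rwa [Set.mem_ofPred_eq, Sl2Pair.X, lie_add, add_lie]
        zero_mem' := by simp [Sl2Pair.X]
        smul_mem' := fun s w hw => by
          have := K.smul_mem s hw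
          rwa [Set.mem_ofPred_eq, Sl2Pair.X, lie_smul, smul_lie] }
    have hlast := he (Fin.last 5)
    have hlast' := hf (Fin.last 5)
    rw [e_last] at hlast
    rw [f_last] at hlast'
    refine hD.W_le_of_stable hb (M := M) (fun i w hw => ?_) (fun i w hw => ?_) (fun z hz => ?_)
      (fun z hz => ?_) hw
    · change D.X _ _ ∈ K
      rw [← lie_X_u (hD.e_mem_cent hb i), ← e_cast]
      exact K.lie_mem (he _) hw
    · change D.X _ _ ∈ K
      rw [← lie_X_u (hD.f_mem_cent hb i), ← f_cast]
      exact K.lie_mem (hf _) hw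
    · obtain ⟨s, rfl⟩ := exists_eq_smul hb (twelveRoots_ne_zero _) hx hx0 hz
      exact M.smul_mem s hlast
    · obtain ⟨s, rfl⟩ := exists_eq_smul hb (twelveRoots_ne_zero _) hy hy0 hz
      refine M.smul_mem s ?_
      have ht0 : t ≠ 0 := by simp [ht, hxy]
      have := K.smul_mem t⁻¹ hlast'
      rwa [smul_smul, inv_mul_cancel₀ ht0, one_smul] at this
  · rw [lhe, hdiag, ofNat_zsmul]
  · rw [lhf, hdiag, neg_smul, ofNat_zsmul]
  · have := lie_corootComb (mem_wt_zero_of_mem (b := b) (corootComb_mem (b := b) (so13Coroots j)))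
      (so13Coroots i)
    simpa using this
  · induction i using Fin.lastCases with
    | last =>
      induction j using Fin.lastCases with
      | last => exact absurd rfl hij
      | cast j =>
        rw [e_last, f_cast, ← lie_skew, lie_X_u (hD.f_mem_cent hb j), neg_eq_zero]
        have : ⁅b.f (simpleIndex j), x⁆ = 0 := by
          refine lie_eq_zero_of_form_nonneg hb (by simp) (twelveRoots_ne_zero _) (f_mem_wt hb _) hx
            ?_ ?_
          · intro h0
            have := congrFun h0 0
            fin_cases j <;> simp [simpleIndex, twelveRoots_zero] at this
          · rw [form_symm, form_neg_right, form_single_right]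
            fin_cases j <;> decide
        rw [this]
        simp [Sl2Pair.X]
    | cast i =>
      induction j using Fin.lastCases with
      | last =>
        rw [e_cast, f_last, lie_smul, lie_X_u (hD.e_mem_cent hb i)]
        have : ⁅b.e (simpleIndex i), y⁆ = 0 := by
          refine lie_eq_zero_of_form_nonneg hb (by simp) (twelveRoots_ne_zero _) (e_mem_wt hb _) hy
            ?_ ?_
          · intro h0
            have := congrFun h0 0
            fin_cases i <;> simp [simpleIndex, twelveRoots_zero] at this
          · rw [form_symm, form_single_right]
            fin_cases i <;> decide
        rw [this]
        simp [Sl2Pair.X]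
      | cast j =>
        rw [e_cast, f_cast]
        refine b.lie_e_f_ne _ _ fun h0 => hij ?_
        simp only [simpleIndex, Fin.mk.injEq] at h0
        exact congrArg _ (Fin.ext (by omega))

/-- A rotation in the plane of `u` and a vector of `W` centralizes the triple but moves `u`. -/
lemma regularSubalgebra_lt_cent : regularSubalgebra b {1, 2, 3, 4, 5, 6} < D.cent := by
  have hS := hD.isSpecial hb
  rw [hD.regularSubalgebra_so12 hb]
  refine lt_of_le_of_ne inf_le_left fun h => ?_
  obtain ⟨x, hx, hx0⟩ := exists_mem_wt_twelveRoots hb (0, true)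
  have hxW := hD.mem_W_twelveRoots hx
  have hX := hS.X_mem_cent (D.W_le_V hxW) D.u_mem_V
  rw [← h] at hX
  have h2 : ⁅D.X x D.u, D.u⁆ = 0 := hX.2
  rw [hS.lie_X (D.W_le_V hxW) D.u_mem_V D.u_mem_V, hS.b_u_u, Sl2Pair.IsSpecial.b_W_u hxW] at h2
  simp [hx0] at h2

/-- Strictness is witnessed by `h₁ - h₂`, which is orthogonal to `h` but does not commute with `E`.
-/
lemma cent_lt_regularSubalgebra : D.cent < regularSubalgebra b {1, 2, 3, 4, 5, 6, 7} := by
  rw [hD.regularSubalgebra_so14 hb]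
  refine lt_of_le_of_ne (fun x hx => ⟨D.cent_le hx, ?_⟩) fun h => ?_
  · rw [← D.lie_E_F, ← killingForm_lie_left, hx.1, map_zero, LinearMap.zero_apply]
  · have h1 : D.h₁ - D.h₂ ∈ D.levi := by
      have m1 := mem_wt_zero_of_mem (b := b) (corootComb_mem (b := b) thetaEight)
      have m2 := mem_wt_zero_of_mem (b := b) (corootComb_mem (b := b) thetaSeven)
      refine ⟨?_, ?_⟩
      · have := hD.mem_gr (sub_mem m1 m2)
        rw [hD.h₁_eq, hD.h₂_eq]
        simpa using this
      · rw [hD.h_eq, hD.h₁_eq, hD.h₂_eq, map_sub, LinearMap.sub_apply, killingForm_corootComb hb,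
          killingForm_corootComb hb]
        simp only [form_add_right, form_thetaEight, form_thetaSeven]
        simp [thetaEight, thetaSeven]
    rw [← h] at h1
    have h2 : ⁅D.h₁ - D.h₂, D.E₁ + D.E₂⁆ = 0 := h1.1
    rw [sub_lie, lie_add, lie_add, D.lie_h₁_E₁, D.lie_h₂_E₂, D.lie_h₁_E₂, D.lie_h₂_E₁] at h2
    have h3 := congrArg (fun v => ⁅D.h₁, v⁆) h2
    simp only [lie_sub, lie_add, lie_smul, D.lie_h₁_E₁, D.lie_h₁_E₂, lie_zero] at h3
    simp [hD.E₁_ne] at h3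

lemma finrank_cent : Module.finrank ℂ D.cent = 78 := by
  obtain ⟨B⟩ := (hD.isSpecial hb).exists_orthonormalFamily (hD.finrank_W hb)
  obtain ⟨ψ, -⟩ := B.exists_so13_equiv (hD.isSpecial hb)
  rw [← ψ.toLinearEquiv.finrank_eq, finrank_so]
  rfl

end IsRootPair

lemma map_sl2_eq (φ : sl2 →ₗ⁅ℂ⁆ L) (X : sl2) : φ X =
    slEntry 0 1 X • φ slE + slEntry 1 0 X • φ slF + slEntry 0 0 X • φ slH := by
  conv_lhs => rw [sl2_eq X]
  rw [map_add, map_add, map_smul, map_smul, map_smul]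
  rfl

/-- A Lie algebra homomorphism from `𝔰𝔩₂` given by the diagonal triple. -/
lemma centralizer_range_eq {φ : sl2 →ₗ⁅ℂ⁆ L} (hE : φ slE = D.E) (hF : φ slF = D.F) :
    centralizer φ.range = D.cent := by
  ext x
  rw [mem_centralizer, D.mem_cent]
  constructor
  · intro h
    exact ⟨h _ ⟨slE, hE⟩, h _ ⟨slF, hF⟩⟩
  · rintro ⟨h1, h2⟩ - ⟨X, rfl⟩
    have hH : φ slH = D.h := by rw [← lie_slE_slF, LieHom.map_lie, hE, hF, D.lie_E_F]
    have h3 : ⁅x, D.h⁆ = 0 := by rw [← D.lie_E_F, leibniz_lie, h1, h2, zero_lie, lie_zero, add_zero]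
    change ⁅x, φ X⁆ = 0
    rw [map_sl2_eq]
    simp only [hE, hF, hH, lie_add, lie_smul, h1, h2, h3, smul_zero,
      add_zero]

/-- The sum of two homomorphisms with commuting images. -/
def addHom (φ₁ φ₂ : sl2 →ₗ⁅ℂ⁆ L) (h : ∀ X Y, ⁅φ₁ X, φ₂ Y⁆ = 0) : sl2 →ₗ⁅ℂ⁆ L :=
  { (φ₁ : sl2 →ₗ[ℂ] L) + (φ₂ : sl2 →ₗ[ℂ] L) with
    map_lie' := fun {X Y} => by
      have h' : ⁅φ₂ X, φ₁ Y⁆ = 0 := by rw [← lie_skew, h, neg_zero]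
      change φ₁ ⁅X, Y⁆ + φ₂ ⁅X, Y⁆ = ⁅φ₁ X + φ₂ X, φ₁ Y + φ₂ Y⁆
      rw [lie_add, add_lie, add_lie, h, h', LieHom.map_lie, LieHom.map_lie, add_zero, zero_add] }

lemma addHom_apply (φ₁ φ₂ : sl2 →ₗ⁅ℂ⁆ L) (h : ∀ X Y, ⁅φ₁ X, φ₂ Y⁆ = 0) (X : sl2) :
    addHom φ₁ φ₂ h X = φ₁ X + φ₂ X := rfl

lemma slE_ne_zero : slE ≠ 0 := fun h => by
  have := congrArg (slEntry 0 1) h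
  rw [slEntry_apply, coe_slE] at this
  simp at this

variable (hb : b.A = CartanMatrix.E₈) [FiniteDimensional ℂ L] [H.IsCartanSubalgebra]
  [LieAlgebra.IsKilling ℂ L]
include hb

lemma eq_thetaEight_of_isGreatest {θ : Fin 8 → ℤ} (hθ : IsGreatest (rootsOn b Set.univ) θ) :
    θ = thetaEight := by
  obtain ⟨hc, -, x, hx, hx0⟩ := (mem_rootsOn hb).1 hθ.1
  refine eq_thetaEight (form_self_eq_two hb hc hx hx0) (hθ.2 ((mem_rootsOn hb).2 ⟨fun h => ?_,
    fun i hi => absurd trivial hi,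
    exists_ne_zero_of_form_eq_two hb thetaEight_nonneg form_thetaEight_self⟩))
  simpa [thetaEight] using congrFun h 0

lemma eq_thetaSeven_of_isGreatest {θ : Fin 8 → ℤ}
    (hθ : IsGreatest (rootsOn b {0, 1, 2, 3, 4, 5, 6}) θ) : θ = thetaSeven := by
  obtain ⟨hc, h7, x, hx, hx0⟩ := (mem_rootsOn hb).1 hθ.1
  refine eq_thetaSeven (form_self_eq_two hb hc hx hx0) (hθ.2 ((mem_rootsOn hb).2 ⟨fun h => ?_,
    fun i hi => ?_,
    exists_ne_zero_of_form_eq_two hb thetaSeven_nonneg form_thetaSeven_self⟩)) (h7 7 (by simp))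
  · simpa [thetaSeven] using congrFun h 0
  · fin_cases i <;> simp_all [thetaSeven]

lemma isRootEmbedding_facts {c : Fin 8 → ℤ} (hc : c ≠ 0) {φ : sl2 →ₗ⁅ℂ⁆ L}
    (hφ : IsRootEmbedding b c φ) : φ slE ∈ wt b c ∧ φ slF ∈ wt b (-c) ∧ φ slE ≠ 0 ∧
      killingForm ℂ L (φ slE) (φ slF) = kap b ∧ φ slH = corootComb b c := by
  obtain ⟨hinj, hE, hF⟩ := hφ
  rw [mem_rootSpace_iff hb] at hE hF
  have hE0 : φ slE ≠ 0 := fun h => slE_ne_zero (hinj (h.trans (map_zero φ).symm))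
  have h := lie_eq_corootComb hb hc hE hE0 hF (by
    rw [← LieHom.map_lie, lie_slE_slF, ← LieHom.map_lie, lie_slH_slE, map_smul])
  rw [← LieHom.map_lie, lie_slE_slF] at h
  exact ⟨hE, hF, hE0, h.1, h.2⟩

/-- The pair of triples attached to root embeddings of the two highest roots. -/
lemma exists_isRootPair {φ₁ φ₂ : sl2 →ₗ⁅ℂ⁆ L} (h₁ : IsRootEmbedding b thetaEight φ₁)
    (h₂ : IsRootEmbedding b thetaSeven φ₂) : ∃ D : Sl2Pair L, IsRootPair b D ∧
      D.E₁ = φ₁ slE ∧ D.F₁ = φ₁ slF ∧ D.h₁ = φ₁ slH ∧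
      D.E₂ = φ₂ slE ∧ D.F₂ = φ₂ slF ∧ D.h₂ = φ₂ slH := by
  have h8 : thetaEight ≠ 0 := fun h => by simpa [thetaEight] using congrFun h 0
  have h7 : thetaSeven ≠ 0 := fun h => by simpa [thetaSeven] using congrFun h 0
  obtain ⟨hE₁, hF₁, hE₁0, hk₁, hh₁⟩ := isRootEmbedding_facts hb h8 h₁
  obtain ⟨hE₂, hF₂, hE₂0, hk₂, hh₂⟩ := isRootEmbedding_facts hb h7 h₂
  have hadd : thetaEight + thetaSeven ≠ 0 := fun h => by
    simpa [thetaEight, thetaSeven] using congrFun h 0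
  have hsub : thetaEight - thetaSeven ≠ 0 := fun h => by
    simpa [thetaEight, thetaSeven] using congrFun h 7
  have h0 := form_thetaEight_thetaSeven
  let D : Sl2Pair L :=
    { E₁ := φ₁ slE
      F₁ := φ₁ slF
      h₁ := φ₁ slH
      E₂ := φ₂ slE
      F₂ := φ₂ slF
      h₂ := φ₂ slH
      lie_E₁_F₁ := by rw [← LieHom.map_lie, lie_slE_slF]
      lie_h₁_E₁ := by rw [← LieHom.map_lie, lie_slH_slE, map_smul]
      lie_h₁_F₁ := by rw [← LieHom.map_lie, lie_slH_slF, map_smul]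
      lie_E₂_F₂ := by rw [← LieHom.map_lie, lie_slE_slF]
      lie_h₂_E₂ := by rw [← LieHom.map_lie, lie_slH_slE, map_smul]
      lie_h₂_F₂ := by rw [← LieHom.map_lie, lie_slH_slF, map_smul]
      lie_E₁_E₂ := lie_eq_zero_of_form_nonneg hb h8 h7 hE₁ hE₂ hadd h0.ge
      lie_E₁_F₂ := lie_eq_zero_of_form_nonneg hb h8 (neg_ne_zero.2 h7) hE₁ hF₂
        (by rwa [← sub_eq_add_neg]) (by rw [form_neg_right, h0, neg_zero])
      lie_F₁_E₂ := lie_eq_zero_of_form_nonneg hb (neg_ne_zero.2 h8) h7 hF₁ hE₂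
        (by rwa [neg_add_eq_sub, ← neg_sub, neg_ne_zero]) (by rw [form_neg_left, h0, neg_zero])
      lie_F₁_F₂ := lie_eq_zero_of_form_nonneg hb (neg_ne_zero.2 h8) (neg_ne_zero.2 h7) hF₁ hF₂
        (by rwa [← neg_add, neg_ne_zero]) (by rw [form_neg_left, form_neg_right, neg_neg, h0]) }
  exact ⟨D, ⟨hE₁, hF₁, hE₂, hF₂, hE₁0, hE₂0, hh₁, hh₂, hk₁, hk₂⟩, rfl, rfl, rfl, rfl, rfl, rfl⟩

end Main

end E8

end

theorem mainTheorem8 {L : Type*} [LieRing L] [LieAlgebra ℂ L] [FiniteDimensional ℂ L]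
    [LieAlgebra.IsSimple ℂ L] (H : LieSubalgebra ℂ L) [H.IsCartanSubalgebra]
    (b : LieAlgebra.Basis (Fin 8) H) (hb : b.A = CartanMatrix.E₈)
    (θ θ' : Fin 8 → ℤ)
    (hθ : IsGreatest (E8.rootsOn b Set.univ) θ)
    (hθ' : IsGreatest (E8.rootsOn b {0, 1, 2, 3, 4, 5, 6}) θ')
    (φ₁ φ₂ : E8.sl2 →ₗ⁅ℂ⁆ L)
    (hφ₁ : E8.IsRootEmbedding b θ φ₁) (hφ₂ : E8.IsRootEmbedding b θ' φ₂) :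
    ∃ φ : E8.sl2 →ₗ⁅ℂ⁆ L,
      (∀ X, φ X = φ₁ X + φ₂ X) ∧ Function.Injective φ ∧
      (∀ i, killingForm ℂ L (φ E8.slH) (φ E8.slH) = 2 * killingForm ℂ L (b.h i) (b.h i)) ∧
      Module.finrank ℂ (E8.centralizer φ.range) = 78 ∧
      E8.regularSubalgebra b {1, 2, 3, 4, 5, 6} < E8.centralizer φ.range ∧
      E8.centralizer φ.range < E8.regularSubalgebra b {1, 2, 3, 4, 5, 6, 7} ∧
      Nonempty (E8.regularSubalgebra b {1, 2, 3, 4, 5, 6} ≃ₗ⁅ℂ⁆ E8.so 12) ∧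
      Nonempty (E8.regularSubalgebra b {1, 2, 3, 4, 5, 6, 7} ≃ₗ⁅ℂ⁆ E8.so 14) ∧
      (∃ b' : LieAlgebra.Basis (Fin 6) (H.comap (E8.centralizer φ.range).incl),
        b'.A = CartanMatrix.B 6 ∧
        ∀ i, (b'.h i : L) = E8.corootComb b (E8.so13Coroots i)) ∧
      ∃ (ψ : E8.so 13 ≃ₗ⁅ℂ⁆ E8.centralizer φ.range)
        (S : Type) (_ : AddCommGroup S) (_ : Module ℂ S)
        (spin : E8.so 13 →ₗ⁅ℂ⁆ Module.End ℂ S)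
        (Φ : L ≃ₗ[ℂ]
          (TensorProduct ℂ ℂ (E8.so 13) × TensorProduct ℂ (Fin 2 → ℂ) S ×
            TensorProduct ℂ E8.sl2 ℂ × TensorProduct ℂ E8.sl2 (Fin 13 → ℂ))),
        E8.IsSpinRep spin ∧
        ∀ (X : E8.sl2) (A : E8.so 13) (v : L),
          Φ ⁅φ X + (ψ A : L), v⁆ =
            E8.directSumRep
              (E8.boxTensorRep (E8.trivialRep E8.sl2) (E8.adjointRep (E8.so 13)))
              (E8.directSumRep
                (E8.boxTensorRep (E8.naturalRep E8.sl2) spin)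
                (E8.directSumRep
                  (E8.boxTensorRep (E8.adjointRep E8.sl2) (E8.trivialRep (E8.so 13)))
                  (E8.boxTensorRep (E8.adjointRep E8.sl2) (E8.naturalRep (E8.so 13)))))
              (X, A) (Φ v) := by
  have hK : LieAlgebra.IsKilling ℂ L := inferInstance
  obtain rfl := E8.eq_thetaEight_of_isGreatest hb hθ
  obtain rfl := E8.eq_thetaSeven_of_isGreatest hb hθ'
  obtain ⟨D, hD, hE₁, hF₁, hh₁, hE₂, hF₂, hh₂⟩ := E8.exists_isRootPair hb hφ₁ hφ₂
  have hS := hD.isSpecial hb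
  have hcomm : ∀ X Y, ⁅φ₁ X, φ₂ Y⁆ = 0 := fun X Y => by
    have l1 := D.lie_E₁_E₂
    have l2 := D.lie_E₁_F₂
    have l3 := D.lie_F₁_E₂
    have l4 := D.lie_F₁_F₂
    have l5 := D.lie_h₁_E₂
    have l6 := D.lie_h₁_F₂
    have l7 := D.lie_h₁_h₂
    have l8 : ⁅D.E₁, D.h₂⁆ = 0 := by rw [← lie_skew, D.lie_h₂_E₁, neg_zero]
    have l9 : ⁅D.F₁, D.h₂⁆ = 0 := by rw [← lie_skew, D.lie_h₂_F₁, neg_zero]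
    rw [E8.map_sl2_eq φ₁, E8.map_sl2_eq φ₂]
    simp only [← hE₁, ← hF₁, ← hh₁, ← hE₂, ← hF₂, ← hh₂, lie_add,
      add_lie, lie_smul, smul_lie, l1, l2, l3, l4, l5, l6, l7, l8, l9, smul_zero, add_zero]
  have hφE : E8.addHom φ₁ φ₂ hcomm E8.slE = D.E := by
    rw [E8.addHom_apply, ← hE₁, ← hE₂]
    rfl
  have hφF : E8.addHom φ₁ φ₂ hcomm E8.slF = D.F := by
    rw [E8.addHom_apply, ← hF₁, ← hF₂]
    rfl
  have hφH : E8.addHom φ₁ φ₂ hcomm E8.slH = D.h := by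
    rw [E8.addHom_apply, ← hh₁, ← hh₂]
    rfl
  refine ⟨E8.addHom φ₁ φ₂ hcomm, fun X => rfl, ?_, fun i => ?_, ?_⟩
  · rw [injective_iff_map_eq_zero]
    intro X hX
    -- If the sum kills `X`, then `φ₁ X` lies in the image of `φ₂` and commutes with the image of
    -- `φ₁`. Thus `X` is central in `𝔰𝔩₂`, hence zero.
    have h1 : φ₁ X = -φ₂ X := eq_neg_of_add_eq_zero_left hX
    have h2 : ∀ Y : E8.sl2, φ₁ ⁅X, Y⁆ = 0 := fun Y => by
      rw [LieHom.map_lie, h1, neg_lie, ← lie_skew, hcomm, neg_zero, neg_zero]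
    have h3 : ∀ Y : E8.sl2, ⁅X, Y⁆ = 0 := fun Y => hφ₁.1 ((h2 Y).trans (map_zero φ₁).symm)
    have e1 := congrArg (E8.slEntry 0 0) (h3 E8.slE)
    have e2 := congrArg (E8.slEntry 0 0) (h3 E8.slF)
    have e3 := congrArg (E8.slEntry 0 1) (h3 E8.slE)
    rw [E8.slEntry_lie_zero_zero] at e1 e2
    rw [E8.slEntry_lie_zero_one] at e3
    simp only [E8.slEntry_apply, E8.coe_slE, E8.coe_slF] at e1 e2 e3
    simp at e1 e2 e3
    rw [E8.sl2_eq X, e1, e2, e3, zero_smul, zero_smul, zero_smul, add_zero, add_zero]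
  · have hii : CartanMatrix.E₈ i i = 2 := CartanMatrix.E₈_diag i
    rw [hφH, hD.h_eq, E8.killingForm_corootComb hb, E8.killingForm_h_h hb, hii]
    simp only [E8.form_add_right, E8.form_thetaEight, E8.form_thetaSeven]
    simp [E8.thetaEight, E8.thetaSeven]
    ring
  rw [E8.centralizer_range_eq hφE hφF]
  obtain ⟨B⟩ := hS.exists_orthonormalFamily (hD.finrank_W hb)
  obtain ⟨ψ, hψ⟩ := B.exists_so13_equiv hS
  -- The spin module is degree `1` in coordinates, so that its carrier lies in `Type` whatever the
  -- universe of `L`.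
  refine ⟨hD.finrank_cent hb, hD.regularSubalgebra_lt_cent hb, hD.cent_lt_regularSubalgebra hb,
    B.exists_so12_equiv hS _ fun x => ?_, B.exists_so14_equiv hS _ fun x => ?_,
    hD.exists_basis_cent hb, ψ, Fin (Module.finrank ℂ (D.gr 1)) → ℂ, inferInstance, inferInstance,
    ?_⟩
  · rw [hD.regularSubalgebra_so12 hb]
    rfl
  · rw [hD.regularSubalgebra_so14 hb]
    rfl
  let P : E8.Sl2Pair.Decomposition D (Fin (Module.finrank ℂ (D.gr 1)) → ℂ) :=
    { special := hS
      family := B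
      φ := E8.addHom φ₁ φ₂ hcomm
      φ_slE := hφE
      φ_slF := hφF
      ψ := ψ
      ψ_apply := hψ
      e := (Module.finBasis ℂ (D.gr 1)).equivFun.symm }
  have hnt : Nontrivial (D.gr 1) := ⟨⟨⟨b.e 0, hD.e_zero_mem hb⟩, 0, fun h =>
    (b.sl2 0).e_ne_zero (congrArg Subtype.val h)⟩⟩
  have : Nontrivial (Fin (Module.finrank ℂ (D.gr 1)) → ℂ) := P.e.toEquiv.nontrivial
  exact ⟨P.spin, P.equiv, P.isSpinRep (fun N => hD.gr_one_irreducible hb N), P.equiv_lie⟩
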